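/- A table algebra $(A,B)$ is a finite-dimensional commutative $\mathbb C$-algebra $A$ with a distinguished basis $B\ni 1$ such that: all structure constants with respect to $B$ are nonnegative reals; there is an algebra automorphism $a\mapsto\bar a$ of $A$ with $\bar{\bar a}=a$ that maps $B$ to $B$; and there is $g:B\times B\to\mathbb R_{>0}$ such that, for all $u,v,w\in B$, the coefficient of $w$ in $uv$ is $g(u,w)$ times the coefficient of $u$ in $\bar v w$. It is normalized if this holds with $g\equiv1$. The degree of an element is its value under the (unique) algebra homomorphism $A\to\mathbb C$ that is positive on $B$. A NITA is a normalized table algebra whose structure constants and degrees of basis elements are nonnegative integers. Let $(\cdot,\cdot)$ be the Hermitian form on $A$ for which $B$ is orthonormal; $a\in A$ is real if $\bar a=a$. A table subset is a subset $S\subseteq B$ that contains $1$, is closed under $\bar{\ }$, and contains all basis elements occurring in products of two elements of $S$; $(A,B)$ is generated by $b\in B$ if $B$ is the only table subset containing $b$. A basis element written with a subscript $n$ has degree $n$. **Theorem.** Let $(A,B)$ be a NITA generated by a non-real element $b_3\in B$ of degree $3$, without non-identity basis elements of degree $1$ or $2$, such that $\bar b_3b_3=1+b_8$ and $b_3^2=c_3+b_6$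 with $b_8,c_3,b_6\in B$, $c_3=\bar c_3$, and $(b_8b_3,b_8b_3)=3$. Then $A$ has dimension $22$, and there are $x_6,x_{15},x_{10},x_9,y_{15},y_9,d_3,z_9,c_8,b_5,c_5,y_3\in B$ such that $B$ consists of the $22$ distinct elements $$1,\ \bar b_3,\ b_3,\ c_3,\ b_6,\ x_6,\ \bar x_6,\ b_8,\ x_{15},\ \bar x_{15},\ x_{10},\ x_9,\ \bar x_9,\ y_{15},\ y_9,\ d_3,\ \bar d_3,\ z_9,\ c_8,\ b_5,\ c_5,\ y_3;$$ the elements $c_3,b_6,b_8,x_{10},y_{15},y_9,z_9,c_8,b_5,c_5,y_3$ are real; $B$ has the increasing series of table subsets $$\{1\}\subseteq\{1,b_8,x_{10},z_9,c_8,b_5,c_5\}\subseteq B;$$ and the multiplication is given (up to order of the factors and application of $\bar{\ }$) by: $b_{3}\bar b_{3}=1+b_{8}$; $b_{3}^2=c_{3}+b_{6}$; $b_{3}c_{3}=\bar b_{3}+\bar x_{6}$; $b_{3}b_{6}=\bar b_{3}+\bar x_{15}$; $b_{3}x_{6}=c_{3}+y_{15}$; $b_{3}\bar x_{6}=b_{8}+x_{10}$;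 $b_{3}b_{8}=x_{6}+b_{3}+x_{15}$; $b_{3}x_{15}=2y_{15}+b_{6}+y_{9}$; $b_{3}x_{10}=x_{15}+x_{6}+x_{9}$; $b_{3}\bar x_{15}=x_{10}+b_{8}+z_{9}+c_{8}+b_{5}+c_{5}$; $b_{3}x_{9}=y_{9}+y_{15}+y_{3}$; $b_{3}\bar x_{9}=x_{10}+z_{9}+c_{8}$; $b_{3}y_{15}=2\bar x_{15}+\bar x_{6}+\bar x_{9}$; $b_{3}y_{9}=d_{3}+\bar x_{15}+\bar x_{9}$; $b_{3}d_{3}=z_{9}$; $b_{3}\bar d_{3}=y_{9}$; $b_{3}z_{9}=x_{9}+\bar d_{3}+x_{15}$; $b_{3}c_{8}=x_{15}+x_{9}$; $b_{3}b_{5}=x_{15}$; $b_{3}c_{5}=x_{15}$; $b_{3}y_{3}=\bar x_{9}$; $c_{3}^2=1+b_{8}$; $c_{3}b_{6}=b_{8}+x_{10}$; $c_{3}x_{6}=\bar b_{3}+\bar x_{15}$; $c_{3}b_{8}=b_{6}+c_{3}+y_{15}$; $c_{3}x_{15}=2\bar x_{15}+\bar x_{6}+\bar x_{9}$; $c_{3}x_{10}=b_{6}+y_{15}+y_{9}$;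 $c_{3}x_{9}=d_{3}+\bar x_{15}+\bar x_{9}$; $c_{3}y_{15}=x_{10}+b_{8}+z_{9}+c_{8}+b_{5}+c_{5}$; $c_{3}y_{9}=z_{9}+x_{10}+c_{8}$; $c_{3}d_{3}=x_{9}$; $c_{3}z_{9}=y_{3}+y_{9}+y_{15}$; $c_{3}c_{8}=y_{9}+y_{15}$; $c_{3}b_{5}=y_{15}$; $c_{3}c_{5}=y_{15}$; $c_{3}y_{3}=z_{9}$; $b_{6}^2=1+b_{8}+z_{9}+c_{8}+b_{5}+c_{5}$; $b_{6}x_{6}=2\bar x_{6}+\bar x_{15}+\bar x_{9}$; $b_{6}b_{8}=2y_{15}+b_{6}+y_{9}+c_{3}$; $b_{6}x_{15}=4\bar x_{15}+\bar x_{6}+2\bar x_{9}+\bar b_{3}+d_{3}$; $b_{6}x_{10}=c_{3}+3y_{15}+y_{9}+y_{3}$; $b_{6}x_{9}=2\bar x_{15}+2\bar x_{9}+\bar x_{6}$; $b_{6}y_{15}=2b_{8}+3x_{10}+2z_{9}+2c_{8}+b_{5}+c_{5}$; $b_{6}y_{9}=b_{8}+2z_{9}+c_{8}+x_{10}+b_{5}+c_{5}$;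 $b_{6}d_{3}=\bar d_{3}+x_{15}$; $b_{6}z_{9}=2y_{15}+2y_{9}+b_{6}$; $b_{6}c_{8}=b_{6}+y_{3}+y_{9}+2y_{15}$; $b_{6}b_{5}=y_{15}+y_{9}+b_{6}$; $b_{6}c_{5}=y_{15}+b_{6}+y_{9}$; $b_{6}y_{3}=x_{10}+c_{8}$; $x_{6}^2=2b_{6}+y_{15}+y_{9}$; $x_{6}\bar x_{6}=1+b_{8}+z_{9}+c_{8}+b_{5}+c_{5}$; $x_{6}b_{8}=b_{3}+2x_{15}+x_{6}+x_{9}$; $x_{6}x_{15}=4y_{15}+b_{6}+2y_{9}+c_{3}+y_{3}$; $x_{6}x_{10}=b_{3}+3x_{15}+\bar d_{3}+x_{9}$; $x_{6}\bar x_{15}=2b_{8}+3x_{10}+2z_{9}+2c_{8}+b_{5}+c_{5}$; $x_{6}x_{9}=2y_{15}+2y_{9}+b_{6}$; $x_{6}\bar x_{9}=x_{10}+b_{8}+2z_{9}+c_{8}+b_{5}+c_{5}$; $x_{6}y_{15}=4\bar x_{15}+2\bar x_{9}+\bar x_{6}+\bar b_{3}+d_{3}$; $x_{6}y_{9}=2\bar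 x_{15}+2\bar x_{9}+\bar x_{6}$; $x_{6}d_{3}=x_{10}+c_{8}$; $x_{6}\bar d_{3}=y_{15}+y_{3}$; $x_{6}z_{9}=2x_{9}+2x_{15}+x_{6}$; $x_{6}c_{8}=2x_{15}+x_{6}+x_{9}+\bar d_{3}$; $x_{6}b_{5}=x_{6}+x_{15}+x_{9}$; $x_{6}c_{5}=x_{15}+x_{9}+x_{6}$; $x_{6}y_{3}=d_{3}+\bar x_{15}$; $b_{8}^2=1+2b_{8}+2x_{10}+z_{9}+c_{8}+b_{5}+c_{5}$; $b_{8}x_{10}=2x_{10}+2z_{9}+2c_{8}+2b_{8}+b_{5}+c_{5}$; $b_{8}x_{9}=3x_{15}+2x_{9}+x_{6}+\bar d_{3}$; $b_{8}y_{15}=5y_{15}+2b_{6}+3y_{9}+c_{3}+y_{3}$; $b_{8}y_{9}=3y_{15}+2y_{9}+b_{6}+y_{3}$; $b_{8}d_{3}=\bar x_{15}+\bar x_{9}$; $b_{8}z_{9}=2x_{10}+b_{8}+2c_{8}+2z_{9}+b_{5}+c_{5}$; $b_{8}c_{8}=2x_{10}+2z_{9}+b_{8}+c_{8}+b_{5}+c_{5}$;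 $b_{8}b_{5}=b_{8}+z_{9}+c_{5}+c_{8}+x_{10}$; $b_{8}c_{5}=b_{8}+x_{10}+c_{8}+z_{9}+b_{5}$; $b_{8}y_{3}=y_{9}+y_{15}$; $b_{8}x_{15}=5x_{15}+2x_{6}+3x_{9}+b_{3}+\bar d_{3}$; $x_{15}^2=9y_{15}+4b_{6}+6y_{9}+2c_{3}+2y_{3}$; $x_{15}x_{10}=3x_{6}+6x_{15}+b_{3}+\bar d_{3}+4x_{9}$; $x_{15}\bar x_{15}=5b_{8}+6x_{10}+6z_{9}+5c_{8}+3b_{5}+3c_{5}+1$; $x_{15}x_{9}=6y_{15}+3y_{9}+2b_{6}+c_{3}+y_{3}$; $x_{15}\bar x_{9}=3b_{8}+4x_{10}+3z_{9}+3c_{8}+2b_{5}+2c_{5}$; $x_{15}y_{15}=4\bar x_{6}+9\bar x_{15}+6\bar x_{9}+2\bar b_{3}+2d_{3}$; $x_{15}y_{9}=6\bar x_{15}+2\bar x_{6}+3\bar x_{9}+\bar b_{3}+d_{3}$; $x_{15}d_{3}=b_{8}+z_{9}+b_{5}+c_{5}+x_{10}+c_{8}$; $x_{15}\bar d_{3}=2y_{15}+y_{9}+b_{6}$;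 $x_{15}z_{9}=2x_{6}+6x_{15}+b_{3}+\bar d_{3}+3x_{9}$; $x_{15}c_{8}=5x_{15}+2x_{6}+3x_{9}+b_{3}+\bar d_{3}$; $x_{15}b_{5}=x_{6}+3x_{15}+2x_{9}+b_{3}+\bar d_{3}$; $x_{15}c_{5}=x_{6}+3x_{15}+2x_{9}+b_{3}+\bar d_{3}$; $x_{15}y_{3}=\bar x_{6}+2\bar x_{15}+\bar x_{9}$; $x_{10}^2=1+2b_{8}+2x_{10}+2c_{8}+2b_{5}+2c_{5}+3z_{9}$; $x_{10}x_{9}=b_{3}+4x_{15}+\bar d_{3}+2x_{9}+x_{6}$; $x_{10}y_{15}=6y_{15}+3b_{6}+4y_{9}+c_{3}+y_{3}$; $x_{10}y_{9}=4y_{15}+2y_{9}+y_{3}+b_{6}+c_{3}$; $x_{10}d_{3}=\bar x_{15}+\bar x_{6}+\bar x_{9}$; $x_{10}z_{9}=3x_{10}+b_{5}+c_{5}+2b_{8}+2z_{9}+2c_{8}$; $x_{10}c_{8}=2x_{10}+2c_{8}+2b_{8}+2z_{9}+b_{5}+c_{5}$; $x_{10}b_{5}=b_{8}+2x_{10}+z_{9}+c_{8}+b_{5}$;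 $x_{10}c_{5}=b_{8}+z_{9}+c_{5}+2x_{10}+c_{8}$; $x_{10}y_{3}=y_{15}+y_{9}+b_{6}$; $x_{9}^2=y_{3}+c_{3}+2b_{6}+3y_{15}+2y_{9}$; $x_{9}\bar x_{9}=1+2b_{8}+2x_{10}+2c_{8}+2z_{9}+b_{5}+c_{5}$; $x_{9}y_{15}=6\bar x_{15}+2\bar x_{6}+3\bar x_{9}+\bar b_{3}+d_{3}$; $x_{9}y_{9}=d_{3}+3\bar x_{15}+2\bar x_{9}+\bar b_{3}+2\bar x_{6}$; $x_{9}d_{3}=x_{10}+b_{8}+z_{9}$; $x_{9}\bar d_{3}=y_{9}+c_{3}+y_{15}$; $x_{9}z_{9}=3x_{15}+2x_{9}+2x_{6}+b_{3}+\bar d_{3}$; $x_{9}b_{5}=2x_{15}+x_{6}+x_{9}$; $x_{9}c_{5}=2x_{15}+x_{6}+x_{9}$; $x_{9}y_{3}=\bar b_{3}+\bar x_{9}+\bar x_{15}$; $y_{15}^2=1+3b_{5}+6x_{10}+6z_{9}+5b_{8}+3c_{5}+5c_{8}$; $y_{15}y_{9}=4x_{10}+3b_{8}+3z_{9}+3c_{8}+2c_{5}+2b_{5}$;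 $y_{15}d_{3}=2x_{15}+x_{6}+x_{9}$; $y_{15}z_{9}=6y_{15}+2b_{6}+3y_{9}+c_{3}+y_{3}$; $y_{15}c_{8}=2b_{6}+5y_{15}+c_{3}+y_{3}+3y_{9}$; $y_{15}b_{5}=b_{6}+3y_{15}+2y_{9}+c_{3}+y_{3}$; $y_{15}c_{5}=b_{6}+c_{3}+3y_{15}+y_{3}+2y_{9}$; $y_{15}y_{3}=b_{5}+b_{8}+z_{9}+c_{5}+x_{10}+c_{8}$; $y_{9}^2=1+2z_{9}+2b_{8}+2c_{8}+2x_{10}+b_{5}+c_{5}$; $y_{9}d_{3}=b_{3}+x_{15}+x_{9}$; $y_{9}z_{9}=3y_{15}+2b_{6}+2y_{9}+c_{3}+y_{3}$; $y_{9}c_{8}=3y_{15}+2y_{9}+b_{6}+c_{3}$; $y_{9}b_{5}=2y_{15}+b_{6}+y_{9}$; $y_{9}c_{5}=2y_{15}+y_{9}+b_{6}$; $y_{9}y_{3}=z_{9}+b_{8}+x_{10}$; $d_{3}\bar d_{3}=1+c_{8}$; $d_{3}^2=b_{6}+y_{3}$; $d_{3}z_{9}=\bar b_{3}+\bar x_{15}+\bar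 x_{9}$; $d_{3}c_{8}=\bar x_{15}+d_{3}+\bar x_{6}$; $d_{3}b_{5}=\bar x_{15}$; $d_{3}c_{5}=\bar x_{15}$; $d_{3}y_{3}=\bar d_{3}+x_{6}$; $z_{9}^2=1+2x_{10}+2z_{9}+2b_{8}+2c_{8}+b_{5}+c_{5}$; $z_{9}c_{8}=2x_{10}+2b_{8}+2z_{9}+b_{5}+c_{5}+c_{8}$; $z_{9}b_{5}=x_{10}+b_{8}+z_{9}+c_{8}+b_{5}+c_{5}$; $z_{9}c_{5}=x_{10}+b_{8}+z_{9}+c_{8}+b_{5}+c_{5}$; $z_{9}y_{3}=y_{9}+c_{3}+y_{15}$; $c_{8}^2=1+2c_{8}+2x_{10}+b_{8}+z_{9}+b_{5}+c_{5}$; $c_{8}b_{5}=b_{8}+z_{9}+c_{5}+x_{10}+c_{8}$; $c_{8}c_{5}=b_{8}+z_{9}+x_{10}+c_{8}+b_{5}$; $c_{8}y_{3}=b_{6}+y_{3}+y_{15}$; $b_{5}^2=1+b_{5}+x_{10}+z_{9}$; $b_{5}c_{5}=b_{8}+z_{9}+c_{8}$; $b_{5}y_{3}=y_{15}$; $c_{5}^2=1+z_{9}+x_{10}+c_{5}$;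 $c_{5}y_{3}=y_{15}$; $y_{3}^2=1+c_{8}$; $x_{9}c_{8}=3x_{15}+2x_{9}+x_{6}+b_{3}$. -/

import Mathlib

/-- A table algebra: a finite dimensional commutative complex algebra `A` with a distinguished
basis, indexed by the finite type `ι`, that contains `1`. -/
structure TableAlgebra (ι A : Type*) [Fintype ι] [CommRing A] [Algebra ℂ A] where
  /-- the table basis -/
  basis : Module.Basis ι ℂ A
  /-- the index of the basis element `1` -/
  one : ι
  basis_one : basis one = 1
  /-- the structure constants are nonnegative real numbers -/
  structure_nonneg : ∀ i j m, ∃ r : ℝ, 0 ≤ r ∧ basis.repr (basis i * basis j) m = (r : ℂ)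
  /-- the algebra automorphism of order dividing two -/
  bar : A ≃ₐ[ℂ] A
  bar_bar : ∀ a, bar (bar a) = a
  bar_basis : ∀ i, ∃ j, bar (basis i) = basis j
  /-- the coefficient of `m` in `i * j` is `g i m > 0` times the coefficient of `i` in
  `bar j * m`, with `g i m` independent of `j` -/
  exists_weight : ∃ g : ι → ι → ℝ, (∀ i m, 0 < g i m) ∧ ∀ i j m,
    basis.repr (basis i * basis j) m = (g i m : ℂ) * basis.repr (bar (basis j) * basis m) i

namespace TableAlgebra

variable {ι A : Type*} [Fintype ι] [CommRing A] [Algebra ℂ A]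

/-- The table basis as a subset of the algebra. -/
def B (T : TableAlgebra ι A) : Set A := Set.range T.basis

/-- The table basis is normalized: the weight function `g` is identically `1`. -/
def IsNormalized (T : TableAlgebra ι A) : Prop :=
  ∀ i j m, T.basis.repr (T.basis i * T.basis j) m
    = T.basis.repr (T.bar (T.basis j) * T.basis m) i

/-- An element is real if it is fixed by the automorphism `bar`. -/
def IsReal (T : TableAlgebra ι A) (a : A) : Prop := T.bar a = a

/-- The Hermitian form for which the table basis is orthonormal. -/
noncomputable def form (T : TableAlgebra ι A) (a c : A) : ℂ :=
  ∑ i, T.basis.repr a i * (starRingEnd ℂ) (T.basis.repr c i)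

/-- A degree homomorphism: an algebra homomorphism to `ℂ` with positive real values on the
table basis. -/
def IsDegreeHom (T : TableAlgebra ι A) (f : A →ₐ[ℂ] ℂ) : Prop :=
  ∀ i, ∃ r : ℝ, 0 < r ∧ f (T.basis i) = (r : ℂ)

/-- There is at most one degree homomorphism. -/
theorem IsDegreeHom.unique (T : TableAlgebra ι A) {f g : A →ₐ[ℂ] ℂ}
    (hf : T.IsDegreeHom f) (hg : T.IsDegreeHom g) : f = g := by
  classical
  have key : ∀ {f g : A →ₐ[ℂ] ℂ}, ∀ {v w : ι → ℝ}, (∀ i, 0 < v i ∧ f (T.basis i) = (v i : ℂ)) →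
      (∀ i, 0 < w i ∧ g (T.basis i) = (w i : ℂ)) → ∀ b, w b ≤ v b := by
    intro f g v w hv hw b
    choose s hs0 hs using T.structure_nonneg
    have expand : ∀ {h : A →ₐ[ℂ] ℂ} {u : ι → ℝ}, (∀ i, 0 < u i ∧ h (T.basis i) = (u i : ℂ)) →
        ∀ j, u b * u j = ∑ m, s b j m * u m := by
      intro h u hu j
      have h1 := congrArg h (T.basis.sum_repr (T.basis b * T.basis j))
      rw [map_sum, map_mul h, (hu b).2, (hu j).2] at h1
      simp only [map_smul, smul_eq_mul, hs, (hu _).2] at h1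
      exact_mod_cast h1.symm
    obtain ⟨k, -, hk⟩ := Finset.exists_max_image Finset.univ (fun m => w m / v m)
      ⟨b, Finset.mem_univ b⟩
    have hle : ∀ m, w m ≤ w k / v k * v m := fun m =>
      (div_le_iff₀ (hv m).1).1 (hk m (Finset.mem_univ m))
    have h2 : w b * w k ≤ v b * w k := by
      calc w b * w k = ∑ m, s b k m * w m := expand hw k
        _ ≤ ∑ m, s b k m * (w k / v k * v m) :=
          Finset.sum_le_sum fun m _ => mul_le_mul_of_nonneg_left (hle m) (hs0 b k m)
        _ = w k / v k * ∑ m, s b k m * v m := by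
          rw [Finset.mul_sum]; exact Finset.sum_congr rfl fun m _ => by ring
        _ = w k / v k * (v b * v k) := by rw [← expand hv k]
        _ = v b * w k := by have := (hv k).1.ne'; field_simp
    exact le_of_mul_le_mul_right h2 (hw k).1
  choose v hv using hf
  choose w hw using hg
  have h : ∀ i, f (T.basis i) = g (T.basis i) := fun i => by
    rw [(hv i).2, (hw i).2, le_antisymm (key hw hv i) (key hv hw i)]
  exact AlgHom.toLinearMap_injective (T.basis.ext h)

open Classical in
/-- The degree of an element: its value under the unique degree homomorphism (with the
convention `0` if there were none). -/
noncomputable def degree (T : TableAlgebra ι A) (a : A) : ℂ :=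
  if h : ∃ f : A →ₐ[ℂ] ℂ, T.IsDegreeHom f then h.choose a else 0

theorem degree_eq (T : TableAlgebra ι A) {f : A →ₐ[ℂ] ℂ} (hf : T.IsDegreeHom f) (a : A) :
    T.degree a = f a := by
  have h : ∃ f : A →ₐ[ℂ] ℂ, T.IsDegreeHom f := ⟨f, hf⟩
  rw [degree, dif_pos h, IsDegreeHom.unique T h.choose_spec hf]

/-- The table algebra is integral: structure constants and degrees are nonnegative integers. -/
def IsIntegral (T : TableAlgebra ι A) : Prop :=
  (∀ i j m, ∃ n : ℕ, T.basis.repr (T.basis i * T.basis j) m = (n : ℂ)) ∧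
    ∀ i, ∃ n : ℕ, T.degree (T.basis i) = (n : ℂ)

/-- A normalized integral table algebra. -/
def IsNITA (T : TableAlgebra ι A) : Prop := T.IsNormalized ∧ T.IsIntegral

/-- `a` is a basis element of degree `n`. -/
def IsBasisElt (T : TableAlgebra ι A) (n : ℕ) (a : A) : Prop := a ∈ T.B ∧ T.degree a = (n : ℂ)

/-- A table subset: a set of basis elements that contains `1`, is closed under `bar`, and
contains all irreducible constituents of products of two of its elements. -/
def IsTableSubset (T : TableAlgebra ι A) (S : Set A) : Prop :=
  S ⊆ T.B ∧ (1 : A) ∈ S ∧ (∀ a ∈ S, T.bar a ∈ S) ∧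
    ∀ a ∈ S, ∀ c ∈ S, ∀ i, T.basis.repr (a * c) i ≠ 0 → T.basis i ∈ S

/-- The table algebra is generated by `b`: the only table subset containing `b` is the
whole table basis. -/
def IsGeneratedBy (T : TableAlgebra ι A) (b : A) : Prop :=
  ∀ S : Set A, T.IsTableSubset S → b ∈ S → S = T.B

end TableAlgebra

/-- The multiplication table of the table algebra with the 22 basis elements `1`,
`b3`, `bar b3`, `c3`, `b6`, `x6`, `bar x6`, `b8`, `x15`, `bar x15`, `x10`, `x9`, `bar x9`, `y15`,
`y9`, `d3`, `bar d3`, `z9`, `c8`, `b5`, `c5`, `y3`. Every product of two basis elements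
different from `1` is listed, up to order of the factors and application of `bar`. -/
structure B22Products {A : Type*} [CommRing A] (bar : A → A)
    (b3 c3 b6 x6 b8 x15 x10 x9 y15 y9 d3 z9 c8 b5 c5 y3 : A) : Prop where
  b3_mul_b3bar : b3 * bar b3 = 1 + b8
  b3_sq : b3 ^ 2 = c3 + b6
  b3_mul_c3 : b3 * c3 = bar b3 + bar x6
  b3_mul_b6 : b3 * b6 = bar b3 + bar x15
  b3_mul_x6 : b3 * x6 = c3 + y15
  b3_mul_x6bar : b3 * bar x6 = b8 + x10
  b3_mul_b8 : b3 * b8 = x6 + b3 + x15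
  b3_mul_x15 : b3 * x15 = 2 * y15 + b6 + y9
  b3_mul_x10 : b3 * x10 = x15 + x6 + x9
  b3_mul_x15bar : b3 * bar x15 = x10 + b8 + z9 + c8 + b5 + c5
  b3_mul_x9 : b3 * x9 = y9 + y15 + y3
  b3_mul_x9bar : b3 * bar x9 = x10 + z9 + c8
  b3_mul_y15 : b3 * y15 = 2 * bar x15 + bar x6 + bar x9
  b3_mul_y9 : b3 * y9 = d3 + bar x15 + bar x9
  b3_mul_d3 : b3 * d3 = z9
  b3_mul_d3bar : b3 * bar d3 = y9
  b3_mul_z9 : b3 * z9 = x9 + bar d3 + x15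
  b3_mul_c8 : b3 * c8 = x15 + x9
  b3_mul_b5 : b3 * b5 = x15
  b3_mul_c5 : b3 * c5 = x15
  b3_mul_y3 : b3 * y3 = bar x9
  c3_sq : c3 ^ 2 = 1 + b8
  c3_mul_b6 : c3 * b6 = b8 + x10
  c3_mul_x6 : c3 * x6 = bar b3 + bar x15
  c3_mul_b8 : c3 * b8 = b6 + c3 + y15
  c3_mul_x15 : c3 * x15 = 2 * bar x15 + bar x6 + bar x9
  c3_mul_x10 : c3 * x10 = b6 + y15 + y9
  c3_mul_x9 : c3 * x9 = d3 + bar x15 + bar x9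
  c3_mul_y15 : c3 * y15 = x10 + b8 + z9 + c8 + b5 + c5
  c3_mul_y9 : c3 * y9 = z9 + x10 + c8
  c3_mul_d3 : c3 * d3 = x9
  c3_mul_z9 : c3 * z9 = y3 + y9 + y15
  c3_mul_c8 : c3 * c8 = y9 + y15
  c3_mul_b5 : c3 * b5 = y15
  c3_mul_c5 : c3 * c5 = y15
  c3_mul_y3 : c3 * y3 = z9
  b6_sq : b6 ^ 2 = 1 + b8 + z9 + c8 + b5 + c5
  b6_mul_x6 : b6 * x6 = 2 * bar x6 + bar x15 + bar x9
  b6_mul_b8 : b6 * b8 = 2 * y15 + b6 + y9 + c3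
  b6_mul_x15 : b6 * x15 = 4 * bar x15 + bar x6 + 2 * bar x9 + bar b3 + d3
  b6_mul_x10 : b6 * x10 = c3 + 3 * y15 + y9 + y3
  b6_mul_x9 : b6 * x9 = 2 * bar x15 + 2 * bar x9 + bar x6
  b6_mul_y15 : b6 * y15 = 2 * b8 + 3 * x10 + 2 * z9 + 2 * c8 + b5 + c5
  b6_mul_y9 : b6 * y9 = b8 + 2 * z9 + c8 + x10 + b5 + c5
  b6_mul_d3 : b6 * d3 = bar d3 + x15
  b6_mul_z9 : b6 * z9 = 2 * y15 + 2 * y9 + b6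
  b6_mul_c8 : b6 * c8 = b6 + y3 + y9 + 2 * y15
  b6_mul_b5 : b6 * b5 = y15 + y9 + b6
  b6_mul_c5 : b6 * c5 = y15 + b6 + y9
  b6_mul_y3 : b6 * y3 = x10 + c8
  x6_sq : x6 ^ 2 = 2 * b6 + y15 + y9
  x6_mul_x6bar : x6 * bar x6 = 1 + b8 + z9 + c8 + b5 + c5
  x6_mul_b8 : x6 * b8 = b3 + 2 * x15 + x6 + x9
  x6_mul_x15 : x6 * x15 = 4 * y15 + b6 + 2 * y9 + c3 + y3
  x6_mul_x10 : x6 * x10 = b3 + 3 * x15 + bar d3 + x9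
  x6_mul_x15bar : x6 * bar x15 = 2 * b8 + 3 * x10 + 2 * z9 + 2 * c8 + b5 + c5
  x6_mul_x9 : x6 * x9 = 2 * y15 + 2 * y9 + b6
  x6_mul_x9bar : x6 * bar x9 = x10 + b8 + 2 * z9 + c8 + b5 + c5
  x6_mul_y15 : x6 * y15 = 4 * bar x15 + 2 * bar x9 + bar x6 + bar b3 + d3
  x6_mul_y9 : x6 * y9 = 2 * bar x15 + 2 * bar x9 + bar x6
  x6_mul_d3 : x6 * d3 = x10 + c8
  x6_mul_d3bar : x6 * bar d3 = y15 + y3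
  x6_mul_z9 : x6 * z9 = 2 * x9 + 2 * x15 + x6
  x6_mul_c8 : x6 * c8 = 2 * x15 + x6 + x9 + bar d3
  x6_mul_b5 : x6 * b5 = x6 + x15 + x9
  x6_mul_c5 : x6 * c5 = x15 + x9 + x6
  x6_mul_y3 : x6 * y3 = d3 + bar x15
  b8_sq : b8 ^ 2 = 1 + 2 * b8 + 2 * x10 + z9 + c8 + b5 + c5
  b8_mul_x10 : b8 * x10 = 2 * x10 + 2 * z9 + 2 * c8 + 2 * b8 + b5 + c5
  b8_mul_x9 : b8 * x9 = 3 * x15 + 2 * x9 + x6 + bar d3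
  b8_mul_y15 : b8 * y15 = 5 * y15 + 2 * b6 + 3 * y9 + c3 + y3
  b8_mul_y9 : b8 * y9 = 3 * y15 + 2 * y9 + b6 + y3
  b8_mul_d3 : b8 * d3 = bar x15 + bar x9
  b8_mul_z9 : b8 * z9 = 2 * x10 + b8 + 2 * c8 + 2 * z9 + b5 + c5
  b8_mul_c8 : b8 * c8 = 2 * x10 + 2 * z9 + b8 + c8 + b5 + c5
  b8_mul_b5 : b8 * b5 = b8 + z9 + c5 + c8 + x10
  b8_mul_c5 : b8 * c5 = b8 + x10 + c8 + z9 + b5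
  b8_mul_y3 : b8 * y3 = y9 + y15
  b8_mul_x15 : b8 * x15 = 5 * x15 + 2 * x6 + 3 * x9 + b3 + bar d3
  x15_sq : x15 ^ 2 = 9 * y15 + 4 * b6 + 6 * y9 + 2 * c3 + 2 * y3
  x15_mul_x10 : x15 * x10 = 3 * x6 + 6 * x15 + b3 + bar d3 + 4 * x9
  x15_mul_x15bar : x15 * bar x15 = 5 * b8 + 6 * x10 + 6 * z9 + 5 * c8 + 3 * b5 + 3 * c5 + 1
  x15_mul_x9 : x15 * x9 = 6 * y15 + 3 * y9 + 2 * b6 + c3 + y3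
  x15_mul_x9bar : x15 * bar x9 = 3 * b8 + 4 * x10 + 3 * z9 + 3 * c8 + 2 * b5 + 2 * c5
  x15_mul_y15 : x15 * y15 = 4 * bar x6 + 9 * bar x15 + 6 * bar x9 + 2 * bar b3 + 2 * d3
  x15_mul_y9 : x15 * y9 = 6 * bar x15 + 2 * bar x6 + 3 * bar x9 + bar b3 + d3
  x15_mul_d3 : x15 * d3 = b8 + z9 + b5 + c5 + x10 + c8
  x15_mul_d3bar : x15 * bar d3 = 2 * y15 + y9 + b6
  x15_mul_z9 : x15 * z9 = 2 * x6 + 6 * x15 + b3 + bar d3 + 3 * x9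
  x15_mul_c8 : x15 * c8 = 5 * x15 + 2 * x6 + 3 * x9 + b3 + bar d3
  x15_mul_b5 : x15 * b5 = x6 + 3 * x15 + 2 * x9 + b3 + bar d3
  x15_mul_c5 : x15 * c5 = x6 + 3 * x15 + 2 * x9 + b3 + bar d3
  x15_mul_y3 : x15 * y3 = bar x6 + 2 * bar x15 + bar x9
  x10_sq : x10 ^ 2 = 1 + 2 * b8 + 2 * x10 + 2 * c8 + 2 * b5 + 2 * c5 + 3 * z9
  x10_mul_x9 : x10 * x9 = b3 + 4 * x15 + bar d3 + 2 * x9 + x6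
  x10_mul_y15 : x10 * y15 = 6 * y15 + 3 * b6 + 4 * y9 + c3 + y3
  x10_mul_y9 : x10 * y9 = 4 * y15 + 2 * y9 + y3 + b6 + c3
  x10_mul_d3 : x10 * d3 = bar x15 + bar x6 + bar x9
  x10_mul_z9 : x10 * z9 = 3 * x10 + b5 + c5 + 2 * b8 + 2 * z9 + 2 * c8
  x10_mul_c8 : x10 * c8 = 2 * x10 + 2 * c8 + 2 * b8 + 2 * z9 + b5 + c5
  x10_mul_b5 : x10 * b5 = b8 + 2 * x10 + z9 + c8 + b5
  x10_mul_c5 : x10 * c5 = b8 + z9 + c5 + 2 * x10 + c8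
  x10_mul_y3 : x10 * y3 = y15 + y9 + b6
  x9_sq : x9 ^ 2 = y3 + c3 + 2 * b6 + 3 * y15 + 2 * y9
  x9_mul_x9bar : x9 * bar x9 = 1 + 2 * b8 + 2 * x10 + 2 * c8 + 2 * z9 + b5 + c5
  x9_mul_y15 : x9 * y15 = 6 * bar x15 + 2 * bar x6 + 3 * bar x9 + bar b3 + d3
  x9_mul_y9 : x9 * y9 = d3 + 3 * bar x15 + 2 * bar x9 + bar b3 + 2 * bar x6
  x9_mul_d3 : x9 * d3 = x10 + b8 + z9
  x9_mul_d3bar : x9 * bar d3 = y9 + c3 + y15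
  x9_mul_z9 : x9 * z9 = 3 * x15 + 2 * x9 + 2 * x6 + b3 + bar d3
  x9_mul_b5 : x9 * b5 = 2 * x15 + x6 + x9
  x9_mul_c5 : x9 * c5 = 2 * x15 + x6 + x9
  x9_mul_y3 : x9 * y3 = bar b3 + bar x9 + bar x15
  y15_sq : y15 ^ 2 = 1 + 3 * b5 + 6 * x10 + 6 * z9 + 5 * b8 + 3 * c5 + 5 * c8
  y15_mul_y9 : y15 * y9 = 4 * x10 + 3 * b8 + 3 * z9 + 3 * c8 + 2 * c5 + 2 * b5
  y15_mul_d3 : y15 * d3 = 2 * x15 + x6 + x9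
  y15_mul_z9 : y15 * z9 = 6 * y15 + 2 * b6 + 3 * y9 + c3 + y3
  y15_mul_c8 : y15 * c8 = 2 * b6 + 5 * y15 + c3 + y3 + 3 * y9
  y15_mul_b5 : y15 * b5 = b6 + 3 * y15 + 2 * y9 + c3 + y3
  y15_mul_c5 : y15 * c5 = b6 + c3 + 3 * y15 + y3 + 2 * y9
  y15_mul_y3 : y15 * y3 = b5 + b8 + z9 + c5 + x10 + c8
  y9_sq : y9 ^ 2 = 1 + 2 * z9 + 2 * b8 + 2 * c8 + 2 * x10 + b5 + c5
  y9_mul_d3 : y9 * d3 = b3 + x15 + x9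
  y9_mul_z9 : y9 * z9 = 3 * y15 + 2 * b6 + 2 * y9 + c3 + y3
  y9_mul_c8 : y9 * c8 = 3 * y15 + 2 * y9 + b6 + c3
  y9_mul_b5 : y9 * b5 = 2 * y15 + b6 + y9
  y9_mul_c5 : y9 * c5 = 2 * y15 + y9 + b6
  y9_mul_y3 : y9 * y3 = z9 + b8 + x10
  d3_mul_d3bar : d3 * bar d3 = 1 + c8
  d3_sq : d3 ^ 2 = b6 + y3
  d3_mul_z9 : d3 * z9 = bar b3 + bar x15 + bar x9
  d3_mul_c8 : d3 * c8 = bar x15 + d3 + bar x6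
  d3_mul_b5 : d3 * b5 = bar x15
  d3_mul_c5 : d3 * c5 = bar x15
  d3_mul_y3 : d3 * y3 = bar d3 + x6
  z9_sq : z9 ^ 2 = 1 + 2 * x10 + 2 * z9 + 2 * b8 + 2 * c8 + b5 + c5
  z9_mul_c8 : z9 * c8 = 2 * x10 + 2 * b8 + 2 * z9 + b5 + c5 + c8
  z9_mul_b5 : z9 * b5 = x10 + b8 + z9 + c8 + b5 + c5
  z9_mul_c5 : z9 * c5 = x10 + b8 + z9 + c8 + b5 + c5
  z9_mul_y3 : z9 * y3 = y9 + c3 + y15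
  c8_sq : c8 ^ 2 = 1 + 2 * c8 + 2 * x10 + b8 + z9 + b5 + c5
  c8_mul_b5 : c8 * b5 = b8 + z9 + c5 + x10 + c8
  c8_mul_c5 : c8 * c5 = b8 + z9 + x10 + c8 + b5
  c8_mul_y3 : c8 * y3 = b6 + y3 + y15
  b5_sq : b5 ^ 2 = 1 + b5 + x10 + z9
  b5_mul_c5 : b5 * c5 = b8 + z9 + c8
  b5_mul_y3 : b5 * y3 = y15
  c5_sq : c5 ^ 2 = 1 + z9 + x10 + c5
  c5_mul_y3 : c5 * y3 = y15
  y3_sq : y3 ^ 2 = 1 + c8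
  x9_mul_c8 : x9 * c8 = 3 * x15 + 2 * x9 + x6 + b3

open Finset

/-! Write `b`, `c`, `d` for b₃, c₃, d₃. The argument lives in the ℤ-span of the basis, where the
form takes integer values and multiplication by `a` is adjoint to multiplication by its conjugate.
Three facts carry it. A positive element of norm 1 is a basis element, and one of norm 2 or 3 is a
sum of two or three distinct ones. Multiplicities are bounded by degrees. A positive element without
the constituent 1 has degree 0 or at least 3. Since the norm of a product `a * w` depends only on
the absolute squares of its factors, and b·b̄ = c² = 1 + b₈ once c² is known, multiplication by `b`
and by `c` can be compared throughout.

Forced part (`Start.exists_core`). These counts determine x₆, x₁₅, y₁₅, x₁₀, x₉, y₉ one after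
another as remainders of products. What stays unknown is Q = b₆² − 1 − b₈, real of degree 27 and
norm 4, hence a sum of four distinct basis elements, together with the remainders of b·x₉ and b̄·y₉
beyond y₁₅ and x₁₅, both of degree 12. Every constituent of Q has degree at least 5 (`Core.part`).

Dichotomy. The multiplicity of y₉ in b·x₉, which equals that of x₉ in b̄·y₉, is 0 or 1
(`Core.t_cases`). It is not 0 (`Core.t_eq_one`). Otherwise let D be the remainder of b̄·y₉. Exactly
one constituent z of Q has x₉ in b·z, and a degree count makes another constituent v have degree 5.
Then b·v = x₁₅ and c·v = y₁₅, so x₉·v and y₉·v are explicit differences, and their positivity bounds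
the norm of D by 2 and restricts its constituents. Distributing the constituents of D over the
constituents of Q then contradicts the degrees in every case (`Bad.elim`).

Completion (`Core.exists_final`). With multiplicity 1 the two remainders have degree 3 after
removing x₉ and y₉: they are d̄ and y₃. Then z₉ = b·d is a constituent of Q, a second one, c₈, is
found from x₉, and 27 = 9 + 8 + 5 + 5 forces b₅ and c₅. The rows of `b` and `c` follow; they do not
distinguish b₅ from c₅, so b₅² and b₅c₅ are computed separately.

Multiplication table. All other products follow by associativity and conjugation
(`TableRel.products`). The listed elements are closed under multiplication
(`TableRel.mul_mem_closure`), so they form a table subset containing the generator and are the whole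
basis. Degrees and products show that they are distinct (`Final.nodup`). -/

/-- A commutative ring that is free over the integers on a distinguished basis `e` with
nonnegative structure constants, an involution permuting the basis, the adjointness relation of
normalized table algebras, and an integral degree map for which every basis element other than
`1` has degree at least three. -/
structure IntTable (ι R : Type*) [Fintype ι] [DecidableEq ι] [CommRing R] where
  e : ι → R
  coef : R →+ (ι → ℤ)
  expand : ∀ a, a = ∑ i, coef a i • e i
  coef_e : ∀ i j, coef (e i) j = if i = j then 1 else 0
  one : ι
  e_one : e one = 1
  bar : R →+* R
  bar_bar : ∀ a, bar (bar a) = a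
  bar_e : ∀ i, ∃ j, bar (e i) = e j
  nonneg : ∀ i j m, 0 ≤ coef (e i * e j) m
  adj : ∀ i j m, coef (e i * e j) m = coef (bar (e j) * e m) i
  deg : R →+* ℤ
  deg_bar : ∀ a, deg (bar a) = deg a
  three_le_deg : ∀ i, e i ≠ 1 → 3 ≤ deg (e i)

/-! ### The orthonormal form, positivity, degrees and norms in an integral table -/

namespace IntTable

variable {ι R : Type*} [Fintype ι] [DecidableEq ι] [CommRing R] (T : IntTable ι R)

/-- The integral form for which the basis is orthonormal. -/
def ip (a c : R) : ℤ := ∑ i, T.coef a i * T.coef c i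

/-- Basis elements. -/
def IsB (x : R) : Prop := ∃ i, T.e i = x

/-- Elements with nonnegative coefficients. -/
def Pos (a : R) : Prop := ∀ i, 0 ≤ T.coef a i

variable {T} {a c x y z : R}

theorem ip_comm (a c : R) : T.ip a c = T.ip c a := by
  simp only [ip, mul_comm]

theorem ip_add (a c d : R) : T.ip a (c + d) = T.ip a c + T.ip a d := by
  simp [ip, mul_add, sum_add_distrib]

theorem add_ip (a c d : R) : T.ip (a + c) d = T.ip a d + T.ip c d := by
  simp [ip, add_mul, sum_add_distrib]

theorem ip_sub (a c d : R) : T.ip a (c - d) = T.ip a c - T.ip a d := by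
  simp [ip, mul_sub, sum_sub_distrib]

theorem sub_ip (a c d : R) : T.ip (a - c) d = T.ip a d - T.ip c d := by
  simp [ip, sub_mul, sum_sub_distrib]

theorem zero_ip (a : R) : T.ip 0 a = 0 := by simp [ip]

theorem ip_zsmul (k : ℤ) (a c : R) : T.ip a (k • c) = k * T.ip a c := by
  simp only [ip, map_zsmul, Pi.smul_apply, smul_eq_mul, mul_sum]
  exact sum_congr rfl fun i _ => by ring

theorem zsmul_ip (k : ℤ) (a c : R) : T.ip (k • a) c = k * T.ip a c := by
  rw [ip_comm, ip_zsmul, ip_comm]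

theorem ip_intCast_mul (k : ℤ) (a c : R) : T.ip a (k * c) = k * T.ip a c := by
  rw [← zsmul_eq_mul, ip_zsmul]

theorem ip_ofNat_mul (k : ℕ) [k.AtLeastTwo] (a c : R) :
    T.ip a (ofNat(k) * c) = ofNat(k) * T.ip a c := by
  have := ip_intCast_mul (T := T) (OfNat.ofNat k) a c
  rwa [Int.cast_ofNat] at this

theorem ofNat_mul_ip (k : ℕ) [k.AtLeastTwo] (a c : R) :
    T.ip (ofNat(k) * a) c = ofNat(k) * T.ip a c := by
  rw [ip_comm, ip_ofNat_mul, ip_comm]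

theorem coef_eq_ip (a : R) (i : ι) : T.coef a i = T.ip a (T.e i) := by
  simp [ip, T.coef_e]

theorem ip_e (i j : ι) : T.ip (T.e i) (T.e j) = if i = j then 1 else 0 := by
  rw [← coef_eq_ip, T.coef_e]

theorem expand_ip (a : R) : a = ∑ i, T.ip a (T.e i) • T.e i := by
  simpa only [coef_eq_ip] using T.expand a

theorem ext_ip (h : ∀ i, T.ip a (T.e i) = T.ip c (T.e i)) : a = c := by
  rw [expand_ip (T := T) a, expand_ip (T := T) c]; simp only [h]

theorem isB_one : T.IsB 1 := ⟨T.one, T.e_one⟩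

theorem IsB.ip_self (hx : T.IsB x) : T.ip x x = 1 := by
  obtain ⟨i, rfl⟩ := hx; simp [ip_e]

theorem IsB.ip_ne (hx : T.IsB x) (hy : T.IsB y) (h : x ≠ y) : T.ip x y = 0 := by
  obtain ⟨i, rfl⟩ := hx; obtain ⟨j, rfl⟩ := hy
  rw [ip_e, if_neg (fun hij => h (by rw [hij]))]

theorem IsB.eq_of_ip (hx : T.IsB x) (hy : T.IsB y) (h : T.ip x y ≠ 0) : x = y := by
  by_contra hne; exact h (hx.ip_ne hy hne)

theorem IsB.ip_deg_ne (hx : T.IsB x) (hy : T.IsB y) (h : T.deg x ≠ T.deg y) : T.ip x y = 0 :=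
  hx.ip_ne hy fun h' => h (by rw [h'])

theorem IsB.bar (hx : T.IsB x) : T.IsB (T.bar x) := by
  obtain ⟨i, rfl⟩ := hx
  obtain ⟨j, hj⟩ := T.bar_e i
  exact ⟨j, hj.symm⟩

/-- Additive maps that agree on basis elements agree. -/
theorem sum_expand {f g : R →+ ℤ} (h : ∀ i, f (T.e i) = g (T.e i)) (a : R) : f a = g a := by
  rw [expand_ip (T := T) a]
  simp only [map_sum, map_zsmul, h]

/-- Normalized adjointness for basis elements extends to all elements by additivity in each of the
three arguments. It is the device that turns a multiplicity in one product into a multiplicity in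
another. -/
theorem ip_mul_right (a c d : R) : T.ip (a * c) d = T.ip a (T.bar c * d) := by
  have h1 : ∀ i j d, T.ip (T.e i * T.e j) d = T.ip (T.e i) (T.bar (T.e j) * d) := fun i j d =>
    sum_expand (T := T) (f := AddMonoidHom.mk' (T.ip (T.e i * T.e j)) (ip_add _))
      (g := (AddMonoidHom.mk' (T.ip (T.e i)) (ip_add _)).comp
        (AddMonoidHom.mulLeft (T.bar (T.e j))))
      (fun m => by
        change T.ip _ _ = T.ip _ (_ * _)
        rw [← coef_eq_ip, T.adj, coef_eq_ip, ip_comm]) d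
  have h2 : ∀ i c d, T.ip (T.e i * c) d = T.ip (T.e i) (T.bar c * d) := fun i c d =>
    sum_expand (T := T)
      (f := (AddMonoidHom.mk' (fun p => T.ip p d) (fun p q => add_ip p q d)).comp
        (AddMonoidHom.mulLeft (T.e i)))
      (g := ((AddMonoidHom.mk' (T.ip (T.e i)) (ip_add _)).comp
        (AddMonoidHom.mulRight d)).comp T.bar.toAddMonoidHom)
      (fun j => h1 i j d) c
  exact sum_expand (T := T)
    (f := (AddMonoidHom.mk' (fun p => T.ip p d) (fun p q => add_ip p q d)).comp
      (AddMonoidHom.mulRight c))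
    (g := AddMonoidHom.mk' (fun p => T.ip p (T.bar c * d)) (fun p q => add_ip p q _))
    (fun i => h2 i c d) a

theorem ip_mul_left (a c d : R) : T.ip (a * c) d = T.ip c (T.bar a * d) := by
  rw [mul_comm, ip_mul_right]

theorem ip_eq_one (a c : R) : T.ip a c = T.ip (a * T.bar c) 1 := by
  rw [ip_mul_right, T.bar_bar, mul_one]

theorem ip_bar_bar (a c : R) : T.ip (T.bar a) (T.bar c) = T.ip a c := by
  rw [ip_eq_one, T.bar_bar, mul_comm, ← ip_eq_one, ip_comm]

theorem ip_bar_left (a c : R) : T.ip (T.bar a) c = T.ip a (T.bar c) := by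
  rw [← ip_bar_bar, T.bar_bar]

variable (T) in
/-- The coefficient of `1`. -/
def tau : R →+ ℤ := AddMonoidHom.mk' (fun a => T.ip a 1) (fun a c => add_ip a c 1)

theorem ip_eq_tau (a c : R) : T.ip a c = T.tau (a * T.bar c) := ip_eq_one a c

/-- The form is the coefficient of 1 in `a * T.bar c` and so depends on that product only. Norms and
multiplicities can therefore be rewritten by regrouping commuting factors. -/
theorem ip_congr {a' c' : R} (h : a * T.bar c = a' * T.bar c') : T.ip a c = T.ip a' c' := by
  rw [ip_eq_tau, ip_eq_tau, h]

/-! ### Positivity -/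

theorem pos_iff : T.Pos a ↔ ∀ x, T.IsB x → 0 ≤ T.ip a x := by
  constructor
  · rintro h x ⟨i, rfl⟩; rw [← coef_eq_ip]; exact h i
  · intro h i; rw [coef_eq_ip]; exact h _ ⟨i, rfl⟩

theorem Pos.ip_nonneg (ha : T.Pos a) (hc : T.Pos c) : 0 ≤ T.ip a c :=
  sum_nonneg fun i _ => mul_nonneg (ha i) (hc i)

theorem IsB.pos (hx : T.IsB x) : T.Pos x := by
  obtain ⟨i, rfl⟩ := hx
  intro j; rw [T.coef_e]; split_ifs <;> simp

theorem Pos.sum {κ : Type*} (s : Finset κ) {f : κ → R} (h : ∀ k ∈ s, T.Pos (f k)) :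
    T.Pos (∑ k ∈ s, f k) := by
  intro i; rw [map_sum, Finset.sum_apply]; exact sum_nonneg fun k hk => h k hk i

theorem Pos.zsmul {k : ℤ} (hk : 0 ≤ k) (ha : T.Pos a) : T.Pos (k • a) := fun i => by
  rw [map_zsmul]; exact mul_nonneg hk (ha i)

theorem Pos.mul (ha : T.Pos a) (hc : T.Pos c) : T.Pos (a * c) := by
  rw [T.expand a, T.expand c, sum_mul_sum]
  refine Pos.sum _ fun i _ => Pos.sum _ fun j _ => ?_
  rw [smul_mul_smul_comm]
  exact Pos.zsmul (mul_nonneg (ha i) (hc j)) (T.nonneg i j)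

/-- A basis element contained `k` times can be subtracted `k` times. -/
theorem Pos.sub_zsmul (ha : T.Pos a) (hx : T.IsB x) {k : ℤ} (h : k ≤ T.ip a x) :
    T.Pos (a - k • x) := by
  rw [pos_iff] at *
  intro y hy
  rw [sub_ip, zsmul_ip]
  by_cases hxy : x = y
  · subst hxy; rw [hx.ip_self]; omega
  · rw [hx.ip_ne hy hxy]; have := ha y hy; omega

theorem Pos.sub (ha : T.Pos a) (hx : T.IsB x) (h : 1 ≤ T.ip a x) : T.Pos (a - x) := by
  have := ha.sub_zsmul hx h; rwa [one_zsmul] at this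

/-! ### Degrees -/

theorem IsB.deg_eq_one_or (hx : T.IsB x) : x = 1 ∨ 3 ≤ T.deg x := by
  obtain ⟨i, rfl⟩ := hx
  by_cases h : T.e i = 1
  · exact Or.inl h
  · exact Or.inr (T.three_le_deg i h)

theorem IsB.deg_pos (hx : T.IsB x) : 1 ≤ T.deg x := by
  rcases hx.deg_eq_one_or with rfl | h
  · simp
  · omega

theorem Pos.deg_nonneg (ha : T.Pos a) : 0 ≤ T.deg a := by
  rw [T.expand a, map_sum]
  refine sum_nonneg fun i _ => ?_
  rw [map_zsmul]
  exact mul_nonneg (ha i) (by have := IsB.deg_pos (T := T) ⟨i, rfl⟩; omega)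

theorem Pos.ne_zero_exists (ha : T.Pos a) (h : a ≠ 0) : ∃ x, T.IsB x ∧ 1 ≤ T.ip a x := by
  by_contra hcon
  push Not at hcon
  apply h
  refine ext_ip (T := T) fun i => ?_
  rw [zero_ip]
  have h1 := hcon (T.e i) ⟨i, rfl⟩
  have h2 := ha.ip_nonneg (IsB.pos (T := T) ⟨i, rfl⟩)
  omega

theorem Pos.mul_deg_le (ha : T.Pos a) (hx : T.IsB x) {k : ℤ} (h : k ≤ T.ip a x) :
    k * T.deg x ≤ T.deg a := by
  have := (ha.sub_zsmul hx h).deg_nonneg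
  rw [map_sub, map_zsmul, smul_eq_mul] at this; omega

theorem Pos.deg_le (ha : T.Pos a) (hx : T.IsB x) (h : 1 ≤ T.ip a x) : T.deg x ≤ T.deg a := by
  have := ha.mul_deg_le hx h; omega

theorem Pos.eq_zero (ha : T.Pos a) (h : T.deg a = 0) : a = 0 := by
  by_contra hne
  obtain ⟨x, hx, hax⟩ := ha.ne_zero_exists hne
  have := ha.deg_le hx hax; have := hx.deg_pos; omega

/-- Any constituent differs from 1 and has degree at least three. Remainders of degree 1 and 2 are
thereby impossible, which closes many of the degree counts below. -/
theorem Pos.deg_eq_zero_or (ha : T.Pos a) (h1 : T.ip a 1 = 0) : T.deg a = 0 ∨ 3 ≤ T.deg a := by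
  by_cases hne : a = 0
  · left; rw [hne, map_zero]
  obtain ⟨x, hx, hax⟩ := ha.ne_zero_exists hne
  have h2 := ha.deg_le hx hax
  rcases hx.deg_eq_one_or with rfl | h
  · omega
  · omega

/-- The remainder after subtracting a basis element, in terms of degrees. -/
theorem Pos.eq_of_deg_lt (ha : T.Pos a) (hx : T.IsB x) (hax : 1 ≤ T.ip a x)
    (h1 : T.ip a 1 = 0) (hd : T.deg a < T.deg x + 3) : a = x := by
  have hp := ha.sub hx hax
  have hx1 : T.ip x 1 = 0 := by
    refine hx.ip_ne isB_one ?_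
    rintro rfl; omega
  have := hp.deg_eq_zero_or (by rw [sub_ip, h1, hx1]; rfl)
  rw [map_sub] at this
  exact sub_eq_zero.1 (hp.eq_zero (by rw [map_sub]; omega))

/-- Two constituents different from 1 would already have total degree at least six. -/
theorem Pos.isB_of_deg (ha : T.Pos a) (h1 : T.ip a 1 = 0) (h3 : 3 ≤ T.deg a)
    (h5 : T.deg a ≤ 5) : T.IsB a := by
  obtain ⟨x, hx, hax⟩ := ha.ne_zero_exists (by rintro rfl; simp at h3)
  have : 3 ≤ T.deg x := by
    rcases hx.deg_eq_one_or with rfl | h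
    · omega
    · exact h
  rwa [ha.eq_of_deg_lt hx hax h1 (by omega)]

/-! ### Norms -/

theorem ip_self_nonneg (a : R) : 0 ≤ T.ip a a := sum_nonneg fun _ _ => mul_self_nonneg _

theorem eq_zero_of_ip_self (h : T.ip a a = 0) : a = 0 := by
  refine ext_ip (T := T) fun i => ?_
  rw [zero_ip, ← coef_eq_ip]
  have := (sum_eq_zero_iff_of_nonneg fun i _ => mul_self_nonneg (T.coef a i)).1 h i (mem_univ i)
  exact mul_self_eq_zero.1 this

theorem ip_self_sub (a x : R) (hx : T.IsB x) :
    T.ip (a - x) (a - x) = T.ip a a - 2 * T.ip a x + 1 := by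
  rw [sub_ip, ip_sub, ip_sub, hx.ip_self, ip_comm x a]; ring

theorem ip_self_eq_zero_or (a : R) : a = 0 ∨ 1 ≤ T.ip a a := by
  by_cases h : a = 0
  · exact Or.inl h
  · right
    have := ip_self_nonneg (T := T) a
    rcases this.lt_or_eq with h' | h'
    · omega
    · exact absurd (eq_zero_of_ip_self h'.symm) h

theorem Pos.isB_of_norm (ha : T.Pos a) (h : T.ip a a = 1) : T.IsB a := by
  obtain ⟨x, hx, hax⟩ := ha.ne_zero_exists (by rintro rfl; simp [zero_ip] at h)
  have h1 := ip_self_sub (T := T) a x hx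
  have h2 := ip_self_nonneg (T := T) (a - x)
  have : a - x = 0 := eq_zero_of_ip_self (T := T) (by omega)
  rwa [sub_eq_zero.1 this]

/-- Peeling off a constituent of an element of norm at most three. -/
theorem Pos.peel (ha : T.Pos a) (h : T.ip a a ≤ 3) (hx : T.IsB x) (hax : 1 ≤ T.ip a x) :
    T.ip a x = 1 ∧ T.Pos (a - x) ∧ T.ip (a - x) (a - x) = T.ip a a - 1 := by
  have h1 := ip_self_sub (T := T) a x hx
  -- This is the norm of `a - x - x`. With norm at most three it gives 4m ≤ 7 for the multiplicity
  -- m, hence m = 1.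
  have h3 : 0 ≤ T.ip a a - 4 * T.ip a x + 4 := by
    have := ip_self_nonneg (T := T) (a - x - x)
    rwa [ip_self_sub _ _ hx, h1, sub_ip, hx.ip_self, show
      T.ip a a - 2 * T.ip a x + 1 - 2 * (T.ip a x - 1) + 1 = T.ip a a - 4 * T.ip a x + 4 by
        ring] at this
  have : T.ip a x = 1 := by omega
  exact ⟨this, ha.sub hx hax, by omega⟩

theorem Pos.norm_two (ha : T.Pos a) (h : T.ip a a = 2) :
    ∃ x y, T.IsB x ∧ T.IsB y ∧ a = x + y ∧ T.ip x y = 0 := by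
  obtain ⟨x, hx, hax⟩ := ha.ne_zero_exists (by rintro rfl; simp [zero_ip] at h)
  obtain ⟨h1, h2, h3⟩ := ha.peel (by omega) hx hax
  refine ⟨x, a - x, hx, h2.isB_of_norm (by omega), by ring, ?_⟩
  rw [ip_sub, hx.ip_self, ip_comm, h1]; rfl

theorem Pos.norm_three (ha : T.Pos a) (h : T.ip a a = 3) :
    ∃ x y z, T.IsB x ∧ T.IsB y ∧ T.IsB z ∧ a = x + y + z ∧ T.ip x y = 0 ∧ T.ip x z = 0 ∧
      T.ip y z = 0 := by
  obtain ⟨x, hx, hax⟩ := ha.ne_zero_exists (by rintro rfl; simp [zero_ip] at h)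
  obtain ⟨h1, h2, h3⟩ := ha.peel (by omega) hx hax
  obtain ⟨y, z, hy, hz, hyz, hyz0⟩ := h2.norm_two (by omega)
  have h4 : T.ip x (y + z) = 0 := by rw [← hyz, ip_sub, hx.ip_self, ip_comm, h1]; rfl
  rw [ip_add] at h4
  have h5 := hx.pos.ip_nonneg hy.pos
  have h6 := hx.pos.ip_nonneg hz.pos
  exact ⟨x, y, z, hx, hy, hz, by rw [add_assoc, ← hyz]; ring, by omega, by omega, hyz0⟩

end IntTable

/-! ### The structure forced by the generating configuration -/

namespace IntTable

variable {ι R : Type*} [Fintype ι] [DecidableEq ι] [CommRing R] (T : IntTable ι R)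

/-- The generating configuration. -/
structure Start (b b8 c b6 : R) : Prop where
  b_isB : T.IsB b
  b8_isB : T.IsB b8
  c_isB : T.IsB c
  b6_isB : T.IsB b6
  b_deg : T.deg b = 3
  b8_deg : T.deg b8 = 8
  c_deg : T.deg c = 3
  b6_deg : T.deg b6 = 6
  b_nonreal : T.bar b ≠ b
  c_real : T.bar c = c
  bar_mul : T.bar b * b = 1 + b8
  sq : b * b = c + b6
  norm : T.ip (b8 * b) (b8 * b) = 3

/-- The part of the structure that is determined without case distinctions. -/
structure Core (b b8 c b6 x6 x15 y15 x10 x9 y9 Q : R) : Prop where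
  b_isB : T.IsB b
  b8_isB : T.IsB b8
  c_isB : T.IsB c
  b6_isB : T.IsB b6
  x6_isB : T.IsB x6
  x15_isB : T.IsB x15
  y15_isB : T.IsB y15
  x10_isB : T.IsB x10
  x9_isB : T.IsB x9
  y9_isB : T.IsB y9
  b_deg : T.deg b = 3
  b8_deg : T.deg b8 = 8
  c_deg : T.deg c = 3
  b6_deg : T.deg b6 = 6
  x6_deg : T.deg x6 = 6
  x15_deg : T.deg x15 = 15
  y15_deg : T.deg y15 = 15
  x10_deg : T.deg x10 = 10
  x9_deg : T.deg x9 = 9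
  y9_deg : T.deg y9 = 9
  Q_deg : T.deg Q = 27
  b_nonreal : T.bar b ≠ b
  c_real : T.bar c = c
  b8_real : T.bar b8 = b8
  b6_real : T.bar b6 = b6
  y15_real : T.bar y15 = y15
  x10_real : T.bar x10 = x10
  y9_real : T.bar y9 = y9
  Q_real : T.bar Q = Q
  Q_pos : T.Pos Q
  Q_one : T.ip Q 1 = 0
  Q_b8 : T.ip Q b8 = 0
  Q_x10 : T.ip Q x10 = 0
  Q_norm : T.ip Q Q = 4
  b_bbar : b * T.bar b = 1 + b8
  b_b : b * b = c + b6
  b_c : b * c = T.bar b + T.bar x6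
  b_b6 : b * b6 = T.bar b + T.bar x15
  b_x6 : b * x6 = c + y15
  b_x6bar : b * T.bar x6 = b8 + x10
  b_b8 : b * b8 = x6 + b + x15
  b_x15 : b * x15 = 2 * y15 + b6 + y9
  b_x15bar : b * T.bar x15 = b8 + x10 + Q
  b_x10 : b * x10 = x15 + x6 + x9
  b_y15 : b * y15 = 2 * T.bar x15 + T.bar x6 + T.bar x9
  c_c : c * c = 1 + b8
  c_b6 : c * b6 = b8 + x10
  c_x6 : c * x6 = T.bar b + T.bar x15
  c_b8 : c * b8 = b6 + c + y15
  c_x15 : c * x15 = 2 * T.bar x15 + T.bar x6 + T.bar x9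
  c_x10 : c * x10 = b6 + y15 + y9
  c_y15 : c * y15 = b8 + x10 + Q
  c_x9 : c * x9 = b * y9
  c_y9 : c * y9 = b * T.bar x9

variable {T}

theorem IsB.ne_one {x : R} (hx : T.IsB x) (h : T.deg x ≠ 1) : T.ip x 1 = 0 :=
  hx.ip_deg_ne isB_one (by rwa [map_one])

theorem Start.exists_core {b b8 c b6 : R} (h : T.Start b b8 c b6) :
    ∃ x6 x15 y15 x10 x9 y9 Q, T.Core b b8 c b6 x6 x15 y15 x10 x9 y9 Q := by
  obtain ⟨hb, hb8, hc, hb6, db, db8, dc, db6, hbb, rc, hbar, hsq, hn⟩ := h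
  have hb' := hb.bar
  have db' : T.deg (T.bar b) = 3 := by rw [T.deg_bar, db]
  have rb8 : T.bar b8 = b8 := by
    have := congrArg T.bar hbar
    simp only [map_mul, map_add, map_one, T.bar_bar] at this
    linear_combination hbar - this
  have cc : T.ip c c = 1 := hc.ip_self
  have hbc0 : T.Pos (b * c) := hb.pos.mul hc.pos
  have e1 : T.ip (b * c) (T.bar b) = 1 := by
    rw [T.ip_congr (a' := b * b) (c' := c) (by rw [T.bar_bar, rc]; ring), hsq, add_ip, cc,
      hb6.ip_deg_ne hc (by omega)]; rfl
  -- x6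
  set r := b * c - T.bar b with hr
  have hrp : T.Pos r := hbc0.sub hb' (by omega)
  have dr : T.deg r = 6 := by rw [hr, map_sub, map_mul, db, dc, db']; rfl
  -- The norm of `b * c` pairs c² with b·b̄ = 1 + b₈, so the norm of the remainder `r` is exactly
  -- the multiplicity of b₈ in c².
  have nbc : T.ip (b * c) (b * c) = 1 + T.ip (c * c) b8 := by
    rw [T.ip_congr (a' := c * c) (c' := 1 + b8) (by
      simp only [map_mul, map_add, map_one, rc, rb8]; linear_combination c * c * hbar), ip_add,
      ip_mul_right, rc, mul_one, cc]
  have nr : T.ip r r = T.ip (c * c) b8 := by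
    rw [hr, ip_self_sub _ _ hb', nbc, e1]; ring
  have hcc : T.Pos (c * c) := hc.pos.mul hc.pos
  -- The remainder `r` has degree 6 and is nonzero, so b₈ occurs in c²; two copies would exceed the
  -- degree 9. Thus `r` has norm one.
  have n1 : 1 ≤ T.ip (c * c) b8 := by
    rcases ip_self_eq_zero_or (T := T) r with h0 | h0
    · rw [h0, map_zero] at dr; omega
    · omega
  have n2 : T.ip (c * c) b8 = 1 := by
    have := hcc.mul_deg_le hb8 le_rfl
    rw [db8, map_mul, dc] at this; omega
  have hrB : T.IsB r := hrp.isB_of_norm (by omega)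
  obtain ⟨x6, hx6⟩ : ∃ x, T.bar r = x := ⟨_, rfl⟩
  have hx6B : T.IsB x6 := hx6 ▸ hrB.bar
  have dx6 : T.deg x6 = 6 := by rw [← hx6, T.deg_bar, dr]
  have hbc : b * c = T.bar b + T.bar x6 := by rw [← hx6, T.bar_bar, hr]; ring
  have hb'c : T.bar b * c = b + x6 := by
    have := congrArg T.bar hbc
    simpa only [map_mul, map_add, rc, T.bar_bar] using this
  have hc_c : c * c = 1 + b8 := by
    have h1 := hcc.sub isB_one (by rw [ip_mul_right, rc, mul_one, cc])
    have h2 := h1.sub hb8 (by rw [sub_ip, n2, isB_one.ip_deg_ne hb8 (by simp [db8])]; rfl)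
    have := h2.eq_zero (by simp [map_sub, map_mul, dc, db8])
    linear_combination this
  -- x15
  have b8b_b : T.ip (b8 * b) b = 1 := by
    rw [T.ip_congr (a' := b8) (c' := 1 + b8) (by
      simp only [map_add, map_one, rb8]; linear_combination b8 * hbar), ip_add, hb8.ip_self,
      hb8.ne_one (by omega)]; rfl
  have hb6b' : T.bar b * b6 = b8 * b - x6 := by
    linear_combination b * hbar - T.bar b * hsq - hb'c
  -- Since b̄·b₆ = b₈·b − x₆ is positive, x₆ must occur in b₈·b.
  have hk := (hb'.pos.mul hb6.pos).ip_nonneg hx6B.pos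
  rw [hb6b', sub_ip, hx6B.ip_self] at hk
  have x6b : T.ip x6 b = 0 := hx6B.ip_deg_ne hb (by omega)
  obtain ⟨x15, hx15⟩ : ∃ x, b8 * b - b - x6 = x := ⟨_, rfl⟩
  have hx15p : T.Pos x15 := by
    rw [← hx15]
    refine ((hb8.pos.mul hb.pos).sub hb b8b_b.ge).sub hx6B ?_
    rw [sub_ip, ip_comm b, x6b]; omega
  -- With m the multiplicity of x₆ in b₈·b, the remainder has norm 3 − 2m. It is nonzero by degree,
  -- so m = 1 and its norm is 1.
  have hx15B : T.IsB x15 := by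
    have n := ip_self_sub (T := T) (b8 * b - b) x6 hx6B
    rw [hx15, ip_self_sub _ _ hb, hn, b8b_b, sub_ip, ip_comm b, x6b] at n
    rcases ip_self_eq_zero_or (T := T) x15 with h0 | h0
    · have := congrArg T.deg hx15; simp [h0, db8, db, dx6] at this
    · exact hx15p.isB_of_norm (by omega)
  have dx15 : T.deg x15 = 15 := by rw [← hx15]; simp [db8, db, dx6]
  have hbb8 : b * b8 = x6 + b + x15 := by rw [← hx15]; ring
  have hb'b6 : T.bar b * b6 = b + x15 := by rw [hb6b', ← hx15]; ring
  -- y15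
  have hcb8 : c * b8 = b6 + b * x6 := by
    linear_combination -c * hbar + hsq + b * hb'c
  have cb8_c : T.ip (c * b8) c = 1 := by
    rw [T.ip_congr (a' := b8) (c' := 1 + b8) (by
      simp only [map_add, map_one, rb8, rc]; linear_combination b8 * hc_c), ip_add,
      hb8.ip_self, hb8.ne_one (by omega)]; rfl
  have cb8_n : T.ip (c * b8) (c * b8) = 3 := by
    rw [← hn]
    exact ip_congr (by
      simp only [map_mul, rb8, rc]; linear_combination b8 * b8 * hc_c - b8 * b8 * hbar)
  have b6c : T.ip b6 c = 0 := hb6.ip_deg_ne hc (by omega)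
  -- The same device, with `b * x6` equal to `c * b8 - b6`: positivity places b₆ in c·b₈, which also
  -- has norm 3 because c² = b·b̄.
  have hk2 := (hb.pos.mul hx6B.pos).ip_nonneg hb6.pos
  rw [show b * x6 = c * b8 - b6 by rw [hcb8]; ring, sub_ip, hb6.ip_self] at hk2
  obtain ⟨y15, hy15⟩ : ∃ y, c * b8 - c - b6 = y := ⟨_, rfl⟩
  have hy15p : T.Pos y15 := by
    rw [← hy15]
    refine ((hc.pos.mul hb8.pos).sub hc cb8_c.ge).sub hb6 ?_
    rw [sub_ip, ip_comm c, b6c]; omega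
  have dy15 : T.deg y15 = 15 := by rw [← hy15]; simp [db8, dc, db6]
  have ny := ip_self_sub (T := T) (c * b8 - c) b6 hb6
  rw [hy15, ip_self_sub _ _ hc, cb8_n, cb8_c, sub_ip, ip_comm c, b6c] at ny
  have hny : T.ip (c * b8) b6 = 1 ∧ T.ip y15 y15 = 1 := by
    rcases ip_self_eq_zero_or (T := T) y15 with h0 | h0
    · rw [h0, map_zero] at dy15; omega
    · omega
  have hy15B : T.IsB y15 := hy15p.isB_of_norm hny.2
  have hc_b8 : c * b8 = b6 + c + y15 := by rw [← hy15]; ring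
  have hbx6 : b * x6 = c + y15 := by linear_combination hc_b8 - hcb8
  have hbar68 : T.bar b6 + T.bar y15 = b6 + y15 := by
    have := congrArg T.bar hc_b8
    simp only [map_mul, map_add, rc, rb8] at this
    linear_combination hc_b8 - this
  -- The sum b₆ + y₁₅ is real and its two constituents have different degrees, so conjugation fixes
  -- each of them.
  have rb6 : T.bar b6 = b6 := by
    have h1 := congrArg (T.ip b6) hbar68
    rw [ip_add, ip_add, hb6.ip_self, hb6.ip_deg_ne hy15B (by omega),
      hb6.ip_deg_ne hy15B.bar (by rw [T.deg_bar]; omega)] at h1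
    exact (hb6.eq_of_ip hb6.bar (by omega)).symm
  have ry15 : T.bar y15 = y15 := by linear_combination hbar68 - rb6
  have hbb6 : b * b6 = T.bar b + T.bar x15 := by
    have := congrArg T.bar hb'b6
    simpa only [map_mul, map_add, rb6, T.bar_bar] using this
  -- x10
  have hbx6' : b * T.bar x6 = c * b6 := by
    linear_combination -b * hbc - hbar + hc_c + c * hsq
  have hb'x15 : T.ip (b * T.bar x15) b8 = 1 := by
    rw [← ip_bar_bar]
    simp only [map_mul, T.bar_bar, rb8]
    rw [ip_mul_left, T.bar_bar, hbb8, ip_add, ip_add, hx15B.ip_self,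
      hx15B.ip_deg_ne hx6B (by omega), hx15B.ip_deg_ne hb (by omega)]; rfl
  have hb6b6 : b6 * b6 = 1 + b8 + b * T.bar x15 - c * b6 := by
    linear_combination b * hbb6 + hbar - b6 * hsq
  have cb6_b8 : T.ip (c * b6) b8 = 1 := by
    rw [← hny.1]; exact ip_congr (by rw [rb8, rb6]; ring)
  have b81 : T.ip b8 1 = 0 := hb8.ne_one (by omega)
  have b18 : T.ip 1 b8 = 0 := by rw [ip_comm, b81]
  have b66_b8 : T.ip (b6 * b6) b8 = 1 := by
    rw [hb6b6, sub_ip, add_ip, add_ip, hb'x15, hb8.ip_self, cb6_b8, b18]; rfl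
  have b66_1 : T.ip (b6 * b6) 1 = 1 := by rw [ip_mul_right, mul_one, rb6, hb6.ip_self]
  -- By c² = 1 + b₈ this norm is the sum of the multiplicities of 1 and b₈ in b₆², both of which are
  -- one.
  have cb6_n : T.ip (c * b6) (c * b6) = 2 := by
    rw [T.ip_congr (a' := b6 * b6) (c' := 1 + b8) (by
      simp only [map_mul, map_add, map_one, rc, rb6, rb8]; linear_combination b6 * b6 * hc_c),
      ip_add, b66_b8, b66_1]; rfl
  obtain ⟨h10a, h10b, h10c⟩ := (hc.pos.mul hb6.pos).peel (by omega) hb8 cb6_b8.ge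
  obtain ⟨x10, hx10⟩ : ∃ x, c * b6 - b8 = x := ⟨_, rfl⟩
  rw [hx10] at h10b h10c
  have hx10B : T.IsB x10 := h10b.isB_of_norm (by omega)
  have dx10 : T.deg x10 = 10 := by rw [← hx10]; simp [dc, db6, db8]
  have rx10 : T.bar x10 = x10 := by rw [← hx10]; simp [rc, rb6, rb8]
  have hc_b6 : c * b6 = b8 + x10 := by rw [← hx10]; ring
  have x10b8 : T.ip x10 b8 = 0 := hx10B.ip_deg_ne hb8 (by omega)
  -- Q
  obtain ⟨Q, hQ⟩ : ∃ x, b6 * b6 - 1 - b8 = x := ⟨_, rfl⟩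
  have hQp : T.Pos Q := by
    rw [← hQ]
    exact ((hb6.pos.mul hb6.pos).sub isB_one b66_1.ge).sub hb8 (by rw [sub_ip, b66_b8, b18]; rfl)
  have Q1 : T.ip Q 1 = 0 := by rw [← hQ, sub_ip, sub_ip, b66_1, b81, isB_one.ip_self]; rfl
  have Q8 : T.ip Q b8 = 0 := by rw [← hQ, sub_ip, sub_ip, b66_b8, b18, hb8.ip_self]; rfl
  have dQ : T.deg Q = 27 := by rw [← hQ]; simp [db6, db8]
  have rQ : T.bar Q = Q := by rw [← hQ]; simp [rb6, rb8]
  -- The remainder of b₆² reappears as the remainder of b·x̄₁₅. This links the constituents of `Q`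
  -- to x₁₅.
  have hbx15' : b * T.bar x15 = b8 + x10 + Q := by
    rw [← hQ]; linear_combination hc_b6 - hb6b6
  -- conjugates
  have hb'x15' : T.bar b * x15 = b8 + x10 + Q := by
    have := congrArg T.bar hbx15'
    simpa only [map_mul, map_add, T.bar_bar, rb8, rx10, rQ] using this
  have hb'x6 : T.bar b * x6 = b8 + x10 := by
    have := congrArg T.bar (hbx6'.trans hc_b6)
    simpa only [map_mul, map_add, T.bar_bar, rb8, rx10] using this
  have hb'b8 : T.bar b * b8 = T.bar x6 + T.bar b + T.bar x15 := by
    have := congrArg T.bar hbb8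
    simpa only [map_mul, map_add, rb8] using this
  -- x9, y9
  have d15 : T.ip x15 x6 = 0 := hx15B.ip_deg_ne hx6B (by omega)
  have d15b : T.ip x15 b = 0 := hx15B.ip_deg_ne hb (by omega)
  have bx10_x15 : T.ip (b * x10) x15 = 1 + T.ip Q x10 := by
    rw [ip_mul_left, hb'x15', ip_add, ip_add, hx10B.ip_self, x10b8, ip_comm x10]; rfl
  have bx10_x6 : T.ip (b * x10) x6 = 1 := by
    rw [ip_mul_left, hb'x6, ip_add, hx10B.ip_self, x10b8]; rfl
  have y15b6 : T.ip y15 b6 = 0 := hy15B.ip_deg_ne hb6 (by omega)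
  have bx15_b6 : T.ip (b * x15) b6 = 1 := by
    rw [ip_mul_left, hb'b6, ip_add, hx15B.ip_self, d15b]; rfl
  have bx15_y15 : T.ip (b * x15) y15 = 2 + T.ip Q x10 := by
    have h1 : T.ip (b * x15) (b * x6) = T.ip x15 ((1 + b8) * x6) := by
      rw [ip_mul_left, ← hbar]; ring_nf
    have h2 : T.ip (b * x15) c = 0 := by
      rw [ip_mul_left, hb'c, ip_add, d15, d15b]; rfl
    have h3 : (1 + b8) * x6 = b * b8 + b * x10 := by linear_combination -x6 * hbar + b * hb'x6
    have h4 : T.ip x15 (b * b8) = 1 := by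
      rw [hbb8, ip_add, ip_add, hx15B.ip_self, d15, d15b]; rfl
    rw [show y15 = b * x6 - c by rw [hbx6]; ring, ip_sub, h2, h1, h3, ip_add, h4, ip_comm x15,
      bx10_x15]; ring
  have hbx15p : T.Pos (b * x15) := hb.pos.mul hx15B.pos
  -- After removing b₆ from b·x₁₅ degree 39 is left, too little for three copies of y₁₅. Hence the
  -- multiplicity 2 + (Q, x₁₀) is exactly 2.
  have hq : T.ip Q x10 = 0 := by
    have h0 := hQp.ip_nonneg hx10B.pos
    have h1 := (hbx15p.sub hb6 bx15_b6.ge).mul_deg_le hy15B (k := 2 + T.ip Q x10) (by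
      rw [sub_ip, bx15_y15, ip_comm b6, y15b6]; omega)
    rw [map_sub, map_mul, db, dx15, db6, dy15] at h1
    omega
  rw [hq] at bx15_y15 bx10_x15
  norm_num at bx15_y15 bx10_x15
  obtain ⟨y9, hy9⟩ : ∃ y, b * x15 - 2 * y15 - b6 = y := ⟨_, rfl⟩
  obtain ⟨x9, hx9⟩ : ∃ y, b * x10 - x15 - x6 = y := ⟨_, rfl⟩
  have y9p : T.Pos y9 := by
    rw [← hy9]
    have := hbx15p.sub_zsmul hy15B (k := 2) (by omega)
    rw [zsmul_eq_mul, Int.cast_ofNat] at this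
    refine this.sub hb6 ?_
    rw [sub_ip, ofNat_mul_ip, bx15_b6, y15b6]; rfl
  have x9p : T.Pos x9 := by
    rw [← hx9]
    refine ((hb.pos.mul hx10B.pos).sub hx15B bx10_x15.ge).sub hx6B ?_
    rw [sub_ip, bx10_x6, d15]; rfl
  have dy9 : T.deg y9 = 9 := by rw [← hy9]; simp [db, dx15, dy15, db6, map_ofNat]
  have dx9 : T.deg x9 = 9 := by rw [← hx9]; simp [db, dx15, dx10, dx6]
  have hbx15 : b * x15 = 2 * y15 + b6 + y9 := by rw [← hy9]; ring
  have hbx10 : b * x10 = x15 + x6 + x9 := by rw [← hx9]; ring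
  have hb'x10 : T.bar b * x10 = T.bar x15 + T.bar x6 + T.bar x9 := by
    have := congrArg T.bar hbx10
    simpa only [map_mul, map_add, rx10] using this
  have h86 : b8 * T.bar x6 = T.bar b + T.bar x15 + T.bar b * x10 := by
    linear_combination -T.bar x6 * hbar + T.bar b * hbx6' + T.bar b * hc_b6 + hb'b8
  have hcx6 : c * x6 = T.bar b + T.bar x15 := by
    linear_combination -c * hb'c + T.bar b * hc_c - hbc + hb'b8
  have hcy15 : c * y15 = b8 + x10 + Q := by
    linear_combination -c * hbx6 + b * hcx6 + hbar - hc_c + hbx15'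
  have hby15 : b * y15 = 2 * T.bar x15 + T.bar x6 + T.bar x9 := by
    linear_combination -b * hc_b8 + b8 * hbc + hb'b8 + h86 - hbb6 - hbc + hb'x10
  have hb'y15 : T.bar b * y15 = 2 * x15 + x6 + x9 := by
    have := congrArg T.bar hby15
    simpa only [map_mul, map_add, ry15, T.bar_bar, map_ofNat] using this
  -- This norm equals that of b̄·x₁₅ and, via b·b̄ = c², that of b̄·y₁₅. The three expansions give
  -- ‖Q‖² = ‖y₉‖² + 3 = ‖x₉‖² + 3.
  have nbx15 : T.ip (b * x15) (b * x15) = 2 + T.ip Q Q := by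
    rw [show T.ip (b * x15) (b * x15) = T.ip (T.bar b * x15) (T.bar b * x15) from
      ip_congr (by simp only [map_mul, T.bar_bar]; ring), hb'x15']
    simp only [ip_add, add_ip, hb8.ip_self, hx10B.ip_self, x10b8, ip_comm b8, hq, Q8,
      ip_comm x10 Q]
    ring
  have x9x15 : T.ip x9 x15 = 0 := by
    rw [← hx9, sub_ip, sub_ip, bx10_x15, hx15B.ip_self, ip_comm x6, d15]; rfl
  have x9x6 : T.ip x9 x6 = 0 := by
    rw [← hx9, sub_ip, sub_ip, bx10_x6, hx6B.ip_self, d15]; rfl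
  have y9y15 : T.ip y9 y15 = 0 := by
    rw [← hy9, sub_ip, sub_ip, ofNat_mul_ip, bx15_y15, hy15B.ip_self, ip_comm b6, y15b6]; rfl
  have y9b6 : T.ip y9 b6 = 0 := by
    rw [← hy9, sub_ip, sub_ip, ofNat_mul_ip, bx15_b6, hb6.ip_self, y15b6]; rfl
  have ny9 : T.ip Q Q = T.ip y9 y9 + 3 := by
    rw [hbx15] at nbx15
    simp only [ip_add, add_ip, ip_ofNat_mul, ofNat_mul_ip, hy15B.ip_self, hb6.ip_self, y15b6,
      ip_comm b6 y15, y9y15, y9b6, ip_comm y15 y9, ip_comm b6 y9] at nbx15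
    omega
  have nx9 : T.ip Q Q = T.ip x9 x9 + 3 := by
    have h1 : T.ip (T.bar b * y15) (T.bar b * y15) = 2 + T.ip Q Q := by
      rw [← nbx15]
      refine ip_congr ?_
      have h2 : c * y15 * (c * y15) = b * T.bar x15 * (T.bar b * x15) := by
        rw [hcy15, hbx15', hb'x15']
      simp only [map_mul, T.bar_bar, ry15]
      linear_combination h2 + y15 * y15 * hbar - y15 * y15 * hc_c
    rw [hb'y15] at h1
    simp only [ip_add, add_ip, ip_ofNat_mul, ofNat_mul_ip, hx15B.ip_self, hx6B.ip_self, d15,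
      ip_comm x6 x15, x9x15, x9x6, ip_comm x15 x9, ip_comm x6 x9] at h1
    omega
  -- The multiplicity of y₁₅ in b·x₉ is ‖x₉‖², and b·x₉ has degree 27 < 2·15.
  have n9 : T.ip x9 x9 = 1 := by
    have h1 : T.ip (b * x9) y15 = T.ip x9 x9 := by
      rw [ip_mul_left, hb'y15, ip_add, ip_add, ip_ofNat_mul, x9x15, x9x6]; ring
    have h2 := (hb.pos.mul x9p).mul_deg_le hy15B h1.ge
    rw [map_mul, db, dx9, dy15] at h2
    rcases ip_self_eq_zero_or (T := T) x9 with h0 | h0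
    · rw [h0, map_zero] at dx9; omega
    · omega
  have hx9B : T.IsB x9 := x9p.isB_of_norm n9
  have hy9B : T.IsB y9 := y9p.isB_of_norm (by omega)
  have h66 : b6 * b8 = 2 * y15 + b6 + y9 + c := by
    linear_combination hbx15 - b6 * hbar + b * hb'b6 + hsq
  have ry9 : T.bar y9 = y9 := by
    have := congrArg T.bar h66
    simp only [map_mul, map_add, map_ofNat, rb6, rb8, ry15, rc] at this
    linear_combination h66 - this
  have hcx15 : c * x15 = 2 * T.bar x15 + T.bar x6 + T.bar x9 := by
    linear_combination -c * hbb8 + b8 * hbc + hb'b8 + h86 - hbc - hcx6 + hb'x10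
  have hcx10 : c * x10 = b6 + y15 + y9 := by
    linear_combination -c * hc_b6 + b6 * hc_c + h66 - hc_b8
  exact ⟨x6, x15, y15, x10, x9, y9, Q,
    { b_isB := hb, b8_isB := hb8, c_isB := hc, b6_isB := hb6, x6_isB := hx6B, x15_isB := hx15B,
      y15_isB := hy15B, x10_isB := hx10B, x9_isB := hx9B, y9_isB := hy9B, b_deg := db,
      b8_deg := db8, c_deg := dc, b6_deg := db6, x6_deg := dx6, x15_deg := dx15,
      y15_deg := dy15, x10_deg := dx10, x9_deg := dx9, y9_deg := dy9, Q_deg := dQ,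
      b_nonreal := hbb, c_real := rc, b8_real := rb8, b6_real := rb6, y15_real := ry15,
      x10_real := rx10, y9_real := ry9, Q_real := rQ, Q_pos := hQp, Q_one := Q1, Q_b8 := Q8,
      Q_x10 := hq, Q_norm := by omega, b_bbar := by rw [mul_comm, hbar], b_b := hsq,
      b_c := hbc, b_b6 := hbb6, b_x6 := hbx6, b_x6bar := hbx6'.trans hc_b6, b_b8 := hbb8,
      b_x15 := hbx15, b_x15bar := hbx15', b_x10 := hbx10, b_y15 := hby15, c_c := hc_c,
      c_b6 := hc_b6, c_x6 := hcx6, c_b8 := hc_b8, c_x15 := hcx15, c_x10 := hcx10,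
      c_y15 := hcy15
      c_x9 := by
        linear_combination -c * hbx10 + b * hcx10 + hbb6 + hby15 - hcx15 - hcx6
      c_y9 := by
        linear_combination -c * hcx10 + x10 * hc_c - hc_b6 - hcy15 + b * hb'x10 - x10 * hbar
          + hbx15' + hbx6' + hc_b6 }⟩

end IntTable

/-! ### Further products in the forced part -/

namespace IntTable

variable {ι R : Type*} [Fintype ι] [DecidableEq ι] [CommRing R] {T : IntTable ι R}

/-- Two positive elements that are not orthogonal share a basis element. -/
theorem Pos.exists_common {a c : R} (ha : T.Pos a) (hc : T.Pos c) (h : 1 ≤ T.ip a c) :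
    ∃ x, T.IsB x ∧ 1 ≤ T.ip a x ∧ 1 ≤ T.ip c x := by
  obtain ⟨i, -, hi⟩ := exists_ne_zero_of_sum_ne_zero (s := univ)
    (f := fun i => T.coef a i * T.coef c i) (fun h0 => by simp only [ip] at h; omega)
  have h1 := left_ne_zero_of_mul hi
  have h2 := right_ne_zero_of_mul hi
  have h3 := ha i
  have h4 := hc i
  refine ⟨T.e i, ⟨i, rfl⟩, ?_, ?_⟩ <;> rw [← coef_eq_ip] <;> omega

theorem ip_bar_mul (a c d : R) : T.ip (T.bar a * c) d = T.ip c (a * d) := by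
  rw [ip_mul_left, T.bar_bar]

theorem ip_mul_mul_bar (a c : R) : T.ip (a * c) (a * c) = T.ip (T.bar a * c) (T.bar a * c) :=
  ip_congr (by simp only [map_mul, T.bar_bar]; ring)

theorem Pos.mul_deg_add_le {a x y : R} (ha : T.Pos a) (hx : T.IsB x) (hy : T.IsB y)
    (hxy : T.ip x y = 0) (h1 : 1 ≤ T.ip a x) (h2 : 1 ≤ T.ip a y) :
    T.Pos (a - x - y) :=
  (ha.sub hx h1).sub hy (by rw [sub_ip, hxy]; omega)

namespace Core

variable {b b8 c b6 x6 x15 y15 x10 x9 y9 Q : R}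

theorem bbar_b6 (h : T.Core b b8 c b6 x6 x15 y15 x10 x9 y9 Q) : T.bar b * b6 = b + x15 := by
  have := congrArg T.bar h.b_b6
  simpa only [map_mul, map_add, T.bar_bar, h.b6_real] using this

theorem bbar_c (h : T.Core b b8 c b6 x6 x15 y15 x10 x9 y9 Q) : T.bar b * c = b + x6 := by
  have := congrArg T.bar h.b_c
  simpa only [map_mul, map_add, T.bar_bar, h.c_real] using this

theorem bbar_x6 (h : T.Core b b8 c b6 x6 x15 y15 x10 x9 y9 Q) : T.bar b * x6 = b8 + x10 := by
  have := congrArg T.bar h.b_x6bar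
  simpa only [map_mul, map_add, T.bar_bar, h.b8_real, h.x10_real] using this

theorem bbar_x15 (h : T.Core b b8 c b6 x6 x15 y15 x10 x9 y9 Q) :
    T.bar b * x15 = b8 + x10 + Q := by
  have := congrArg T.bar h.b_x15bar
  simpa only [map_mul, map_add, T.bar_bar, h.b8_real, h.x10_real, h.Q_real] using this

theorem bbar_y15 (h : T.Core b b8 c b6 x6 x15 y15 x10 x9 y9 Q) :
    T.bar b * y15 = 2 * x15 + x6 + x9 := by
  have := congrArg T.bar h.b_y15
  simpa only [map_mul, map_add, map_ofNat, T.bar_bar, h.y15_real] using this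

theorem b_x15_real (h : T.Core b b8 c b6 x6 x15 y15 x10 x9 y9 Q) :
    T.bar b * T.bar x15 = b * x15 := by
  have := congrArg T.bar h.b_x15
  simp only [map_mul, map_add, map_ofNat, h.y15_real, h.b6_real, h.y9_real] at this
  rw [this, h.b_x15]

/-- The product `c * x̄₉`. -/
theorem c_x9bar (h : T.Core b b8 c b6 x6 x15 y15 x10 x9 y9 Q) :
    c * T.bar x9 = T.bar b * y9 := by
  have := congrArg T.bar h.c_x9
  simpa only [map_mul, h.c_real, h.y9_real] using this

theorem c_mul_Q (h : T.Core b b8 c b6 x6 x15 y15 x10 x9 y9 Q) :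
    c * Q = 3 * y15 + y9 + b * x9 := by
  linear_combination -c * h.c_y15 - h.c_b8 - h.c_x10 + y15 * h.c_c - y15 * h.b_bbar +
    b * h.bbar_y15 + 2 * h.b_x15 + h.b_x6

theorem c_x15bar (h : T.Core b b8 c b6 x6 x15 y15 x10 x9 y9 Q) :
    c * T.bar x15 = 2 * x15 + x6 + x9 := by
  have := congrArg T.bar h.c_x15
  simpa only [map_mul, map_add, map_ofNat, T.bar_bar, h.c_real] using this

theorem c_x6bar (h : T.Core b b8 c b6 x6 x15 y15 x10 x9 y9 Q) :
    c * T.bar x6 = b + x15 := by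
  have := congrArg T.bar h.c_x6
  simpa only [map_mul, map_add, T.bar_bar, h.c_real] using this

theorem b8_x15 (h : T.Core b b8 c b6 x6 x15 y15 x10 x9 y9 Q) :
    b8 * x15 = 4 * x15 + 2 * x6 + 2 * x9 + b + T.bar b * y9 := by
  linear_combination -x15 * h.c_c + c * h.c_x15 + 2 * h.c_x15bar + h.c_x6bar + h.c_x9bar

/-- The products b·(b̄·x₁₅) and (b·b̄)·x₁₅ agree. As `Q` has four constituents, this distributes the
three explicit copies of x₁₅ and the one inside b̄·y₉ among them. -/
theorem b_mul_Q (h : T.Core b b8 c b6 x6 x15 y15 x10 x9 y9 Q) :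
    b * Q = 3 * x15 + x9 + T.bar b * y9 := by
  linear_combination -b * h.bbar_x15 + x15 * h.b_bbar + h.b8_x15 - h.b_b8 - h.b_x10

theorem b8_x6 (h : T.Core b b8 c b6 x6 x15 y15 x10 x9 y9 Q) :
    b8 * x6 = b + 2 * x15 + x6 + x9 := by
  linear_combination -x6 * h.b_bbar + b * h.bbar_x6 + h.b_b8 + h.b_x10

theorem b6_b8 (h : T.Core b b8 c b6 x6 x15 y15 x10 x9 y9 Q) :
    b6 * b8 = 2 * y15 + b6 + y9 + c := by
  linear_combination -b6 * h.b_bbar + b * h.bbar_b6 + h.b_b + h.b_x15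

/-- In the formula for `c * Q` every other term is real. -/
theorem b_x9_real (h : T.Core b b8 c b6 x6 x15 y15 x10 x9 y9 Q) :
    T.bar (b * x9) = b * x9 := by
  have := congrArg T.bar h.c_mul_Q
  simp only [map_mul, map_add, map_ofNat, h.y15_real, h.c_real, h.y9_real, h.Q_real] at this
  rw [map_mul]
  linear_combination h.c_mul_Q - this

theorem bbar_x9 (h : T.Core b b8 c b6 x6 x15 y15 x10 x9 y9 Q) :
    T.bar b * x9 = c * y9 := by
  have := congrArg T.bar h.c_y9
  simp only [map_mul, T.bar_bar, h.y9_real, h.c_real] at this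
  exact this.symm

/-! Multiplication by an element with `b * v = x₁₅` and `c * v = y₁₅`. -/

theorem x6_mul {v : R} (h : T.Core b b8 c b6 x6 x15 y15 x10 x9 y9 Q)
    (hb : b * v = x15) (hc : c * v = y15) : x6 * v = x15 + x6 + x9 := by
  linear_combination -v * h.bbar_c + T.bar b * hc + h.bbar_y15 - hb

theorem x15_mul {v : R} (h : T.Core b b8 c b6 x6 x15 y15 x10 x9 y9 Q)
    (hb : b * v = x15) (hc : c * v = y15) :
    x15 * v = 2 * x15 + x6 + x9 + b + T.bar b * y9 := by
  linear_combination -v * h.b_b8 + b8 * hb + h.b8_x15 - hb - h.x6_mul hb hc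

theorem x10_x15 (h : T.Core b b8 c b6 x6 x15 y15 x10 x9 y9 Q) :
    x10 * x15 = b8 * x15 + b8 * x9 - x15 - T.bar b * y9 := by
  linear_combination -x10 * h.b_b8 + b8 * h.b_x10 + h.b8_x6 + x10 * h.bbar_c -
    T.bar b * h.c_x10 - h.bbar_b6 - h.bbar_y15

/-- Associativity applied to b·x₁₀·v. When `v` is positive the left side is positive while the right
side is a difference; this, and its companion for y₉, are the main constraints used to refute `Bad`.
-/
theorem x9_mul {v : R} (h : T.Core b b8 c b6 x6 x15 y15 x10 x9 y9 Q)
    (hb : b * v = x15) (hc : c * v = y15) : x9 * v = b8 * x9 - T.bar b * y9 := by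
  linear_combination -v * h.b_x10 + x10 * hb + h.x10_x15 - h.x15_mul hb hc - h.x6_mul hb hc
    + h.b8_x15

theorem b6_mul {v : R} (h : T.Core b b8 c b6 x6 x15 y15 x10 x9 y9 Q)
    (hb : b * v = x15) (hc : c * v = y15) : b6 * v = y15 + b6 + y9 := by
  linear_combination -v * h.b_b + b * hb + h.b_x15 - hc

theorem y9_mul {v : R} (h : T.Core b b8 c b6 x6 x15 y15 x10 x9 y9 Q)
    (hb : b * v = x15) (hc : c * v = y15) : y9 * v = b8 * y9 - b * x9 := by
  linear_combination -v * h.c_x10 + x10 * hc - h.b6_mul hb hc - x10 * h.c_b8 + b8 * h.c_x10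
    + h.b6_b8 + x10 * h.b_b - b * h.b_x10 - h.b_x15 - h.b_x6 + v * h.c_b8 - b8 * hc
    + hc + h.b6_mul hb hc

end Core

end IntTable

/-! ### The constituents of Q and the multiplicity of y₉ in b·x₉ -/

namespace IntTable

variable {ι R : Type*} [Fintype ι] [DecidableEq ι] [CommRing R] {T : IntTable ι R}

/-- Equality of degrees forces `b * d = y`. Then `T.bar b * d` has the same norm 1, so it is a basis
element, and `z` occurs in it. -/
theorem IsB.deg_of_product {b d y z : R} (hb : T.IsB b) (hd : T.IsB d) (hy : T.IsB y)
    (hz : T.IsB z) (hdeg : T.deg b * T.deg d = T.deg y) (h1 : 1 ≤ T.ip (b * d) y)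
    (h2 : 1 ≤ T.ip (b * z) d) : T.bar b * d = z := by
  have e1 : b * d = y := sub_eq_zero.1 (((hb.pos.mul hd.pos).sub hy h1).eq_zero (by
    rw [map_sub, map_mul]; omega))
  have e2 : T.IsB (T.bar b * d) := by
    refine (hb.bar.pos.mul hd.pos).isB_of_norm ?_
    rw [← ip_mul_mul_bar, e1, hy.ip_self]
  refine (hz.eq_of_ip e2 ?_).symm
  rw [ip_mul_left] at h2; omega

namespace Core

variable {b b8 c b6 x6 x15 y15 x10 x9 y9 Q : R}

theorem ip_b_x9_y15 (h : T.Core b b8 c b6 x6 x15 y15 x10 x9 y9 Q) : T.ip (b * x9) y15 = 1 := by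
  rw [ip_mul_left, h.bbar_y15, ip_add, ip_add, ip_ofNat_mul, h.x9_isB.ip_self,
    h.x9_isB.ip_deg_ne h.x15_isB (by rw [h.x9_deg, h.x15_deg]; decide),
    h.x9_isB.ip_deg_ne h.x6_isB (by rw [h.x9_deg, h.x6_deg]; decide)]
  rfl

theorem ip_bbar_y9_x15 (h : T.Core b b8 c b6 x6 x15 y15 x10 x9 y9 Q) :
    T.ip (T.bar b * y9) x15 = 1 := by
  rw [ip_bar_mul, h.b_x15, ip_add, ip_add, ip_ofNat_mul, h.y9_isB.ip_self,
    h.y9_isB.ip_deg_ne h.y15_isB (by rw [h.y9_deg, h.y15_deg]; decide),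
    h.y9_isB.ip_deg_ne h.b6_isB (by rw [h.y9_deg, h.b6_deg]; decide)]
  rfl

theorem ip_bbar_y9_x9 :
    T.ip (T.bar b * y9) x9 = T.ip (b * x9) y9 := by
  rw [ip_bar_mul, ip_comm]

theorem bbar_y9_pos (h : T.Core b b8 c b6 x6 x15 y15 x10 x9 y9 Q) : T.Pos (T.bar b * y9) :=
  h.b_isB.bar.pos.mul h.y9_isB.pos

theorem b_x9_pos (h : T.Core b b8 c b6 x6 x15 y15 x10 x9 y9 Q) : T.Pos (b * x9) :=
  h.b_isB.pos.mul h.x9_isB.pos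

theorem bbar_deg (h : T.Core b b8 c b6 x6 x15 y15 x10 x9 y9 Q) : T.deg (T.bar b) = 3 := by
  rw [T.deg_bar, h.b_deg]

/-- The products b·y₉ and c·x₉ coincide, and b·w and c·w have equal norms because b·b̄ = c². -/
theorem norm_eq (h : T.Core b b8 c b6 x6 x15 y15 x10 x9 y9 Q) :
    T.ip (T.bar b * y9) (T.bar b * y9) = T.ip (b * x9) (b * x9) := by
  rw [← ip_mul_mul_bar, ← h.c_x9]
  refine ip_congr ?_
  simp only [map_mul, h.c_real]
  linear_combination x9 * T.bar x9 * h.c_c - x9 * T.bar x9 * h.b_bbar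

/-- Beyond y₁₅ only degree 12 is left in b·x₉, which has room for at most one y₉. -/
theorem t_cases (h : T.Core b b8 c b6 x6 x15 y15 x10 x9 y9 Q) :
    T.ip (b * x9) y9 = 0 ∨ T.ip (b * x9) y9 = 1 := by
  have h0 := h.b_x9_pos.ip_nonneg h.y9_isB.pos
  have h1 := (h.b_x9_pos.sub h.y15_isB h.ip_b_x9_y15.ge).mul_deg_le h.y9_isB
    (k := T.ip (b * x9) y9) (by
      rw [sub_ip, h.y15_isB.ip_deg_ne h.y9_isB (by rw [h.y9_deg, h.y15_deg]; decide)]; omega)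
  rw [map_sub, map_mul, h.b_deg, h.x9_deg, h.y15_deg, h.y9_deg] at h1
  omega

/-- The basic properties of a constituent of `Q`. -/
structure Part (T : IntTable ι R) (b b8 c x15 y15 x10 Q z : R) : Prop where
  isB : T.IsB z
  ip_Q : T.ip Q z = 1
  ip_one : T.ip z 1 = 0
  ip_b8 : T.ip z b8 = 0
  ip_x10 : T.ip z x10 = 0
  ip_x15 : T.ip (b * z) x15 = 1
  ip_y15 : T.ip (c * z) y15 = 1
  deg_ge : 5 ≤ T.deg z

theorem part {z : R} (h : T.Core b b8 c b6 x6 x15 y15 x10 x9 y9 Q) (hz : T.IsB z)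
    (hQ : 1 ≤ T.ip Q z) : Part T b b8 c x15 y15 x10 Q z := by
  have key : ∀ w, T.IsB w → T.ip Q w = 0 → T.ip z w = 0 := fun w hw h0 =>
    hz.ip_ne hw (by rintro rfl; omega)
  have h1 := key 1 isB_one h.Q_one
  have h8 := key b8 h.b8_isB h.Q_b8
  have h10 := key x10 h.x10_isB h.Q_x10
  -- With multiplicity m the norm of Q − 2z is 8 − 4m, so m ≤ 2. Multiplicity 2 would make Q = 2z,
  -- impossible because 27 is odd.
  have hQz : T.ip Q z = 1 := by
    have n1 := ip_self_sub (T := T) (Q - z) z hz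
    rw [ip_self_sub Q z hz, h.Q_norm, sub_ip Q z z, hz.ip_self] at n1
    have n2 := ip_self_nonneg (T := T) (Q - z - z)
    by_contra hne
    have n3 : Q - z - z = 0 := eq_zero_of_ip_self (T := T) (by omega)
    have := congrArg T.deg n3
    rw [map_sub, map_sub, map_zero, h.Q_deg] at this
    omega
  have h15 : T.ip (b * z) x15 = 1 := by
    rw [ip_mul_left, h.bbar_x15, ip_add, ip_add, h8, h10, ip_comm, hQz]; rfl
  refine ⟨hz, hQz, h1, h8, h10, h15, ?_, ?_⟩
  · rw [ip_mul_left, h.c_real, h.c_y15, ip_add, ip_add, h8, h10, ip_comm, hQz]; rfl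
  · have := (h.b_isB.pos.mul hz.pos).deg_le h.x15_isB h15.ge
    rw [map_mul, h.b_deg, h.x15_deg] at this
    omega

theorem Part.rest_pos {z : R} (hz : Part T b b8 c x15 y15 x10 Q z)
    (h : T.Core b b8 c b6 x6 x15 y15 x10 x9 y9 Q) : T.Pos (b * z - x15) :=
  (h.b_isB.pos.mul hz.isB.pos).sub h.x15_isB hz.ip_x15.ge

theorem Part.b_mul {z : R} (hz : Part T b b8 c x15 y15 x10 Q z) (hd : T.deg z = 5)
    (h : T.Core b b8 c b6 x6 x15 y15 x10 x9 y9 Q) : b * z = x15 :=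
  sub_eq_zero.1 ((hz.rest_pos h).eq_zero (by
    rw [map_sub, map_mul, h.b_deg, h.x15_deg, hd]; rfl))

theorem Part.c_mul {z : R} (hz : Part T b b8 c x15 y15 x10 Q z) (hd : T.deg z = 5)
    (h : T.Core b b8 c b6 x6 x15 y15 x10 x9 y9 Q) : c * z = y15 :=
  sub_eq_zero.1 (((h.c_isB.pos.mul hz.isB.pos).sub h.y15_isB hz.ip_y15.ge).eq_zero (by
    rw [map_sub, map_mul, h.c_deg, h.y15_deg, hd]; rfl))

theorem Part.bar {z : R} (hz : Part T b b8 c x15 y15 x10 Q z)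
    (h : T.Core b b8 c b6 x6 x15 y15 x10 x9 y9 Q) : Part T b b8 c x15 y15 x10 Q (T.bar z) :=
  h.part hz.isB.bar (by rw [← h.Q_real, ip_bar_bar, hz.ip_Q])

/-- The square of the absolute value of a constituent of degree five. -/
theorem Part.exists_sq {v : R} (hv : Part T b b8 c x15 y15 x10 Q v) (hd : T.deg v = 5)
    (h : T.Core b b8 c b6 x6 x15 y15 x10 x9 y9 Q) :
    ∃ P, v * T.bar v = 1 + x10 + P ∧ T.Pos P ∧ T.ip P 1 = 0 ∧ T.ip P b8 = 0 ∧ T.ip P x10 = 0 ∧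
      b * P = x15 + T.bar b * y9 ∧ T.deg P = 14 := by
  have hb := hv.b_mul hd h
  have hc := hv.c_mul hd h
  have hd' : T.deg (T.bar v) = 5 := by rw [T.deg_bar, hd]
  have hb' := (hv.bar h).b_mul hd' h
  have hc' := (hv.bar h).c_mul hd' h
  have hbv : T.bar b * v = T.bar x15 := by
    have := congrArg T.bar hb'
    rwa [map_mul, T.bar_bar] at this
  have e1 : T.ip (v * T.bar v) 1 = 1 := by
    rw [← ip_eq_one, hv.isB.ip_self]
  -- The product b·v = x₁₅ has norm 1, and this norm pairs v·v̄ with 1 + b₈; the constituent 1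
  -- already accounts for it.
  have e8 : T.ip (v * T.bar v) b8 = 0 := by
    have h1 : T.ip (b * v) (b * v) = T.ip (v * T.bar v) (1 + b8) := ip_congr (by
      simp only [map_mul, map_add, map_one, h.b8_real]
      linear_combination v * T.bar v * h.b_bbar)
    rw [hb, h.x15_isB.ip_self, ip_add, e1] at h1
    omega
  -- Testing v·v̄ against b·x̄₆ = b₈ + x₁₀ amounts to pairing b̄·v = x̄₁₅ with v·x̄₆, which contains
  -- x̄₁₅ once.
  have e10 : T.ip (v * T.bar v) x10 = 1 := by
    have h1 : v * T.bar x6 = T.bar x15 + T.bar x6 + T.bar x9 := by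
      linear_combination -v * h.b_c + b * hc + h.b_y15 - hbv
    have h2 : T.ip (T.bar b * v) (v * T.bar x6) = T.ip (v * T.bar v) (b * T.bar x6) := ip_congr (by
      simp only [map_mul, T.bar_bar]; ring)
    rw [hbv, h1, h.b_x6bar, ip_add, ip_add, ip_bar_bar, ip_bar_bar, ip_bar_bar, ip_add, e8,
      h.x15_isB.ip_self, h.x15_isB.ip_deg_ne h.x6_isB (by rw [h.x15_deg, h.x6_deg]; decide),
      h.x15_isB.ip_deg_ne h.x9_isB (by rw [h.x15_deg, h.x9_deg]; decide)] at h2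
    omega
  have o10 : T.ip 1 x10 = 0 := isB_one.ip_deg_ne h.x10_isB (by rw [h.x10_deg, map_one]; decide)
  have o8 : T.ip 1 b8 = 0 := isB_one.ip_deg_ne h.b8_isB (by rw [h.b8_deg, map_one]; decide)
  have o108 : T.ip x10 b8 = 0 := h.x10_isB.ip_deg_ne h.b8_isB
    (by rw [h.b8_deg, h.x10_deg]; decide)
  refine ⟨v * T.bar v - 1 - x10, by ring, ((hv.isB.pos.mul hv.isB.bar.pos).sub isB_one e1.ge).sub
    h.x10_isB ?_, ?_, ?_, ?_, ?_, ?_⟩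
  · rw [sub_ip, e10, o10]; rfl
  · rw [sub_ip, sub_ip, e1, isB_one.ip_self, ip_comm, o10]; rfl
  · rw [sub_ip, sub_ip, e8, o8, o108]; rfl
  · rw [sub_ip, sub_ip, e10, o10, h.x10_isB.ip_self]; rfl
  · linear_combination T.bar v * hb + h.x15_mul hb' hc' - h.b_x10
  · rw [map_sub, map_sub, map_mul, hd', hd, map_one, h.x10_deg]; rfl

end Core

end IntTable

/-! ### The case of multiplicity zero: constraints on D and E -/

namespace IntTable

variable {ι R : Type*} [Fintype ι] [DecidableEq ι] [CommRing R] {T : IntTable ι R}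

/-- The configuration in which `y₉` does not occur in `b * x₉`; it will be refuted. -/
structure Bad (T : IntTable ι R) (b b8 c b6 x6 x15 y15 x10 x9 y9 Q D E z u u' v : R) : Prop where
  core : T.Core b b8 c b6 x6 x15 y15 x10 x9 y9 Q
  D_eq : T.bar b * y9 = x15 + D
  E_eq : b * x9 = y15 + E
  D_pos : T.Pos D
  E_pos : T.Pos E
  D_x9 : T.ip D x9 = 0
  E_y9 : T.ip E y9 = 0
  hz : Core.Part T b b8 c x15 y15 x10 Q z
  hu : Core.Part T b b8 c x15 y15 x10 Q u
  hu' : Core.Part T b b8 c x15 y15 x10 Q u'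
  hv : Core.Part T b b8 c x15 y15 x10 Q v
  sum : Q = z + u + u' + v
  z_x9 : T.ip (b * z) x9 = 1
  v_deg : T.deg v = 5

namespace Bad

variable {b b8 c b6 x6 x15 y15 x10 x9 y9 Q D E z u u' v : R}

theorem swap (H : Bad T b b8 c b6 x6 x15 y15 x10 x9 y9 Q D E z u u' v) :
    Bad T b b8 c b6 x6 x15 y15 x10 x9 y9 Q D E z u' u v :=
  { H with hu := H.hu', hu' := H.hu, sum := by rw [H.sum]; ring }

theorem D_deg (H : Bad T b b8 c b6 x6 x15 y15 x10 x9 y9 Q D E z u u' v) : T.deg D = 12 := by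
  have := congrArg T.deg H.D_eq
  rw [map_mul, map_add, H.core.bbar_deg, H.core.y9_deg, H.core.x15_deg] at this
  omega

theorem E_deg (H : Bad T b b8 c b6 x6 x15 y15 x10 x9 y9 Q D E z u u' v) : T.deg E = 12 := by
  have := congrArg T.deg H.E_eq
  rw [map_mul, map_add, H.core.b_deg, H.core.x9_deg, H.core.y15_deg] at this
  omega

theorem D_x15 (H : Bad T b b8 c b6 x6 x15 y15 x10 x9 y9 Q D E z u u' v) : T.ip D x15 = 0 := by
  have := H.core.ip_bbar_y9_x15
  rw [H.D_eq, add_ip, H.core.x15_isB.ip_self] at this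
  omega

theorem E_y15 (H : Bad T b b8 c b6 x6 x15 y15 x10 x9 y9 Q D E z u u' v) : T.ip E y15 = 0 := by
  have := H.core.ip_b_x9_y15
  rw [H.E_eq, add_ip, H.core.y15_isB.ip_self] at this
  omega

theorem ip_D (H : Bad T b b8 c b6 x6 x15 y15 x10 x9 y9 Q D E z u u' v) (w : R) :
    T.ip D w = T.ip y9 (b * w) - T.ip x15 w := by
  rw [← ip_bar_mul, H.D_eq, add_ip]; ring

theorem ip_E (H : Bad T b b8 c b6 x6 x15 y15 x10 x9 y9 Q D E z u u' v) (w : R) :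
    T.ip E w = T.ip x9 (T.bar b * w) - T.ip y15 w := by
  rw [← ip_mul_left, H.E_eq, add_ip]; ring

theorem D_b (H : Bad T b b8 c b6 x6 x15 y15 x10 x9 y9 Q D E z u u' v) : T.ip D b = 0 := by
  have h := H.core
  rw [H.ip_D, h.b_b, ip_add, h.y9_isB.ip_deg_ne h.c_isB (by rw [h.y9_deg, h.c_deg]; decide),
    h.y9_isB.ip_deg_ne h.b6_isB (by rw [h.y9_deg, h.b6_deg]; decide),
    h.x15_isB.ip_deg_ne h.b_isB (by rw [h.x15_deg, h.b_deg]; decide)]; rfl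

theorem D_x6 (H : Bad T b b8 c b6 x6 x15 y15 x10 x9 y9 Q D E z u u' v) : T.ip D x6 = 0 := by
  have h := H.core
  rw [H.ip_D, h.b_x6, ip_add, h.y9_isB.ip_deg_ne h.c_isB (by rw [h.y9_deg, h.c_deg]; decide),
    h.y9_isB.ip_deg_ne h.y15_isB (by rw [h.y9_deg, h.y15_deg]; decide),
    h.x15_isB.ip_deg_ne h.x6_isB (by rw [h.x15_deg, h.x6_deg]; decide)]; rfl

theorem D_one (H : Bad T b b8 c b6 x6 x15 y15 x10 x9 y9 Q D E z u u' v) : T.ip D 1 = 0 := by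
  have h := H.core
  rw [H.ip_D, mul_one, h.y9_isB.ip_deg_ne h.b_isB (by rw [h.y9_deg, h.b_deg]; decide),
    h.x15_isB.ne_one (by rw [h.x15_deg]; decide)]; rfl

theorem E_b6 (H : Bad T b b8 c b6 x6 x15 y15 x10 x9 y9 Q D E z u u' v) : T.ip E b6 = 0 := by
  have h := H.core
  rw [H.ip_E, h.bbar_b6, ip_add, h.x9_isB.ip_deg_ne h.b_isB (by rw [h.x9_deg, h.b_deg]; decide),
    h.x9_isB.ip_deg_ne h.x15_isB (by rw [h.x9_deg, h.x15_deg]; decide),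
    h.y15_isB.ip_deg_ne h.b6_isB (by rw [h.y15_deg, h.b6_deg]; decide)]; rfl

theorem E_real (H : Bad T b b8 c b6 x6 x15 y15 x10 x9 y9 Q D E z u u' v) : T.bar E = E := by
  have h1 := H.core.b_x9_real
  rw [H.E_eq, map_add, H.core.y15_real] at h1
  linear_combination h1

theorem bQ (H : Bad T b b8 c b6 x6 x15 y15 x10 x9 y9 Q D E z u u' v) :
    b * Q = 4 * x15 + x9 + D := by
  linear_combination H.core.b_mul_Q + H.D_eq

theorem norm_D (H : Bad T b b8 c b6 x6 x15 y15 x10 x9 y9 Q D E z u u' v) :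
    T.ip D D = T.ip E E := by
  have := H.core.norm_eq
  rw [H.D_eq, H.E_eq] at this
  simp only [ip_add, add_ip, H.core.x15_isB.ip_self, H.core.y15_isB.ip_self, ip_comm y15 E,
    ip_comm x15 D, H.D_x15, H.E_y15] at this
  omega

theorem norm_b_x9 (H : Bad T b b8 c b6 x6 x15 y15 x10 x9 y9 Q D E z u u' v) :
    T.ip (b * x9) (b * x9) = 1 + T.ip D D := by
  rw [H.norm_D, H.E_eq, ip_add, add_ip, add_ip, H.core.y15_isB.ip_self, ip_comm y15 E, H.E_y15]
  ring

/-- A constituent of `Q` other than `z` is involved only with `x₁₅` and `D`. -/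
theorem rest (H : Bad T b b8 c b6 x6 x15 y15 x10 x9 y9 Q D E z u u' v) :
    D = (b * z - x15 - x9) + (b * u - x15) + (b * u' - x15) := by
  have h1 := H.hv.b_mul H.v_deg H.core
  have h2 := H.bQ
  rw [H.sum] at h2
  linear_combination h1 - h2

theorem D1_pos (H : Bad T b b8 c b6 x6 x15 y15 x10 x9 y9 Q D E z u u' v) :
    T.Pos (b * z - x15 - x9) := by
  refine (H.hz.rest_pos H.core).sub H.core.x9_isB ?_
  rw [sub_ip, H.z_x9, H.core.x15_isB.ip_deg_ne H.core.x9_isB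
    (by rw [H.core.x15_deg, H.core.x9_deg]; decide)]; rfl

theorem x9_v (H : Bad T b b8 c b6 x6 x15 y15 x10 x9 y9 Q D E z u u' v) :
    x9 * v = b8 * x9 - T.bar b * y9 :=
  H.core.x9_mul (H.hv.b_mul H.v_deg H.core) (H.hv.c_mul H.v_deg H.core)

theorem y9_v (H : Bad T b b8 c b6 x6 x15 y15 x10 x9 y9 Q D E z u u' v) :
    y9 * v = b8 * y9 - b * x9 :=
  H.core.y9_mul (H.hv.b_mul H.v_deg H.core) (H.hv.c_mul H.v_deg H.core)

/-- The product x₉·v has degree 45 and contains x₆, x₁₅ and exactly ‖D‖² copies of x₉. The remaining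
degree 24 allows at most two copies. -/
theorem norm_D_le (H : Bad T b b8 c b6 x6 x15 y15 x10 x9 y9 Q D E z u u' v) :
    T.ip D D ≤ 2 := by
  have h := H.core
  have n1 : T.ip (b8 * x9) x9 = T.ip D D := by
    have h1 : T.ip (b * x9) (b * x9) = T.ip ((1 + b8) * x9) x9 := ip_congr (by
      simp only [map_mul]; linear_combination x9 * T.bar x9 * h.b_bbar)
    rw [H.norm_b_x9, add_mul, one_mul, add_ip, h.x9_isB.ip_self] at h1
    omega
  have a1 : T.ip x9 x15 = 0 := h.x9_isB.ip_deg_ne h.x15_isB (by rw [h.x9_deg, h.x15_deg]; decide)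
  have a2 : T.ip x9 x6 = 0 := h.x9_isB.ip_deg_ne h.x6_isB (by rw [h.x9_deg, h.x6_deg]; decide)
  have a3 : T.ip x9 b = 0 := h.x9_isB.ip_deg_ne h.b_isB (by rw [h.x9_deg, h.b_deg]; decide)
  have a4 : T.ip x15 x6 = 0 := h.x15_isB.ip_deg_ne h.x6_isB (by rw [h.x15_deg, h.x6_deg]; decide)
  have e9 : T.ip (x9 * v) x9 = T.ip D D := by
    rw [H.x9_v, sub_ip, n1, H.D_eq, add_ip, ip_comm x15, a1, H.D_x9]; ring
  have e6 : T.ip (x9 * v) x6 = 1 := by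
    rw [H.x9_v, sub_ip, H.D_eq, add_ip, a4, H.D_x6, ip_mul_left, h.b8_real, h.b8_x6]
    simp only [ip_add, ip_ofNat_mul, a1, a2, a3, h.x9_isB.ip_self]; rfl
  have e15 : T.ip (x9 * v) x15 = 1 := by
    have h1 : T.ip x9 (T.bar b * y9) = 0 := by
      rw [H.D_eq, ip_add, a1, ip_comm, H.D_x9]; rfl
    rw [H.x9_v, sub_ip, h.ip_bbar_y9_x15, ip_mul_left, h.b8_real, h.b8_x15]
    simp only [ip_add, ip_ofNat_mul, a1, a2, a3, h1, h.x9_isB.ip_self]; rfl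
  have hp := (h.x9_isB.pos.mul H.hv.isB.pos).mul_deg_add_le h.x6_isB h.x15_isB
    (by rw [ip_comm, a4]) e6.ge e15.ge
  have := hp.mul_deg_le h.x9_isB (k := T.ip D D) (by
    rw [sub_ip, sub_ip, e9, ip_comm x6, a2, ip_comm x15, a1]; omega)
  rw [map_sub, map_sub, map_mul, h.x9_deg, h.x6_deg, h.x15_deg, H.v_deg] at this
  omega

/-- The remaining part of `b̄ * x₉`. -/
theorem exists_F (H : Bad T b b8 c b6 x6 x15 y15 x10 x9 y9 Q D E z u u' v) :
    ∃ F, T.bar b * x9 = x10 + z + F ∧ T.Pos F ∧ T.ip F F = T.ip D D - 1 ∧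
      T.deg F = 17 - T.deg z := by
  have h := H.core
  have a1 : T.ip (T.bar b * x9) x10 = 1 := by
    rw [ip_bar_mul, h.b_x10, ip_add, ip_add, h.x9_isB.ip_self,
      h.x9_isB.ip_deg_ne h.x15_isB (by rw [h.x9_deg, h.x15_deg]; decide),
      h.x9_isB.ip_deg_ne h.x6_isB (by rw [h.x9_deg, h.x6_deg]; decide)]; rfl
  have a2 : T.ip (T.bar b * x9) z = 1 := by rw [ip_bar_mul, ip_comm, H.z_x9]
  have a3 : T.ip x10 z = 0 := by rw [ip_comm, H.hz.ip_x10]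
  have n1 := ip_self_sub (T := T) (T.bar b * x9 - x10) z H.hz.isB
  have n2 := ip_self_sub (T := T) (T.bar b * x9) x10 h.x10_isB
  rw [← ip_mul_mul_bar, H.norm_b_x9, a1] at n2
  rw [n2, sub_ip _ x10 z, a2, a3] at n1
  refine ⟨T.bar b * x9 - x10 - z, by ring,
    (h.b_isB.bar.pos.mul h.x9_isB.pos).mul_deg_add_le h.x10_isB H.hz.isB a3 a1.ge a2.ge, ?_, ?_⟩
  · rw [n1]; ring
  · rw [map_sub, map_sub, map_mul, h.bbar_deg, h.x9_deg, h.x10_deg]; ring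

/-- Two evaluations of (b·b̄)·x₉, one of them through x₉·v. The bracket on the left is the part of
`D` that does not come from `z`; its constituents must be found in `b * F`. -/
theorem b_F {F : R} (H : Bad T b b8 c b6 x6 x15 y15 x10 x9 y9 Q D E z u u' v)
    (hF : T.bar b * x9 = x10 + z + F) :
    x9 * v + (D - (b * z - x15 - x9)) = b * F + x6 + x15 + x9 := by
  linear_combination H.x9_v - x9 * H.core.b_bbar + b * hF + H.core.b_x10 - H.D_eq

/-- Compares b·(b̄·y₉) with c·(c·y₉), using that c·y₉ = b̄·x₉. -/
theorem c_F {F : R} (H : Bad T b b8 c b6 x6 x15 y15 x10 x9 y9 Q D E z u u' v)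
    (hF : T.bar b * x9 = x10 + z + F) : b * D = c * z - y15 + c * F := by
  have h := H.core
  linear_combination -b * H.D_eq + y9 * h.b_bbar - y9 * h.c_c - c * h.bbar_x9 + c * hF
    + h.c_x10 - h.b_x15

section constituents

variable {d : R}

theorem d_ne (H : Bad T b b8 c b6 x6 x15 y15 x10 x9 y9 Q D E z u u' v) (hd : T.IsB d)
    (hD : 1 ≤ T.ip D d) :
    T.ip d x15 = 0 ∧ T.ip d x9 = 0 ∧ T.ip d x6 = 0 ∧ T.ip d b = 0 ∧ T.ip d 1 = 0 := by
  have h := H.core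
  refine ⟨hd.ip_ne h.x15_isB ?_, hd.ip_ne h.x9_isB ?_, hd.ip_ne h.x6_isB ?_,
    hd.ip_ne h.b_isB ?_, hd.ip_ne isB_one ?_⟩ <;> rintro rfl
  · have := H.D_x15; omega
  · have := H.D_x9; omega
  · have := H.D_x6; omega
  · have := H.D_b; omega
  · have := H.D_one; omega

theorem b_d_y9 (H : Bad T b b8 c b6 x6 x15 y15 x10 x9 y9 Q D E z u u' v) (hd : T.IsB d)
    (hD : 1 ≤ T.ip D d) : 1 ≤ T.ip (b * d) y9 := by
  have h1 := (H.d_ne hd hD).1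
  rw [ip_mul_left, H.D_eq, ip_add, h1, ip_comm]; omega

theorem b_d_one (H : Bad T b b8 c b6 x6 x15 y15 x10 x9 y9 Q D E z u u' v) (hd : T.IsB d)
    (hD : 1 ≤ T.ip D d) : T.ip (T.bar b * d) 1 = 0 := by
  rw [ip_bar_mul, mul_one, (H.d_ne hd hD).2.2.2.1]

/-- Positivity of x₉·v = x₁₅ + x₆ + b̄·E − D: a constituent of `D` differs from x₁₅ and x₆, so the
term b̄·E has to compensate for it. -/
theorem d_E (H : Bad T b b8 c b6 x6 x15 y15 x10 x9 y9 Q D E z u u' v) (hd : T.IsB d)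
    (hD : 1 ≤ T.ip D d) : 1 ≤ T.ip (b * d) E := by
  have h := H.core
  obtain ⟨n15, n9, n6, nb, n1⟩ := H.d_ne hd hD
  have e : x9 * v = x15 + x6 + T.bar b * E - D := by
    linear_combination H.x9_v - x9 * h.b_bbar + T.bar b * H.E_eq + h.bbar_y15 - H.D_eq
  have hp := (h.x9_isB.pos.mul H.hv.isB.pos).ip_nonneg hd.pos
  rw [e, sub_ip, add_ip, add_ip, ip_comm x15, n15, ip_comm x6, n6, ip_bar_mul, ip_comm E] at hp
  omega

/-- A constituent of degree 3 would give `b * d = y9`, but `b * d` must meet `E`, which is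
orthogonal to y₉. -/
theorem d_deg (H : Bad T b b8 c b6 x6 x15 y15 x10 x9 y9 Q D E z u u' v) (hd : T.IsB d)
    (hD : 1 ≤ T.ip D d) : 4 ≤ T.deg d := by
  have h := H.core
  rcases hd.deg_eq_one_or with rfl | h3
  · have := H.D_one; omega
  by_contra hlt
  have e : b * d - y9 = 0 := ((h.b_isB.pos.mul hd.pos).sub h.y9_isB (H.b_d_y9 hd hD)).eq_zero (by
    rw [map_sub, map_mul, h.b_deg, h.y9_deg]; omega)
  have := H.d_E hd hD
  rw [sub_eq_zero.1 e, ip_comm, H.E_y9] at this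
  omega

/-- The counterpart of `d_E` for y₉·v, which equals y₁₅ + b₆ plus the conjugate of b·D minus `E`. As
`E` is real, the test is made at the conjugate of `e`. -/
theorem e_D {e : R} (H : Bad T b b8 c b6 x6 x15 y15 x10 x9 y9 Q D E z u u' v) (he : T.IsB e)
    (hE : 1 ≤ T.ip E e) : 1 ≤ T.ip (b * D) e := by
  have h := H.core
  have hE' : 1 ≤ T.ip E (T.bar e) := by rwa [← ip_bar_left, H.E_real]
  have n15 : T.ip y15 (T.bar e) = 0 := h.y15_isB.ip_ne he.bar (by
    rintro h0; rw [← h0, H.E_y15] at hE'; omega)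
  have n6 : T.ip b6 (T.bar e) = 0 := h.b6_isB.ip_ne he.bar (by
    rintro h0; rw [← h0, H.E_b6] at hE'; omega)
  have hDbar : b * y9 = T.bar x15 + T.bar D := by
    have := congrArg T.bar H.D_eq
    simpa only [map_mul, map_add, T.bar_bar, h.y9_real] using this
  have e1 : y9 * v = y15 + b6 + T.bar (b * D) - E := by
    rw [map_mul]
    linear_combination H.y9_v - y9 * h.b_bbar + T.bar b * hDbar - H.E_eq + h.b_x15_real + h.b_x15
  have hp := (h.y9_isB.pos.mul H.hv.isB.pos).ip_nonneg he.bar.pos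
  rw [e1, sub_ip, add_ip, add_ip, n15, n6, ip_bar_bar] at hp
  omega

/-- In `b_F` the left side contains `d`, while x₆, x₁₅ and x₉ on the right do not. So `d` occurs in
`b * F`, and by adjointness `F` occurs in `T.bar b * d`. -/
theorem d_w {F : R} (H : Bad T b b8 c b6 x6 x15 y15 x10 x9 y9 Q D E z u u' v)
    (hF : T.bar b * x9 = x10 + z + F) (hd : T.IsB d) (hD : 1 ≤ T.ip D d)
    (hz : T.ip (b * z - x15 - x9) d = 0) : 1 ≤ T.ip (T.bar b * d) F := by
  have h := H.core
  obtain ⟨n15, n9, n6, nb, n1⟩ := H.d_ne hd hD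
  have e := congrArg (fun a => T.ip a d) (H.b_F hF)
  simp only [add_ip] at e
  rw [sub_ip, hz, ip_comm x15, n15, ip_comm x6, n6, ip_comm x9, n9] at e
  have hp := (h.x9_isB.pos.mul H.hv.isB.pos).ip_nonneg hd.pos
  rw [ip_bar_mul, ip_comm]
  omega

end constituents

end Bad

end IntTable

/-! ### The case of multiplicity zero: refutation by degrees -/

namespace IntTable

variable {ι R : Type*} [Fintype ι] [DecidableEq ι] [CommRing R] {T : IntTable ι R}

theorem Pos.two_mul_deg_le {a x y : R} (ha : T.Pos a) (hx : T.IsB x) (hy : T.IsB y)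
    (hxy : T.ip x y = 0) : T.ip a x * T.deg x + T.ip a y * T.deg y ≤ T.deg a := by
  have h := (ha.sub_zsmul hx le_rfl).mul_deg_le hy (k := T.ip a y) (by
    rw [sub_ip, zsmul_ip, hxy]; omega)
  rw [map_sub, map_zsmul, smul_eq_mul] at h
  omega

namespace Bad

variable {b b8 c b6 x6 x15 y15 x10 x9 y9 Q D E z u u' v d d' F : R}

theorem d_part (H : Bad T b b8 c b6 x6 x15 y15 x10 x9 y9 Q D E z u u' v) (hd : T.IsB d)
    (hD : 1 ≤ T.ip D d) (w : R) : T.ip (T.bar b * d) w = T.ip (b * w - x15) d := by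
  rw [ip_bar_mul, sub_ip, ip_comm x15, (H.d_ne hd hD).1, ip_comm]; ring

theorem d_part_z (H : Bad T b b8 c b6 x6 x15 y15 x10 x9 y9 Q D E z u u' v) (hd : T.IsB d)
    (hD : 1 ≤ T.ip D d) : T.ip (T.bar b * d) z = T.ip (b * z - x15 - x9) d := by
  rw [H.d_part hd hD, sub_ip _ x9, ip_comm x9, (H.d_ne hd hD).2.1]; ring

/-- No room for a remainder of degree one or two in `b̄ * d`. -/
theorem d_rest {p q : R} (H : Bad T b b8 c b6 x6 x15 y15 x10 x9 y9 Q D E z u u' v)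
    (hd : T.IsB d) (hD : 1 ≤ T.ip D d) (hp : T.IsB p) (hq : T.IsB q) (hpq : T.ip p q = 0)
    (h1 : 1 ≤ T.ip (T.bar b * d) p) (h2 : 1 ≤ T.ip (T.bar b * d) q) :
    T.Pos (T.bar b * d - p - q) ∧
      (T.deg p + T.deg q = 3 * T.deg d ∨ T.deg p + T.deg q + 3 ≤ 3 * T.deg d) := by
  have hpos := (H.core.b_isB.bar.pos.mul hd.pos).mul_deg_add_le hp hq hpq h1 h2
  refine ⟨hpos, ?_⟩
  have e1 := H.b_d_one hd hD
  have hne : ∀ r, T.IsB r → 1 ≤ T.ip (T.bar b * d) r → T.ip r 1 = 0 := fun r hr hr1 =>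
    hr.ip_ne isB_one (by rintro rfl; omega)
  have := hpos.deg_eq_zero_or (by rw [sub_ip, sub_ip, e1, hne p hp h1, hne q hq h2]; rfl)
  rw [map_sub, map_sub, map_mul, H.core.bbar_deg] at this
  omega

/-- Write v·v̄ = 1 + x₁₀ + P. The element P has degree 14, meets `Q` with total multiplicity 2 and
omits `z`, so removing its constituents `u`, `u'`, `v` leaves a basis element L of degree 4 with b·L
= D. Now b̄·d contains both `z` and L, of total degree 16, and a remainder of degree 2 is
impossible. So `d` and `d'` each have degree at least 7, although their sum is 12. -/
theorem false_of_both_z (H : Bad T b b8 c b6 x6 x15 y15 x10 x9 y9 Q D E z u u' v)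
    (hd : T.IsB d) (hd' : T.IsB d') (hD : D = d + d') (hdd : T.ip d d' = 0)
    (hz : T.deg z = 12) (hu : T.deg u = 5) (hu' : T.deg u' = 5)
    (h1 : 1 ≤ T.ip (b * z - x15 - x9) d) (h2 : 1 ≤ T.ip (b * z - x15 - x9) d') : False := by
  have h := H.core
  have hDd : T.ip D d = 1 := by rw [hD, add_ip, hd.ip_self, ip_comm, hdd]; rfl
  have hDd' : T.ip D d' = 1 := by rw [hD, add_ip, hd'.ip_self, hdd]; rfl
  have hdeg := H.D_deg
  rw [hD, map_add] at hdeg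
  obtain ⟨P, -, hP, hP1, hP8, hP10, hbP, dP⟩ := H.hv.exists_sq H.v_deg h
  have hbP' : b * P = 2 * x15 + D := by rw [hbP, H.D_eq]; ring
  have hPQ : T.ip P Q = 2 := by
    have h3 : T.ip (b * P) x15 = T.ip P (T.bar b * x15) := ip_mul_left _ _ _
    rw [hbP', h.bbar_x15, add_ip, ofNat_mul_ip, h.x15_isB.ip_self, H.D_x15, ip_add, ip_add, hP8,
      hP10] at h3
    omega
  -- If `z`, of degree 12, occurred in `P`, of degree 14, the remaining degree 2 would have to
  -- vanish.
  have hPz : T.ip P z = 0 := by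
    have h0 := hP.ip_nonneg H.hz.isB.pos
    by_contra hne
    have := hP.eq_of_deg_lt H.hz.isB (by omega) hP1 (by omega)
    rw [this, hz] at dP
    omega
  rw [H.sum, ip_add, ip_add, ip_add, hPz] at hPQ
  have orth : T.ip u u' = 0 ∧ T.ip u v = 0 ∧ T.ip u' v = 0 := by
    have e1 := H.hu.ip_Q
    have e2 := H.hu'.ip_Q
    rw [H.sum, add_ip, add_ip, add_ip, H.hu.isB.ip_self] at e1
    rw [H.sum, add_ip, add_ip, add_ip, H.hu'.isB.ip_self] at e2
    have p1 := H.hz.isB.pos.ip_nonneg H.hu.isB.pos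
    have p2 := H.hu'.isB.pos.ip_nonneg H.hu.isB.pos
    have p3 := H.hv.isB.pos.ip_nonneg H.hu.isB.pos
    have p4 := H.hz.isB.pos.ip_nonneg H.hu'.isB.pos
    have p5 := H.hu.isB.pos.ip_nonneg H.hu'.isB.pos
    have p6 := H.hv.isB.pos.ip_nonneg H.hu'.isB.pos
    rw [ip_comm u v, ip_comm u' v]
    omega
  obtain ⟨o1, o2, o3⟩ := orth
  obtain ⟨L, hL⟩ : ∃ L, P - T.ip P u • u - T.ip P u' • u' - T.ip P v • v = L := ⟨_, rfl⟩
  have hLp : T.Pos L := by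
    rw [← hL]
    refine ((hP.sub_zsmul H.hu.isB le_rfl).sub_zsmul H.hu'.isB ?_).sub_zsmul H.hv.isB ?_
    · rw [sub_ip, zsmul_ip, o1]; omega
    · rw [sub_ip, sub_ip, zsmul_ip, zsmul_ip, o2, o3]; omega
  have dL : T.deg L = 4 := by
    rw [← hL]
    simp only [map_sub, map_zsmul, smul_eq_mul, dP, hu, hu', H.v_deg]
    omega
  have hbL : b * L = D := by
    have hs : ((T.ip P u : ℤ) : R) + (T.ip P u' : ℤ) + (T.ip P v : ℤ) = 2 := by
      have : T.ip P u + T.ip P u' + T.ip P v = 2 := by omega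
      exact_mod_cast congrArg (Int.cast : ℤ → R) this
    rw [← hL]
    simp only [zsmul_eq_mul]
    linear_combination hbP' - (T.ip P u : R) * H.hu.b_mul hu h - (T.ip P u' : R) *
      H.hu'.b_mul hu' h - (T.ip P v : R) * H.hv.b_mul H.v_deg h - x15 * hs
  have hL1 : T.ip L 1 = 0 := by
    rw [← hL]
    simp only [sub_ip, zsmul_ip, hP1, H.hu.ip_one, H.hu'.ip_one, H.hv.ip_one]; ring
  have hLB : T.IsB L := hLp.isB_of_deg hL1 (by omega) (by omega)
  have hzL : T.ip z L = 0 := H.hz.isB.ip_deg_ne hLB (by omega)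
  have r1 := (H.d_rest hd hDd.ge H.hz.isB hLB hzL (by rwa [H.d_part_z hd hDd.ge])
    (by rw [ip_bar_mul, hbL, ip_comm, hDd])).2
  have r2 := (H.d_rest hd' hDd'.ge H.hz.isB hLB hzL (by rwa [H.d_part_z hd' hDd'.ge])
    (by rw [ip_bar_mul, hbL, ip_comm, hDd'])).2
  omega

/-- Here `E` splits into two basis elements of degree 6, the remainders of c·z and c·u. The product
b·d' contains y₉ and one constituent of `E`, so it leaves a basis element k of degree 3. By `c_F`
this k occurs in c·F, hence `F` occurs in c·k. But c·k has degree 9 and `F` degree 7, and a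
remainder of degree 2 is impossible. -/
theorem false_of_one_z (H : Bad T b b8 c b6 x6 x15 y15 x10 x9 y9 Q D E z u u' v)
    (hD : D = d + d') (hd' : T.IsB d') (hd : T.IsB d) (hdd : T.ip d d' = 0)
    (hn : T.ip E E = 2) (hF : T.bar b * x9 = x10 + z + F) (hFB : T.IsB F)
    (hz : T.deg z = 10) (hu : T.deg u = 7) (hu' : T.deg u' = 5) (h6 : T.deg d' = 6)
    (hFd : T.deg F = 7) : False := by
  have h := H.core
  have hDd' : T.ip D d' = 1 := by rw [hD, add_ip, hd'.ip_self, hdd]; rfl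
  have hcz : T.ip (c * z) y9 = 1 := by
    rw [ip_mul_left, h.c_real, ← h.bbar_x9, ← ip_mul_left, H.z_x9]
  obtain ⟨E1, hE1⟩ : ∃ x, c * z - y15 - y9 = x := ⟨_, rfl⟩
  obtain ⟨E2, hE2⟩ : ∃ x, c * u - y15 = x := ⟨_, rfl⟩
  have hE : E = E1 + E2 := by
    have h1 := h.c_mul_Q
    rw [H.sum] at h1
    rw [← hE1, ← hE2]
    linear_combination -h1 - H.E_eq + H.hu'.c_mul hu' h + H.hv.c_mul H.v_deg h
  have p1 : T.Pos E1 := by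
    rw [← hE1]
    exact (h.c_isB.pos.mul H.hz.isB.pos).mul_deg_add_le h.y15_isB h.y9_isB
      (h.y15_isB.ip_deg_ne h.y9_isB (by rw [h.y15_deg, h.y9_deg]; decide)) H.hz.ip_y15.ge hcz.ge
  have p2 : T.Pos E2 := by
    rw [← hE2]
    exact (h.c_isB.pos.mul H.hu.isB.pos).sub h.y15_isB H.hu.ip_y15.ge
  have d1 : T.deg E1 = 6 := by
    rw [← hE1, map_sub, map_sub, map_mul, h.c_deg, hz, h.y15_deg, h.y9_deg]; rfl
  have d2 : T.deg E2 = 6 := by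
    rw [← hE2, map_sub, map_mul, h.c_deg, hu, h.y15_deg]; rfl
  have hne : ∀ x, T.deg x = 6 → 1 ≤ T.ip x x := fun x hx => by
    rcases ip_self_eq_zero_or (T := T) x with h0 | h0
    · rw [h0, map_zero] at hx; omega
    · exact h0
  have hn' := hn
  rw [hE, add_ip, ip_add, ip_add, ip_comm E2 E1] at hn'
  have n1 := hne E1 d1
  have n2 := hne E2 d2
  have n12 := p1.ip_nonneg p2
  have B1 : T.IsB E1 := p1.isB_of_norm (by omega)
  have B2 : T.IsB E2 := p2.isB_of_norm (by omega)
  obtain ⟨e, heB, hed, heE⟩ := (h.b_isB.pos.mul hd'.pos).exists_common H.E_pos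
    (H.d_E hd' hDd'.ge)
  have de : T.deg e = 6 := by
    rw [hE, add_ip] at heE
    by_contra hne6
    rw [B1.ip_deg_ne heB (by omega), B2.ip_deg_ne heB (by omega)] at heE
    omega
  have dbd' : T.deg (b * d') = 18 := by rw [map_mul, h.b_deg, h6]; rfl
  have hp := (h.b_isB.pos.mul hd'.pos).mul_deg_add_le h.y9_isB heB
    (h.y9_isB.ip_deg_ne heB (by rw [h.y9_deg]; omega)) (H.b_d_y9 hd' hDd'.ge) hed
  obtain ⟨k, hk⟩ : ∃ x, b * d' - y9 - e = x := ⟨_, rfl⟩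
  rw [hk] at hp
  have dk : T.deg k = 3 := by
    rw [← hk, map_sub, map_sub, dbd', h.y9_deg, de]; rfl
  have hbD : ∀ w, T.ip (b * D) w = T.ip D (T.bar b * w) := fun w => ip_mul_left _ _ _
  have hsplit : b * D = b * d + (y9 + e + k) := by rw [hD, ← hk]; ring
  have hle : ∀ w, T.Pos w → T.ip k w ≤ T.ip (b * D) w := fun w hw => by
    have q1 := (h.b_isB.pos.mul hd.pos).ip_nonneg hw
    have q2 := h.y9_isB.pos.ip_nonneg hw
    have q3 := heB.pos.ip_nonneg hw
    rw [hsplit, add_ip, add_ip, add_ip]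
    omega
  have hk0 : ∀ w, T.Pos w → T.ip (b * D) w = 0 → T.ip k w = 0 := fun w hw h0 => by
    have := hle w hw
    have := hp.ip_nonneg hw
    omega
  have hk1 : T.ip k 1 = 0 := hk0 1 isB_one.pos (by
    rw [hbD, mul_one, H.ip_D, h.b_bbar, ip_add, h.y9_isB.ne_one (by rw [h.y9_deg]; decide),
      h.y9_isB.ip_deg_ne h.b8_isB (by rw [h.y9_deg, h.b8_deg]; decide),
      h.x15_isB.ip_deg_ne h.b_isB.bar (by rw [h.x15_deg, h.bbar_deg]; decide)]; rfl)
  have hkB : T.IsB k := hp.isB_of_deg hk1 (by omega) (by omega)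
  have hkc : T.ip k c = 0 := hk0 c h.c_isB.pos (by
    rw [hbD, h.bbar_c, ip_add, H.D_b, H.D_x6]; rfl)
  have hw : 1 ≤ T.ip (c * F) k := by
    have h1 := hle k hp
    have h2 : b * D = y9 + E1 + c * F := by
      rw [H.c_F hF, ← hE1]; ring
    rw [hkB.ip_self, h2, add_ip, add_ip,
      h.y9_isB.ip_deg_ne hkB (by rw [h.y9_deg]; omega), B1.ip_deg_ne hkB (by omega)] at h1
    omega
  have hck := (h.c_isB.pos.mul hkB.pos).eq_of_deg_lt hFB
    (by rwa [ip_mul_left, h.c_real, ip_comm])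
    (by rw [ip_mul_left, h.c_real, mul_one, hkc]) (by rw [map_mul, h.c_deg]; omega)
  have := congrArg T.deg hck
  rw [map_mul, h.c_deg] at this
  omega

/-- Both b̄·d and b̄·d' contain `u` and `F`, of total degree 18, so `d` and `d'` have degree 6 and
these products have norm 2. Hence b·d and b·d' are each y₉ plus a basis element of degree 9. By
`e_D` the two constituents of `E` then have degree 9, against the degree 12 of `E`. -/
theorem false_of_both_u (H : Bad T b b8 c b6 x6 x15 y15 x10 x9 y9 Q D E z u u' v)
    (hd : T.IsB d) (hd' : T.IsB d') (hD : D = d + d') (hdd : T.ip d d' = 0)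
    (hn : T.ip E E = 2) (hFB : T.IsB F) (hFd : T.deg F = 9) (hu : T.deg u = 9)
    (huF : T.ip u F = 0)
    (h1 : 1 ≤ T.ip (T.bar b * d) u) (h2 : 1 ≤ T.ip (T.bar b * d') u)
    (h3 : 1 ≤ T.ip (T.bar b * d) F) (h4 : 1 ≤ T.ip (T.bar b * d') F) : False := by
  have h := H.core
  have hDd : T.ip D d = 1 := by rw [hD, add_ip, hd.ip_self, ip_comm, hdd]; rfl
  have hDd' : T.ip D d' = 1 := by rw [hD, add_ip, hd'.ip_self, hdd]; rfl
  have hdeg := H.D_deg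
  rw [hD, map_add] at hdeg
  obtain ⟨hp, r1⟩ := H.d_rest hd hDd.ge H.hu.isB hFB huF h1 h3
  obtain ⟨hp', r2⟩ := H.d_rest hd' hDd'.ge H.hu.isB hFB huF h2 h4
  have key : ∀ f, T.IsB f → T.ip D f = 1 → T.deg f = 6 → T.Pos (T.bar b * f - u - F) →
      ∃ r, b * f = y9 + r ∧ T.IsB r ∧ T.deg r = 9 := by
    intro f hf hDf h6 hpf
    have e0 := hpf.eq_zero (by
      rw [map_sub, map_sub, map_mul, h.bbar_deg, h6, hu, hFd]; rfl)
    have e1 : T.bar b * f = u + F := by linear_combination e0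
    have n : T.ip (b * f) (b * f) = 2 := by
      rw [ip_mul_mul_bar, e1, add_ip, ip_add, ip_add, H.hu.isB.ip_self, hFB.ip_self,
        ip_comm F, huF]; rfl
    obtain ⟨-, q1, q2⟩ := (h.b_isB.pos.mul hf.pos).peel (by omega) h.y9_isB
      (H.b_d_y9 hf hDf.ge)
    exact ⟨b * f - y9, by ring, q1.isB_of_norm (by omega), by
      rw [map_sub, map_mul, h.b_deg, h6, h.y9_deg]; rfl⟩
  obtain ⟨r, hr, hrB, hrd⟩ := key d hd hDd (by omega) hp
  obtain ⟨r', hr', hrB', hrd'⟩ := key d' hd' hDd' (by omega) hp'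
  obtain ⟨e, e', heB, heB', hE, hee⟩ := H.E_pos.norm_two hn
  have key2 : ∀ f, T.IsB f → 1 ≤ T.ip E f → T.deg f = 9 := by
    intro f hf hEf
    have h5 := H.e_D hf hEf
    by_contra hne
    rw [hD, mul_add, hr, hr', add_ip, add_ip, add_ip,
      h.y9_isB.ip_deg_ne hf (by rw [h.y9_deg]; omega), hrB.ip_deg_ne hf (by omega),
      hrB'.ip_deg_ne hf (by omega)] at h5
    omega
  have q1 := key2 e heB (by rw [hE, add_ip, heB.ip_self, ip_comm, hee]; omega)
  have q2 := key2 e' heB' (by rw [hE, add_ip, heB'.ip_self, hee]; omega)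
  have := H.E_deg
  rw [hE, map_add] at this
  omega

/-- Each of `d`, `d'` lies in exactly one of the remainders of b·z, b·u, b·u'. These remainders have
degrees divisible by 3 and total degree 12, and each constituent has degree at least 4, so the
distribution fixes the degrees of z, u, u': both in z gives 12, 5, 5; one in z gives 10, 7, 5; both
in u gives 8, 9, 5, up to exchanging u and u'. If u and u' take one each, the degrees are 8, 7, 7;
then b̄·d, of degree 18, contains constituents of degrees 7 and 9, leaving an impossible 2. -/
theorem false_of_norm_two (H : Bad T b b8 c b6 x6 x15 y15 x10 x9 y9 Q D E z u u' v)
    (hd : T.IsB d) (hd' : T.IsB d') (hD : D = d + d') (hdd : T.ip d d' = 0)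
    (hn : T.ip E E = 2) (hF : T.bar b * x9 = x10 + z + F) (hFB : T.IsB F)
    (hFd : T.deg F = 17 - T.deg z) : False := by
  have h := H.core
  have hd'd : T.ip d' d = 0 := by rw [ip_comm, hdd]
  have hDd : T.ip D d = 1 := by rw [hD, add_ip, hd.ip_self, hd'd]; rfl
  have hDd' : T.ip D d' = 1 := by rw [hD, add_ip, hd'.ip_self, hdd]; rfl
  have hdeg := H.D_deg
  rw [hD, map_add] at hdeg
  have g := H.d_deg hd hDd.ge
  have g' := H.d_deg hd' hDd'.ge
  have pu := H.hu.rest_pos h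
  have pu' := H.hu'.rest_pos h
  have t1 := H.D1_pos.two_mul_deg_le hd hd' hdd
  have t2 := pu.two_mul_deg_le hd hd' hdd
  have t3 := pu'.two_mul_deg_le hd hd' hdd
  have s1 := H.D1_pos.ip_nonneg hd.pos
  have s1' := H.D1_pos.ip_nonneg hd'.pos
  have s2 := pu.ip_nonneg hd.pos
  have s2' := pu.ip_nonneg hd'.pos
  have s3 := pu'.ip_nonneg hd.pos
  have s3' := pu'.ip_nonneg hd'.pos
  have e := congrArg (fun a => T.ip a d) H.rest
  have e' := congrArg (fun a => T.ip a d') H.rest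
  simp only [add_ip] at e e'
  rw [hDd] at e
  rw [hDd'] at e'
  have m1 : T.deg (b * z - x15 - x9) = 3 * T.deg z - 24 := by
    rw [map_sub, map_sub, map_mul, h.b_deg, h.x15_deg, h.x9_deg]; ring
  have m2 : T.deg (b * u - x15) = 3 * T.deg u - 15 := by
    rw [map_sub, map_mul, h.b_deg, h.x15_deg]
  have m3 : T.deg (b * u' - x15) = 3 * T.deg u' - 15 := by
    rw [map_sub, map_mul, h.b_deg, h.x15_deg]
  have hsum := h.Q_deg
  rw [H.sum, map_add, map_add, map_add, H.v_deg] at hsum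
  rw [m1] at t1
  rw [m2] at t2
  rw [m3] at t3
  have ru := H.d_part hd hDd.ge u
  have ru' := H.d_part hd hDd.ge u'
  have qu := H.d_part hd' hDd'.ge u
  have qu' := H.d_part hd' hDd'.ge u'
  have w1 := H.d_w hF hd hDd.ge
  have w2 := H.d_w hF hd' hDd'.ge
  -- The element `F` occurs in b̄·x₉, so b·F contains x₉. A constituent of `Q` whose product with
  -- `b` omits x₉ is therefore different from `F`.
  have oF : ∀ x, Core.Part T b b8 c x15 y15 x10 Q x → T.ip (b * x - x15) x9 = 0 →
      T.ip x F = 0 := by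
    intro x hx hx9
    refine hx.isB.ip_ne hFB ?_
    rintro rfl
    have h1 := congrArg (fun a => T.ip a x) hF
    have h2 : T.ip (T.bar b * x9) x = 0 := by
      rw [ip_bar_mul, ip_comm, ← hx9, sub_ip, h.x15_isB.ip_deg_ne h.x9_isB
        (by rw [h.x9_deg, h.x15_deg]; decide)]; ring
    have h3 := h.x10_isB.pos.ip_nonneg hx.isB.pos
    have h4 := H.hz.isB.pos.ip_nonneg hx.isB.pos
    simp only [add_ip] at h1
    rw [h2, hx.isB.ip_self] at h1
    omega
  -- As `D` omits x₉, so does each of the three positive remainders.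
  have z9 := congrArg (fun a => T.ip a x9) H.rest
  simp only [add_ip] at z9
  rw [H.D_x9] at z9
  have k1 := H.D1_pos.ip_nonneg h.x9_isB.pos
  have k2 := pu.ip_nonneg h.x9_isB.pos
  have k3 := pu'.ip_nonneg h.x9_isB.pos
  have oF1 := oF u H.hu (by omega)
  have oF2 := oF u' H.hu' (by omega)
  have hD' : D = d' + d := by rw [hD, add_comm]
  have c1 : ∀ x y w : ℤ, 1 = x + y + w → 0 ≤ x → 0 ≤ y → 0 ≤ w →
      (x = 1 ∧ y = 0 ∧ w = 0) ∨ (x = 0 ∧ y = 1 ∧ w = 0) ∨ (x = 0 ∧ y = 0 ∧ w = 1) := by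
    intro x y w _ _ _ _; omega
  rcases c1 _ _ _ e s1 s2 s3 with ⟨p1, p2, p3⟩ | ⟨p1, p2, p3⟩ | ⟨p1, p2, p3⟩ <;>
  rcases c1 _ _ _ e' s1' s2' s3' with ⟨p1', p2', p3'⟩ | ⟨p1', p2', p3'⟩ | ⟨p1', p2', p3'⟩ <;>
  rw [p1, p1'] at t1 <;> rw [p2, p2'] at t2 <;> rw [p3, p3'] at t3
  · exact H.false_of_both_z hd hd' hD hdd (by omega) (by omega) (by omega) p1.ge p1'.ge
  · exact H.false_of_one_z hD hd' hd hdd hn hF hFB (by omega) (by omega) (by omega) (by omega)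
      (by omega)
  · exact H.swap.false_of_one_z hD hd' hd hdd hn hF hFB (by omega) (by omega) (by omega)
      (by omega) (by omega)
  · exact H.false_of_one_z hD' hd hd' hd'd hn hF hFB (by omega) (by omega) (by omega) (by omega)
      (by omega)
  · exact H.false_of_both_u hd hd' hD hdd hn hFB (by omega) (by omega) oF1 (by omega) (by omega)
      (w1 p1) (w2 p1')
  · have := (H.d_rest hd hDd.ge H.hu.isB hFB oF1 (by omega) (w1 p1)).2
    omega
  · exact H.swap.false_of_one_z hD' hd hd' hd'd hn hF hFB (by omega) (by omega) (by omega)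
      (by omega) (by omega)
  · have := (H.d_rest hd hDd.ge H.hu'.isB hFB oF2 (by omega) (w1 p1)).2
    omega
  · exact H.swap.false_of_both_u hd hd' hD hdd hn hFB (by omega) (by omega) oF2 (by omega)
      (by omega) (w1 p1) (w2 p1')

/-- If `D` has norm 1 then F = 0 and `z` has degree 17, leaving degree 10 for three constituents of
degree at least 5. Otherwise the norm is 2. -/
theorem elim (H : Bad T b b8 c b6 x6 x15 y15 x10 x9 y9 Q D E z u u' v) : False := by
  have h := H.core
  obtain ⟨F, hF, hFp, hFn, hFd⟩ := H.exists_F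
  have hle := H.norm_D_le
  have hge : 1 ≤ T.ip D D := by
    rcases ip_self_eq_zero_or (T := T) D with h0 | h0
    · have := H.D_deg; rw [h0, map_zero] at this; omega
    · exact h0
  by_cases hn : T.ip D D = 1
  · have h0 : F = 0 := eq_zero_of_ip_self (T := T) (by omega)
    rw [h0, map_zero] at hFd
    have := h.Q_deg
    have := H.hu.deg_ge
    have := H.hu'.deg_ge
    have := H.hv.deg_ge
    have hs := congrArg T.deg H.sum
    simp only [map_add] at hs
    omega
  · obtain ⟨d, d', hd, hd', hD, hdd⟩ := H.D_pos.norm_two (by omega)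
    exact H.false_of_norm_two hd hd' hD hdd (by rw [← H.norm_D]; omega) hF
      (hFp.isB_of_norm (by omega)) hFd

end Bad

/-- The element `y₉` occurs in `b * x₉`. -/
theorem Core.t_eq_one {b b8 c b6 x6 x15 y15 x10 x9 y9 Q : R}
    (h : T.Core b b8 c b6 x6 x15 y15 x10 x9 y9 Q) : T.ip (b * x9) y9 = 1 := by
  refine h.t_cases.resolve_left fun h0 => ?_
  obtain ⟨D, hD⟩ : ∃ D, T.bar b * y9 - x15 = D := ⟨_, rfl⟩
  have hDp : T.Pos D := hD ▸ h.bbar_y9_pos.sub h.x15_isB h.ip_bbar_y9_x15.ge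
  have hDx9 : T.ip D x9 = 0 := by
    rw [← hD, sub_ip, ip_bbar_y9_x9, h0, h.x15_isB.ip_deg_ne h.x9_isB
      (by rw [h.x15_deg, h.x9_deg]; decide)]; rfl
  have hbQ : b * Q = 4 * x15 + x9 + D := by rw [← hD]; linear_combination h.b_mul_Q
  have hx15x9 : T.ip x15 x9 = 0 := h.x15_isB.ip_deg_ne h.x9_isB
    (by rw [h.x15_deg, h.x9_deg]; decide)
  have hQx9 : T.ip (b * Q) x9 = 1 := by
    rw [hbQ, add_ip, add_ip, ofNat_mul_ip, hx15x9, h.x9_isB.ip_self, hDx9]; rfl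
  -- The single x₉ in b·Q comes from exactly one constituent of `Q`.
  obtain ⟨z, hzB, hQz, hzx⟩ := h.Q_pos.exists_common (h.b_isB.bar.pos.mul h.x9_isB.pos)
    (by rw [← ip_mul_left, hQx9])
  have hz := h.part hzB hQz
  rw [ip_bar_mul, ip_comm] at hzx
  have hQzp := h.Q_pos.sub hzB hQz
  obtain ⟨p, q, r, hp, hq, hr, hsum, pq, pr, qr⟩ := hQzp.norm_three (by
    rw [ip_self_sub _ _ hzB, h.Q_norm, hz.ip_Q]; rfl)
  have hQsum : Q = z + p + q + r := by linear_combination hsum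
  have hge : ∀ w, T.IsB w → 1 ≤ T.ip p w + T.ip q w + T.ip r w → Core.Part T b b8 c x15 y15 x10 Q w
      := by
    intro w hw h1
    refine h.part hw ?_
    have := hzB.pos.ip_nonneg hw.pos
    rw [hQsum, add_ip, add_ip, add_ip]; omega
  have Pp := hge p hp (by rw [hp.ip_self, ip_comm q, ip_comm r, pq, pr]; rfl)
  have Pq := hge q hq (by rw [hq.ip_self, ip_comm r, pq, qr]; rfl)
  have Pr := hge r hr (by rw [hr.ip_self, pr, qr]; rfl)
  have hdeg := congrArg T.deg hQsum
  simp only [map_add] at hdeg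
  rw [h.Q_deg] at hdeg
  -- none of the other constituents of `Q` has degree six
  have no6 : ∀ w, Core.Part T b b8 c x15 y15 x10 Q w → T.deg w ≠ 6 := by
    intro w hw h6
    obtain ⟨f, hf⟩ : ∃ f, b * w - x15 = f := ⟨_, rfl⟩
    have hfp : T.Pos f := hf ▸ hw.rest_pos h
    have df : T.deg f = 3 := by rw [← hf, map_sub, map_mul, h.b_deg, h6, h.x15_deg]; rfl
    have hf1 : T.ip f 1 = 0 := by
      have h1 : T.ip (b * w) 1 = 0 := by
        rw [ip_mul_left, mul_one, ip_comm]
        exact h.b_isB.bar.ip_deg_ne hw.isB (by rw [h.bbar_deg, h6]; decide)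
      rw [← hf, sub_ip, h1, h.x15_isB.ne_one (by rw [h.x15_deg]; decide)]; rfl
    have hfB := hfp.isB_of_deg hf1 (by omega) (by omega)
    have hwf : 1 ≤ T.ip (b * w) f := by
      rw [show b * w = x15 + f by rw [← hf]; ring, add_ip, hfB.ip_self,
        h.x15_isB.ip_deg_ne hfB (by rw [h.x15_deg]; omega)]; rfl
    -- Since b·Q = 4x₁₅ + x₉ + D, the degree 3 remainder `f` of b·w lies in `D`. This forces b·f =
    -- y₉ and then b̄·f = w, whose degree would be 9.
    have hQw := h.b_isB.pos.mul (h.Q_pos.sub hw.isB hw.ip_Q.ge)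
    have h1 := hQw.ip_nonneg hfp
    rw [mul_sub, sub_ip, hbQ, add_ip, add_ip, ofNat_mul_ip,
      h.x15_isB.ip_deg_ne hfB (by rw [h.x15_deg]; omega),
      h.x9_isB.ip_deg_ne hfB (by rw [h.x9_deg]; omega)] at h1
    have h2 := IsB.deg_of_product h.b_isB hfB h.y9_isB hw.isB
      (by rw [h.b_deg, df, h.y9_deg]; rfl) (by
        rw [ip_mul_left, ip_comm, show T.bar b * y9 = x15 + D by rw [← hD]; ring, add_ip,
          h.x15_isB.ip_deg_ne hfB (by rw [h.x15_deg]; omega)]; omega) hwf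
    have h3 := congrArg T.deg h2
    rw [map_mul, h.bbar_deg, df, h6] at h3
    omega
  have hz8 : 8 ≤ T.deg z := by
    have h1 := ((h.b_isB.pos.mul hzB.pos).sub h.x15_isB hz.ip_x15.ge).deg_le h.x9_isB (by
      rw [sub_ip, hx15x9]; omega)
    rw [map_sub, map_mul, h.b_deg, h.x15_deg, h.x9_deg] at h1
    omega
  have hzx9 : T.ip (b * z) x9 = 1 := by
    have h1 := (h.b_isB.pos.mul (h.Q_pos.sub hzB hQz)).ip_nonneg h.x9_isB.pos
    rw [mul_sub, sub_ip, hQx9] at h1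
    omega
  have bad : ∀ u u' v, Core.Part T b b8 c x15 y15 x10 Q u → Core.Part T b b8 c x15 y15 x10 Q u' →
      Core.Part T b b8 c x15 y15 x10 Q v → Q = z + u + u' + v → T.deg v = 5 → False := by
    intro u u' v hu hu' hv hs h5
    exact Bad.elim (D := D) (E := b * x9 - y15)
      { core := h, D_eq := by rw [← hD]; ring, E_eq := by ring, D_pos := hDp,
        E_pos := h.b_x9_pos.sub h.y15_isB h.ip_b_x9_y15.ge, D_x9 := hDx9,
        E_y9 := by
          rw [sub_ip, h0, h.y15_isB.ip_deg_ne h.y9_isB (by rw [h.y15_deg, h.y9_deg]; decide)]; rfl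
        hz := hz, hu := hu, hu' := hu', hv := hv, sum := hs, z_x9 := hzx9, v_deg := h5 }
  -- As `z` has degree at least 8, the other three degrees sum to at most 19. Without a constituent
  -- of degree 5 they would all be at least 7.
  have := Pp.deg_ge
  have := Pq.deg_ge
  have := Pr.deg_ge
  have := no6 p Pp
  have := no6 q Pq
  have := no6 r Pr
  by_cases hp5 : T.deg p = 5
  · exact bad q r p Pq Pr Pp (by rw [hQsum]; ring) hp5
  by_cases hq5 : T.deg q = 5
  · exact bad p r q Pp Pr Pq (by rw [hQsum]; ring) hq5
  exact bad p q r Pp Pq Pr hQsum (by omega)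

end IntTable

/-! ### The defining relations and the completed configuration -/

/-- The relations from which the multiplication table follows. -/
structure TableRel {A : Type*} [CommRing A] (bar : A → A)
    (b c b6 x6 b8 x15 x10 x9 y15 y9 d z9 c8 b5 c5 y3 : A) : Prop where
  c_real : bar c = c
  b6_real : bar b6 = b6
  b8_real : bar b8 = b8
  x10_real : bar x10 = x10
  y15_real : bar y15 = y15
  y9_real : bar y9 = y9
  z9_real : bar z9 = z9
  c8_real : bar c8 = c8
  b5_real : bar b5 = b5
  c5_real : bar c5 = c5
  y3_real : bar y3 = y3
  b_bbar : b * bar b = 1 + b8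
  b_b : b * b = c + b6
  b_c : b * c = bar b + bar x6
  b_b6 : b * b6 = bar b + bar x15
  b_x6 : b * x6 = c + y15
  b_x6bar : b * bar x6 = b8 + x10
  b_b8 : b * b8 = x6 + b + x15
  b_x15 : b * x15 = 2 * y15 + b6 + y9
  b_x15bar : b * bar x15 = x10 + b8 + z9 + c8 + b5 + c5
  b_x10 : b * x10 = x15 + x6 + x9
  b_x9 : b * x9 = y9 + y15 + y3
  b_x9bar : b * bar x9 = x10 + z9 + c8
  b_y15 : b * y15 = 2 * bar x15 + bar x6 + bar x9
  b_y9 : b * y9 = d + bar x15 + bar x9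
  b_d : b * d = z9
  b_dbar : b * bar d = y9
  b_z9 : b * z9 = x9 + bar d + x15
  b_c8 : b * c8 = x15 + x9
  b_b5 : b * b5 = x15
  b_c5 : b * c5 = x15
  b_y3 : b * y3 = bar x9
  c_c : c * c = 1 + b8
  c_b6 : c * b6 = b8 + x10
  c_x6 : c * x6 = bar b + bar x15
  c_b8 : c * b8 = b6 + c + y15
  c_x15 : c * x15 = 2 * bar x15 + bar x6 + bar x9
  c_x10 : c * x10 = b6 + y15 + y9
  c_x9 : c * x9 = d + bar x15 + bar x9
  c_y15 : c * y15 = x10 + b8 + z9 + c8 + b5 + c5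
  c_y9 : c * y9 = z9 + x10 + c8
  c_d : c * d = x9
  c_z9 : c * z9 = y3 + y9 + y15
  c_c8 : c * c8 = y9 + y15
  c_b5 : c * b5 = y15
  c_c5 : c * c5 = y15
  c_y3 : c * y3 = z9
  b5_b5 : b5 * b5 = 1 + b5 + x10 + z9
  b5_c5 : b5 * c5 = b8 + z9 + c8

namespace IntTable

variable {ι R : Type*} [Fintype ι] [DecidableEq ι] [CommRing R] {T : IntTable ι R}

/-- The basis elements with their degrees and relations. -/
structure Final (T : IntTable ι R)
    (b c b6 x6 b8 x15 x10 x9 y15 y9 d z9 c8 b5 c5 y3 : R) : Prop where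
  b_isB : T.IsB b
  c_isB : T.IsB c
  b6_isB : T.IsB b6
  x6_isB : T.IsB x6
  b8_isB : T.IsB b8
  x15_isB : T.IsB x15
  x10_isB : T.IsB x10
  x9_isB : T.IsB x9
  y15_isB : T.IsB y15
  y9_isB : T.IsB y9
  d_isB : T.IsB d
  z9_isB : T.IsB z9
  c8_isB : T.IsB c8
  b5_isB : T.IsB b5
  c5_isB : T.IsB c5
  y3_isB : T.IsB y3
  b_deg : T.deg b = 3
  c_deg : T.deg c = 3
  b6_deg : T.deg b6 = 6
  x6_deg : T.deg x6 = 6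
  b8_deg : T.deg b8 = 8
  x15_deg : T.deg x15 = 15
  x10_deg : T.deg x10 = 10
  x9_deg : T.deg x9 = 9
  y15_deg : T.deg y15 = 15
  y9_deg : T.deg y9 = 9
  d_deg : T.deg d = 3
  z9_deg : T.deg z9 = 9
  c8_deg : T.deg c8 = 8
  b5_deg : T.deg b5 = 5
  c5_deg : T.deg c5 = 5
  y3_deg : T.deg y3 = 3
  b8_ne_c8 : b8 ≠ c8
  b5_ne_c5 : b5 ≠ c5
  rel : TableRel T.bar b c b6 x6 b8 x15 x10 x9 y15 y9 d z9 c8 b5 c5 y3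

namespace Core

variable {b b8 c b6 x6 x15 y15 x10 x9 y9 Q : R}

/-- The square of the absolute value of a constituent of degree five contains one of the
two constituents of degree five. -/
theorem five_sq {d z9 c8 v v' : R} (h : T.Core b b8 c b6 x6 x15 y15 x10 x9 y9 Q)
    (hd : T.IsB d) (hd3 : T.deg d = 3) (hz : Part T b b8 c x15 y15 x10 Q z9)
    (hc8 : Part T b b8 c x15 y15 x10 Q c8) (hv : Part T b b8 c x15 y15 x10 Q v)
    (hv' : Part T b b8 c x15 y15 x10 Q v') (hQ : Q = z9 + c8 + v + v')
    (dz : T.deg z9 = 9) (dc8 : T.deg c8 = 8) (dv : T.deg v = 5)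
    (hbd : T.bar b * T.bar d = z9) (hy9 : T.bar b * y9 = T.bar d + x15 + x9) :
    v * T.bar v = 1 + x10 + z9 + v ∨ v * T.bar v = 1 + x10 + z9 + v' := by
  obtain ⟨P, hP, hPp, hP1, hP8, hP10, hbP, dP⟩ := hv.exists_sq dv h
  have hbd' : T.deg (T.bar d) = 3 := by rw [T.deg_bar, hd3]
  -- The element d̄ occurs once in b·P = 2x₁₅ + x₉ + d̄, and b̄·d̄ = z₉.
  have hPz : T.ip P z9 = 1 := by
    have h1 : T.ip (b * P) (T.bar d) = T.ip P (T.bar b * T.bar d) := ip_mul_left _ _ _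
    rw [hbd, hbP, hy9, add_ip, add_ip, add_ip, hd.bar.ip_self,
      h.x15_isB.ip_deg_ne hd.bar (by rw [h.x15_deg, hbd']; decide),
      h.x9_isB.ip_deg_ne hd.bar (by rw [h.x9_deg, hbd']; decide)] at h1
    omega
  obtain ⟨W, hW⟩ : ∃ W, P - z9 = W := ⟨_, rfl⟩
  have hWp : T.Pos W := hW ▸ hPp.sub hz.isB hPz.ge
  have hWB : T.IsB W := hWp.isB_of_deg (by rw [← hW, sub_ip, hP1, hz.ip_one]; rfl)
    (by rw [← hW, map_sub, dP, dz]; decide) (by rw [← hW, map_sub, dP, dz]; decide)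
  have dW : T.deg W = 5 := by rw [← hW, map_sub, dP, dz]; rfl
  -- Counting x₁₅ in b·P gives total multiplicity 2 of the constituents of `Q` in `P`. One is z₉, so
  -- the remaining degree 5 element also lies in `Q`.
  have hPQ : T.ip P Q = 2 := by
    have h1 : T.ip (b * P) x15 = T.ip P (T.bar b * x15) := ip_mul_left _ _ _
    rw [h.bbar_x15, hbP, hy9, add_ip, add_ip, add_ip, h.x15_isB.ip_self,
      hd.bar.ip_deg_ne h.x15_isB (by rw [h.x15_deg, hbd']; decide),
      h.x9_isB.ip_deg_ne h.x15_isB (by rw [h.x9_deg, h.x15_deg]; decide), ip_add, ip_add, hP8,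
      hP10] at h1
    omega
  have hWQ : T.ip W Q = 1 := by rw [← hW, sub_ip, hPQ, ip_comm, hz.ip_Q]; rfl
  rw [hQ, ip_add, ip_add, ip_add, hWB.ip_deg_ne hz.isB (by omega),
    hWB.ip_deg_ne hc8.isB (by omega)] at hWQ
  by_cases h0 : T.ip W v = 0
  · right
    rw [← hWB.eq_of_ip hv'.isB (by omega), ← hW, hP]; ring
  · left
    rw [hP, ← hWB.eq_of_ip hv.isB h0, ← hW]; ring

/-- Removing x₉ and y₉ from the remainders of degree 12 leaves d̄ and y₃. Then b·d̄ = y₉ has norm 1,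
so z₉ = b̄·d̄ is a basis element, and d̄ in b·Q shows that it lies in `Q`. The other three
constituents follow from the count of x₉ and from degrees. -/
theorem exists_final (h : T.Core b b8 c b6 x6 x15 y15 x10 x9 y9 Q) :
    ∃ d z9 c8 b5 c5 y3, T.Final b c b6 x6 b8 x15 x10 x9 y15 y9 d z9 c8 b5 c5 y3 := by
  have ht := h.t_eq_one
  have n15_9 : T.ip x15 x9 = 0 := h.x15_isB.ip_deg_ne h.x9_isB
    (by rw [h.x15_deg, h.x9_deg]; decide)
  have n15_9' : T.ip y15 y9 = 0 := h.y15_isB.ip_deg_ne h.y9_isB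
    (by rw [h.y15_deg, h.y9_deg]; decide)
  -- `d` and `y3`
  obtain ⟨f, hf⟩ : ∃ f, T.bar b * y9 - x15 - x9 = f := ⟨_, rfl⟩
  have hfp : T.Pos f := hf ▸ h.bbar_y9_pos.mul_deg_add_le h.x15_isB h.x9_isB n15_9
    h.ip_bbar_y9_x15.ge (by rw [ip_bbar_y9_x9, ht])
  have df : T.deg f = 3 := by
    rw [← hf, map_sub, map_sub, map_mul, h.bbar_deg, h.y9_deg, h.x15_deg, h.x9_deg]; rfl
  have hfB : T.IsB f := by
    refine hfp.isB_of_deg ?_ (by omega) (by omega)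
    rw [← hf, sub_ip, sub_ip, ip_bar_mul, mul_one, h.y9_isB.ip_deg_ne h.b_isB
      (by rw [h.y9_deg, h.b_deg]; decide), h.x15_isB.ne_one (by rw [h.x15_deg]; decide),
      h.x9_isB.ne_one (by rw [h.x9_deg]; decide)]; rfl
  obtain ⟨y3, hy3⟩ : ∃ y, b * x9 - y15 - y9 = y := ⟨_, rfl⟩
  have hy3p : T.Pos y3 := hy3 ▸ h.b_x9_pos.mul_deg_add_le h.y15_isB h.y9_isB n15_9'
    h.ip_b_x9_y15.ge ht.ge
  have dy3 : T.deg y3 = 3 := by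
    rw [← hy3, map_sub, map_sub, map_mul, h.b_deg, h.x9_deg, h.y15_deg, h.y9_deg]; rfl
  have hy3B : T.IsB y3 := by
    refine hy3p.isB_of_deg ?_ (by omega) (by omega)
    rw [← hy3, sub_ip, sub_ip, ip_mul_left, mul_one, h.x9_isB.ip_deg_ne h.b_isB.bar
      (by rw [h.x9_deg, h.bbar_deg]; decide), h.y15_isB.ne_one (by rw [h.y15_deg]; decide),
      h.y9_isB.ne_one (by rw [h.y9_deg]; decide)]; rfl
  have ry3 : T.bar y3 = y3 := by
    rw [← hy3, map_sub, map_sub, h.b_x9_real, h.y15_real, h.y9_real]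
  have n15f : T.ip x15 f = 0 := h.x15_isB.ip_deg_ne hfB (by rw [h.x15_deg]; omega)
  have n9f : T.ip x9 f = 0 := h.x9_isB.ip_deg_ne hfB (by rw [h.x9_deg]; omega)
  have hbby9 : T.bar b * y9 = f + x15 + x9 := by rw [← hf]; ring
  have hbQ : b * Q = 4 * x15 + 2 * x9 + f := by linear_combination h.b_mul_Q + hbby9
  have hbx9 : b * x9 = y9 + y15 + y3 := by rw [← hy3]; ring
  -- `z9`
  have hbf : b * f = y9 := sub_eq_zero.1 (((h.b_isB.pos.mul hfB.pos).sub h.y9_isB (by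
    rw [ip_mul_left, hbby9, ip_add, ip_add, hfB.ip_self, ip_comm, n15f, ip_comm, n9f]; rfl)
    ).eq_zero (by rw [map_sub, map_mul, h.b_deg, df, h.y9_deg]; rfl))
  obtain ⟨z9, hz9⟩ : ∃ z, T.bar b * f = z := ⟨_, rfl⟩
  have hz9B : T.IsB z9 := by
    rw [← hz9]
    refine (h.b_isB.bar.pos.mul hfB.pos).isB_of_norm ?_
    rw [← ip_mul_mul_bar, hbf, h.y9_isB.ip_self]
  have dz9 : T.deg z9 = 9 := by rw [← hz9, map_mul, h.bbar_deg, df]; rfl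
  have hQz : T.ip Q z9 = 1 := by
    rw [← hz9, ← ip_mul_left, hbQ, add_ip, add_ip, ofNat_mul_ip, ofNat_mul_ip, n15f, n9f,
      hfB.ip_self]; rfl
  have Pz := h.part hz9B hQz.ge
  have hQzp := h.Q_pos.sub hz9B hQz.ge
  have nQz : T.ip (Q - z9) (Q - z9) = 3 := by
    rw [ip_self_sub _ _ hz9B, h.Q_norm, hQz]; rfl
  -- `c8`
  have hz9x9 : T.ip (b * z9) x9 ≤ 1 := by
    have h1 := ((h.b_isB.pos.mul hz9B.pos).sub h.x15_isB Pz.ip_x15.ge).sub hfB (by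
      rw [sub_ip, n15f, ip_mul_left, hz9, hz9B.ip_self]; rfl)
    have h2 := h1.mul_deg_le h.x9_isB (k := T.ip (b * z9) x9) (by
      rw [sub_ip, sub_ip, n15_9, ip_comm f, n9f]; omega)
    rw [map_sub, map_sub, map_mul, h.b_deg, dz9, h.x15_deg, df, h.x9_deg] at h2
    omega
  have hQx9 : T.ip (b * Q) x9 = 2 := by
    rw [hbQ, add_ip, add_ip, ofNat_mul_ip, ofNat_mul_ip, n15_9, ip_comm f, n9f,
      h.x9_isB.ip_self]; rfl
  obtain ⟨c8, hc8B, hc8Q, hc8x⟩ := hQzp.exists_common (h.b_isB.bar.pos.mul h.x9_isB.pos) (by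
    rw [← ip_mul_left, mul_sub, sub_ip, hQx9]; omega)
  rw [ip_bar_mul, ip_comm] at hc8x
  obtain ⟨hc8Q1, hQcp, nQc⟩ := hQzp.peel nQz.le hc8B hc8Q
  obtain ⟨b5, c5, hb5B, hc5B, hQ5, h55⟩ := hQcp.norm_two (by rw [nQc, nQz]; rfl)
  have hQ : Q = z9 + c8 + b5 + c5 := by linear_combination hQ5
  have P8 := h.part hc8B (by
    have := hc8Q
    have := hz9B.pos.ip_nonneg hc8B.pos
    rw [show Q = z9 + (Q - z9) by ring, add_ip]; omega)
  have P5 := h.part hb5B (by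
    have := hz9B.pos.ip_nonneg hb5B.pos
    have := hc8B.pos.ip_nonneg hb5B.pos
    have := hc5B.pos.ip_nonneg hb5B.pos
    rw [hQ, add_ip, add_ip, add_ip, hb5B.ip_self]; omega)
  have P5' := h.part hc5B (by
    have := hz9B.pos.ip_nonneg hc5B.pos
    have := hc8B.pos.ip_nonneg hc5B.pos
    have := hb5B.pos.ip_nonneg hc5B.pos
    rw [hQ, add_ip, add_ip, add_ip, hc5B.ip_self]; omega)
  have hdeg := h.Q_deg
  rw [hQ, map_add, map_add, map_add, dz9] at hdeg
  have dc8 : 8 ≤ T.deg c8 := by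
    have h1 := ((h.b_isB.pos.mul hc8B.pos).sub h.x15_isB P8.ip_x15.ge).deg_le h.x9_isB (by
      rw [sub_ip, n15_9]; omega)
    rw [map_sub, map_mul, h.b_deg, h.x15_deg, h.x9_deg] at h1
    omega
  -- The three degrees sum to 18 and are at least 8, 5 and 5.
  have d5 : T.deg b5 = 5 := by have := P5.deg_ge; have := P5'.deg_ge; omega
  have d5' : T.deg c5 = 5 := by have := P5.deg_ge; have := P5'.deg_ge; omega
  replace dc8 : T.deg c8 = 8 := by omega
  have hbb5 := P5.b_mul d5 h
  have hbc5 := P5'.b_mul d5' h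
  have hcb5 := P5.c_mul d5 h
  have hcc5 := P5'.c_mul d5' h
  have hbc8 : b * c8 = x15 + x9 := by
    have h1 := (((h.b_isB.pos.mul hc8B.pos).sub h.x15_isB P8.ip_x15.ge).sub h.x9_isB (by
      rw [sub_ip, n15_9]; omega)).eq_zero (by
        rw [map_sub, map_sub, map_mul, h.b_deg, h.x15_deg, h.x9_deg, dc8]; rfl)
    linear_combination h1
  have hbz9 : b * z9 = x9 + f + x15 := by
    rw [hQ] at hbQ
    linear_combination hbQ - hbc8 - hbb5 - hbc5
  -- reality
  have hreal : ∀ w, Part T b b8 c x15 y15 x10 Q w → (T.deg w = 9 ∨ T.deg w = 8) →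
      T.bar w = w := by
    intro w hw hdw
    have h1 := (hw.bar h).ip_Q
    have d1 : T.deg (T.bar w) = T.deg w := T.deg_bar w
    have h2 := hw.ip_Q
    rw [hQ, add_ip, add_ip, add_ip, hb5B.ip_deg_ne hw.isB (by omega),
      hc5B.ip_deg_ne hw.isB (by omega)] at h2
    rw [hQ, add_ip, add_ip, add_ip, hb5B.ip_deg_ne hw.isB.bar (by omega),
      hc5B.ip_deg_ne hw.isB.bar (by omega)] at h1
    rcases hdw with hdw | hdw
    · rw [hc8B.ip_deg_ne hw.isB (by omega)] at h2
      rw [hc8B.ip_deg_ne hw.isB.bar (by omega)] at h1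
      rw [← hz9B.eq_of_ip hw.isB.bar (by omega), hz9B.eq_of_ip hw.isB (by omega)]
    · rw [hz9B.ip_deg_ne hw.isB (by omega)] at h2
      rw [hz9B.ip_deg_ne hw.isB.bar (by omega)] at h1
      rw [← hc8B.eq_of_ip hw.isB.bar (by omega), hc8B.eq_of_ip hw.isB (by omega)]
  have rz9 := hreal z9 Pz (by omega)
  have rc8 := hreal c8 P8 (by omega)
  have rsum : T.bar b5 + T.bar c5 = b5 + c5 := by
    have h1 := h.Q_real
    rw [hQ, map_add, map_add, map_add, rz9, rc8] at h1
    linear_combination h1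
  obtain ⟨d, hd⟩ : ∃ d, T.bar f = d := ⟨_, rfl⟩
  have hfd : T.bar d = f := by rw [← hd, T.bar_bar]
  have hdB : T.IsB d := hd ▸ hfB.bar
  have dd : T.deg d = 3 := by rw [← hd, T.deg_bar, df]
  have hbd' : T.bar b * T.bar d = z9 := by rw [hfd, hz9]
  have hy9' : T.bar b * y9 = T.bar d + x15 + x9 := by rw [hfd, hbby9]
  have sq5 := h.five_sq hdB dd Pz P8 P5 P5' hQ dz9 dc8 d5 hbd' hy9'
  -- The element b₅·b̄₅ is real, so whichever of b₅, c₅ appears in its expansion is real; the other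
  -- follows because their sum is real.
  have hreal5 : T.bar b5 = b5 ∧ T.bar c5 = c5 := by
    rcases sq5 with h1 | h1
    · have h2 := congrArg T.bar h1
      simp only [map_mul, map_add, map_one, T.bar_bar, h.x10_real, rz9] at h2
      have h3 : T.bar b5 = b5 := by linear_combination h1 - h2
      exact ⟨h3, by linear_combination rsum - h3⟩
    · have h2 := congrArg T.bar h1
      simp only [map_mul, map_add, map_one, T.bar_bar, h.x10_real, rz9] at h2
      have h3 : T.bar c5 = c5 := by linear_combination h1 - h2
      exact ⟨by linear_combination rsum - h3, h3⟩
  obtain ⟨r5, r5'⟩ := hreal5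
  -- the rows of `b` and `c`
  have hbd : b * d = z9 := by
    have := congrArg T.bar hbd'
    simpa only [map_mul, T.bar_bar, rz9] using this
  have hby9 : b * y9 = d + T.bar x15 + T.bar x9 := by
    have := congrArg T.bar hy9'
    simpa only [map_mul, map_add, T.bar_bar, h.y9_real] using this
  have hbx9' : b * T.bar x9 = x10 + z9 + c8 := by
    rw [← h.c_y9, ← h.bbar_x9]
    have p0 : T.Pos (T.bar b * x9) := h.b_isB.bar.pos.mul h.x9_isB.pos
    have a1 : T.ip (T.bar b * x9) x10 = 1 := by
      rw [ip_bar_mul, h.b_x10, ip_add, ip_add, h.x9_isB.ip_self, ip_comm, n15_9,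
        h.x9_isB.ip_deg_ne h.x6_isB (by rw [h.x9_deg, h.x6_deg]; decide)]; rfl
    have a2 : T.ip (T.bar b * x9) z9 = 1 := by
      rw [ip_bar_mul, hbz9, ip_add, ip_add, h.x9_isB.ip_self, ip_comm x9 x15, n15_9, n9f]; rfl
    have a3 : T.ip (T.bar b * x9) c8 = 1 := by
      rw [ip_bar_mul, hbc8, ip_add, h.x9_isB.ip_self, ip_comm x9 x15, n15_9]; rfl
    have n1 : T.ip x10 z9 = 0 := by rw [ip_comm, Pz.ip_x10]
    have n2 : T.ip x10 c8 = 0 := by rw [ip_comm, P8.ip_x10]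
    have n3 : T.ip z9 c8 = 0 := hz9B.ip_deg_ne hc8B (by omega)
    have h1 := ((p0.mul_deg_add_le h.x10_isB hz9B n1 a1.ge a2.ge).sub hc8B (by
      rw [sub_ip, sub_ip, a3, n2, n3]; rfl)).eq_zero (by
        simp only [map_sub, map_mul, h.bbar_deg, h.x9_deg, h.x10_deg, dz9, dc8]; rfl)
    linear_combination h1
  have hby3 : b * y3 = T.bar x9 := by
    have h1 : T.bar b * T.bar x9 = y9 + y15 + y3 := by
      rw [← map_mul, h.b_x9_real, hbx9]
    refine sub_eq_zero.1 (((h.b_isB.pos.mul hy3B.pos).sub h.x9_isB.bar ?_).eq_zero ?_)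
    · rw [ip_mul_left, h1, ip_add, ip_add, hy3B.ip_self, hy3B.ip_deg_ne h.y9_isB
        (by rw [dy3, h.y9_deg]; decide), hy3B.ip_deg_ne h.y15_isB
        (by rw [dy3, h.y15_deg]; decide)]; rfl
    · rw [map_sub, map_mul, T.deg_bar, h.b_deg, dy3, h.x9_deg]; rfl
  have hcx9 : c * x9 = d + T.bar x15 + T.bar x9 := h.c_x9.trans hby9
  have hcd : c * d = x9 := by
    refine sub_eq_zero.1 (((h.c_isB.pos.mul hdB.pos).sub h.x9_isB ?_).eq_zero ?_)
    · rw [ip_mul_left, h.c_real, hcx9, ip_add, ip_add, hdB.ip_self,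
        hdB.ip_deg_ne h.x15_isB.bar (by rw [dd, T.deg_bar, h.x15_deg]; decide),
        hdB.ip_deg_ne h.x9_isB.bar (by rw [dd, T.deg_bar, h.x9_deg]; decide)]; rfl
    · rw [map_sub, map_mul, h.c_deg, dd, h.x9_deg]; rfl
  have hcy9 : c * y9 = z9 + x10 + c8 := by rw [h.c_y9, hbx9']; ring
  have hcz9 : c * z9 = y3 + y9 + y15 := by linear_combination -c * hbd + b * hcd + hbx9
  have hcc8 : c * c8 = y9 + y15 := by
    linear_combination -c * hbx9' + b * h.c_x9bar + b * hy9' + b * hfd + hbf + h.b_x15 + hbx9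
      - h.c_x10 - hcz9
  have hcy3 : c * y3 = z9 := by
    linear_combination -c * hbx9 + b * hcx9 + hbd + h.b_x15bar + hbx9' - hcy9 - h.c_y15
  -- the products of the elements of degree five
  have hb8c5 : b8 * c5 = b8 + x10 + Q - c5 := by
    linear_combination -c5 * h.c_c + c * hcc5 + h.c_y15
  have e8 : T.ip (b5 * c5) b8 = 1 := by
    rw [T.ip_congr (a' := b5) (c' := b8 * c5) (by simp only [map_mul, h.b8_real, r5']; ring),
      hb8c5, ip_sub, ip_add, ip_add, P5.ip_b8, P5.ip_x10, ip_comm b5 Q, P5.ip_Q, h55]; rfl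
  -- Testing against b·x̄₆ = b₈ + x₁₀ gives total multiplicity 1, which b₈ already uses.
  have e10 : T.ip (b5 * c5) x10 = 0 := by
    have hb'5 : T.bar b * b5 = T.bar x15 := by
      have := congrArg T.bar hbb5
      rwa [map_mul, r5] at this
    have h1 : T.ip (b5 * c5) (b * T.bar x6) = T.ip (T.bar b * b5) (T.bar (x6 * c5)) := ip_congr (by
      simp only [map_mul, T.bar_bar, r5']; ring)
    rw [h.b_x6bar, hb'5, h.x6_mul hbc5 hcc5, ip_bar_bar, ip_add, ip_add, ip_add, e8,
      h.x15_isB.ip_self, n15_9,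
      h.x15_isB.ip_deg_ne h.x6_isB (by rw [h.x15_deg, h.x6_deg]; decide)] at h1
    omega
  obtain ⟨W, hW⟩ : ∃ W, b5 * c5 - b8 = W := ⟨_, rfl⟩
  have hWp : T.Pos W := hW ▸ (hb5B.pos.mul hc5B.pos).sub h.b8_isB e8.ge
  have hbW : b * W = 2 * x15 + 2 * x9 + f := by
    rw [← hW]
    linear_combination c5 * hbb5 + h.x15_mul hbc5 hcc5 + hbby9 - h.b_b8
  have w10 : T.ip W x10 = 0 := by
    rw [← hW, sub_ip, e10, h.b8_isB.ip_deg_ne h.x10_isB (by rw [h.b8_deg, h.x10_deg]; decide)]; rfl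
  have w9 : T.ip W z9 = 1 := by
    rw [← hz9, ← ip_mul_left, hbW, add_ip, add_ip, ofNat_mul_ip, ofNat_mul_ip, n15f, n9f,
      hfB.ip_self]; rfl
  have w8 : T.ip W c8 = 1 := by
    have h1 : T.ip (b * W) x9 = T.ip W (T.bar b * x9) := ip_mul_left _ _ _
    rw [h.bbar_x9, hcy9, hbW, add_ip, add_ip, ofNat_mul_ip, ofNat_mul_ip, n15_9,
      h.x9_isB.ip_self, ip_comm f, n9f, ip_add, ip_add, w9, w10] at h1
    omega
  have hb5c5 : b5 * c5 = b8 + z9 + c8 := by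
    have h1 := (hWp.mul_deg_add_le hz9B hc8B (hz9B.ip_deg_ne hc8B (by omega)) w9.ge
      w8.ge).eq_zero (by
        rw [← hW]; simp only [map_sub, map_mul, d5, d5', h.b8_deg, dz9, dc8]; rfl)
    linear_combination h1 + hW
  have hb5b5 : b5 * b5 = 1 + b5 + x10 + z9 := by
    rw [r5] at sq5
    rcases sq5 with h1 | h1
    · rw [h1]; ring
    -- If c₅ occurred in b₅², then b₅ would occur in b₅c₅ = b₈ + z₉ + c₈.
    · exfalso
      have h2 : T.ip (b5 * b5) c5 = T.ip b5 (b5 * c5) := by rw [ip_mul_left, r5]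
      rw [h1, hb5c5, add_ip, add_ip, add_ip, ip_add, ip_add, hc5B.ip_self,
        P5.ip_b8, hb5B.ip_deg_ne hz9B (by omega), hb5B.ip_deg_ne hc8B (by omega),
        hz9B.ip_deg_ne hc5B (by omega), ip_comm x10, P5'.ip_x10, ip_comm 1, P5'.ip_one] at h2
      omega
  refine ⟨d, z9, c8, b5, c5, y3,
    { b_isB := h.b_isB, c_isB := h.c_isB, b6_isB := h.b6_isB, x6_isB := h.x6_isB,
      b8_isB := h.b8_isB, x15_isB := h.x15_isB, x10_isB := h.x10_isB, x9_isB := h.x9_isB,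
      y15_isB := h.y15_isB, y9_isB := h.y9_isB, d_isB := hdB, z9_isB := hz9B, c8_isB := hc8B,
      b5_isB := hb5B, c5_isB := hc5B, y3_isB := hy3B, b_deg := h.b_deg, c_deg := h.c_deg,
      b6_deg := h.b6_deg, x6_deg := h.x6_deg, b8_deg := h.b8_deg, x15_deg := h.x15_deg,
      x10_deg := h.x10_deg, x9_deg := h.x9_deg, y15_deg := h.y15_deg, y9_deg := h.y9_deg,
      d_deg := dd, z9_deg := dz9, c8_deg := dc8, b5_deg := d5, c5_deg := d5', y3_deg := dy3,
      b8_ne_c8 := ?_, b5_ne_c5 := ?_,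
      rel :=
      { c_real := h.c_real, b6_real := h.b6_real, b8_real := h.b8_real, x10_real := h.x10_real,
        y15_real := h.y15_real, y9_real := h.y9_real, z9_real := rz9, c8_real := rc8,
        b5_real := r5, c5_real := r5', y3_real := ry3, b_bbar := h.b_bbar, b_b := h.b_b,
        b_c := h.b_c, b_b6 := h.b_b6, b_x6 := h.b_x6, b_x6bar := h.b_x6bar, b_b8 := h.b_b8,
        b_x15 := h.b_x15, b_x15bar := ?_, b_x10 := h.b_x10, b_x9 := hbx9, b_x9bar := hbx9',
        b_y15 := h.b_y15, b_y9 := hby9, b_d := hbd, b_dbar := by rw [hfd, hbf],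
        b_z9 := by rw [hbz9, hfd], b_c8 := hbc8, b_b5 := hbb5, b_c5 := hbc5, b_y3 := hby3,
        c_c := h.c_c, c_b6 := h.c_b6, c_x6 := h.c_x6, c_b8 := h.c_b8, c_x15 := h.c_x15,
        c_x10 := h.c_x10, c_x9 := hcx9, c_y15 := ?_, c_y9 := hcy9, c_d := hcd, c_z9 := hcz9,
        c_c8 := hcc8, c_b5 := hcb5, c_c5 := hcc5, c_y3 := hcy3, b5_b5 := hb5b5,
        b5_c5 := hb5c5 } }⟩
  · rintro rfl
    have := P8.ip_b8
    rw [h.b8_isB.ip_self] at this; omega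
  · rintro rfl
    rw [hb5B.ip_self] at h55; omega
  · rw [h.b_x15bar, hQ]; ring
  · rw [h.c_y15, hQ]; ring

end Core

end IntTable

/-! ### The multiplication table from the defining relations -/

namespace TableRel

variable {A : Type*} [CommRing A] {bar : A →+* A}
  {b c b6 x6 b8 x15 x10 x9 y15 y9 d z9 c8 b5 c5 y3 : A}

set_option maxHeartbeats 8000000 in
/-- The defining relations determine the whole multiplication table. -/
theorem products (hbar : ∀ a, bar (bar a) = a)
    (h : TableRel bar b c b6 x6 b8 x15 x10 x9 y15 y9 d z9 c8 b5 c5 y3) :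
    B22Products bar b c b6 x6 b8 x15 x10 x9 y15 y9 d z9 c8 b5 c5 y3 := by
  obtain ⟨c_real, b6_real, b8_real, x10_real, y15_real, y9_real, z9_real, c8_real, b5_real,
      c5_real, y3_real, b_B, b_b, b_c, b_b6, b_x6, b_X6, b_b8, b_x15, b_X15, b_x10, b_x9, b_X9,
      b_y15, b_y9, b_d, b_D, b_z9, b_c8, b_b5, b_c5, b_y3, c_c, c_b6, c_x6, c_b8, c_x15,
      c_x10, c_x9, c_y15, c_y9, c_d, c_z9, c_c8, c_b5, c_c5, c_y3, b5_b5, b5_c5⟩ := h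
  -- Conjugating a known product yields the row of the conjugate factor; the capitals in the
  -- hypothesis names stand for conjugated elements.
  have key : ∀ {u v w : A}, u * v = w → bar u * bar v = bar w := fun h => by rw [← h, map_mul]
  have B_B : bar b * bar b = c + b6 := by
    simpa only [map_add, map_mul, map_ofNat, map_one, hbar, c_real, b6_real, b8_real, x10_real,
        y15_real, y9_real, z9_real, c8_real, b5_real, c5_real, y3_real] using key b_b
  have B_c : bar b * c = b + x6 := by
    simpa only [map_add, map_mul, map_ofNat, map_one, hbar, c_real, b6_real, b8_real, x10_real,
        y15_real, y9_real, z9_real, c8_real, b5_real, c5_real, y3_real] using key b_c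
  have B_b8 : bar b * b8 = bar x6 + bar b + bar x15 := by
    simpa only [map_add, map_mul, map_ofNat, map_one, hbar, c_real, b6_real, b8_real, x10_real,
        y15_real, y9_real, z9_real, c8_real, b5_real, c5_real, y3_real] using key b_b8
  have B_b6 : bar b * b6 = b + x15 := by
    simpa only [map_add, map_mul, map_ofNat, map_one, hbar, c_real, b6_real, b8_real, x10_real,
        y15_real, y9_real, z9_real, c8_real, b5_real, c5_real, y3_real] using key b_b6
  have B_X6 : bar b * bar x6 = c + y15 := by
    simpa only [map_add, map_mul, map_ofNat, map_one, hbar, c_real, b6_real, b8_real, x10_real,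
        y15_real, y9_real, z9_real, c8_real, b5_real, c5_real, y3_real] using key b_x6
  have B_x6 : bar b * x6 = b8 + x10 := by
    simpa only [map_add, map_mul, map_ofNat, map_one, hbar, c_real, b6_real, b8_real, x10_real,
        y15_real, y9_real, z9_real, c8_real, b5_real, c5_real, y3_real] using key b_X6
  have B_y15 : bar b * y15 = 2 * x15 + x6 + x9 := by
    simpa only [map_add, map_mul, map_ofNat, map_one, hbar, c_real, b6_real, b8_real, x10_real,
        y15_real, y9_real, z9_real, c8_real, b5_real, c5_real, y3_real] using key b_y15
  have B_X15 : bar b * bar x15 = 2 * y15 + b6 + y9 := by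
    simpa only [map_add, map_mul, map_ofNat, map_one, hbar, c_real, b6_real, b8_real, x10_real,
        y15_real, y9_real, z9_real, c8_real, b5_real, c5_real, y3_real] using key b_x15
  have B_x15 : bar b * x15 = x10 + b8 + z9 + c8 + b5 + c5 := by
    simpa only [map_add, map_mul, map_ofNat, map_one, hbar, c_real, b6_real, b8_real, x10_real,
        y15_real, y9_real, z9_real, c8_real, b5_real, c5_real, y3_real] using key b_X15
  have B_x10 : bar b * x10 = bar x15 + bar x6 + bar x9 := by
    simpa only [map_add, map_mul, map_ofNat, map_one, hbar, c_real, b6_real, b8_real, x10_real,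
        y15_real, y9_real, z9_real, c8_real, b5_real, c5_real, y3_real] using key b_x10
  have B_x9 : bar b * x9 = x10 + z9 + c8 := by
    simpa only [map_add, map_mul, map_ofNat, map_one, hbar, c_real, b6_real, b8_real, x10_real,
        y15_real, y9_real, z9_real, c8_real, b5_real, c5_real, y3_real] using key b_X9
  have B_X9 : bar b * bar x9 = y9 + y15 + y3 := by
    simpa only [map_add, map_mul, map_ofNat, map_one, hbar, c_real, b6_real, b8_real, x10_real,
        y15_real, y9_real, z9_real, c8_real, b5_real, c5_real, y3_real] using key b_x9
  have B_y9 : bar b * y9 = bar d + x15 + x9 := by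
    simpa only [map_add, map_mul, map_ofNat, map_one, hbar, c_real, b6_real, b8_real, x10_real,
        y15_real, y9_real, z9_real, c8_real, b5_real, c5_real, y3_real] using key b_y9
  have B_d : bar b * d = y9 := by
    simpa only [map_add, map_mul, map_ofNat, map_one, hbar, c_real, b6_real, b8_real, x10_real,
        y15_real, y9_real, z9_real, c8_real, b5_real, c5_real, y3_real] using key b_D
  have B_D : bar b * bar d = z9 := by
    simpa only [map_add, map_mul, map_ofNat, map_one, hbar, c_real, b6_real, b8_real, x10_real,
        y15_real, y9_real, z9_real, c8_real, b5_real, c5_real, y3_real] using key b_d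
  have B_z9 : bar b * z9 = bar x9 + d + bar x15 := by
    simpa only [map_add, map_mul, map_ofNat, map_one, hbar, c_real, b6_real, b8_real, x10_real,
        y15_real, y9_real, z9_real, c8_real, b5_real, c5_real, y3_real] using key b_z9
  have B_y3 : bar b * y3 = x9 := by
    simpa only [map_add, map_mul, map_ofNat, map_one, hbar, c_real, b6_real, b8_real, x10_real,
        y15_real, y9_real, z9_real, c8_real, b5_real, c5_real, y3_real] using key b_y3
  have B_c8 : bar b * c8 = bar x15 + bar x9 := by
    simpa only [map_add, map_mul, map_ofNat, map_one, hbar, c_real, b6_real, b8_real, x10_real,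
        y15_real, y9_real, z9_real, c8_real, b5_real, c5_real, y3_real] using key b_c8
  have B_b5 : bar b * b5 = bar x15 := by
    simpa only [map_add, map_mul, map_ofNat, map_one, hbar, c_real, b6_real, b8_real, x10_real,
        y15_real, y9_real, z9_real, c8_real, b5_real, c5_real, y3_real] using key b_b5
  have B_c5 : bar b * c5 = bar x15 := by
    simpa only [map_add, map_mul, map_ofNat, map_one, hbar, c_real, b6_real, b8_real, x10_real,
        y15_real, y9_real, z9_real, c8_real, b5_real, c5_real, y3_real] using key b_c5
  have c_X6 : c * bar x6 = b + x15 := by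
    simpa only [map_add, map_mul, map_ofNat, map_one, hbar, c_real, b6_real, b8_real, x10_real,
        y15_real, y9_real, z9_real, c8_real, b5_real, c5_real, y3_real] using key c_x6
  have c_X15 : c * bar x15 = 2 * x15 + x6 + x9 := by
    simpa only [map_add, map_mul, map_ofNat, map_one, hbar, c_real, b6_real, b8_real, x10_real,
        y15_real, y9_real, z9_real, c8_real, b5_real, c5_real, y3_real] using key c_x15
  have c_X9 : c * bar x9 = bar d + x15 + x9 := by
    simpa only [map_add, map_mul, map_ofNat, map_one, hbar, c_real, b6_real, b8_real, x10_real,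
        y15_real, y9_real, z9_real, c8_real, b5_real, c5_real, y3_real] using key c_x9
  have c_D : c * bar d = bar x9 := by
    simpa only [map_add, map_mul, map_ofNat, map_one, hbar, c_real, b6_real, b8_real, x10_real,
        y15_real, y9_real, z9_real, c8_real, b5_real, c5_real, y3_real] using key c_d
  -- One pattern produces the rows from here on. A relation p·q = r + s with known rows of p, q, r
  -- gives s·v = p·(q·v) − r·v: for example b₆ = b² − c, x₆ = b̄c − b, x₁₅ = b̄b₆ − b, x₁₀ = cb₆ −
  -- b₈.
  have b6_b6 : b6 * b6 = 1 + b8 + z9 + c8 + b5 + c5 := by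
    linear_combination -b6 * b_b + b * b_b6 + b_B + b_X15 - c_b6
  have b6_x6 : b6 * x6 = 2 * bar x6 + bar x15 + bar x9 := by
    linear_combination -x6 * b_b + b * b_x6 + b_c + b_y15 - c_x6
  have b8_b6 : b8 * b6 = c + b6 + 2 * y15 + y9 := by
    linear_combination -b6 * c_c + c * c_b6 + c_b8 + c_x10
  have b6_x15 : b6 * x15 = bar b + bar x6 + 4 * bar x15 + 2 * bar x9 + d := by
    linear_combination -x15 * b_b + b * b_x15 + b_b6 + 2 * b_y15 + b_y9 - c_x15
  have b6_x10 : b6 * x10 = c + 3 * y15 + y9 + y3 := by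
    linear_combination -x10 * b_b + b * b_x10 + b_x6 + b_x15 + b_x9 - c_x10
  have b6_x9 : b6 * x9 = bar x6 + 2 * bar x15 + 2 * bar x9 := by
    linear_combination -x9 * b_b + b * b_x9 + b_y15 + b_y9 + b_y3 - c_x9
  have b6_y15 : b6 * y15 = 2 * b8 + 3 * x10 + 2 * z9 + 2 * c8 + b5 + c5 := by
    linear_combination -y15 * b_b + b * b_y15 + b_X6 + 2 * b_X15 + b_X9 - c_y15
  have b6_y9 : b6 * y9 = b8 + x10 + 2 * z9 + c8 + b5 + c5 := by
    linear_combination -y9 * b_b + b * b_y9 + b_X15 + b_X9 + b_d - c_y9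
  have b6_d : b6 * d = x15 + bar d := by
    linear_combination -d * b_b + b * b_d + b_z9 - c_d
  have b6_z9 : b6 * z9 = b6 + 2 * y15 + 2 * y9 := by
    linear_combination -z9 * b_b + b * b_z9 + b_x15 + b_x9 + b_D - c_z9
  have b6_c8 : b6 * c8 = b6 + 2 * y15 + y9 + y3 := by
    linear_combination -c8 * b_b + b * b_c8 + b_x15 + b_x9 - c_c8
  have b6_b5 : b6 * b5 = b6 + y15 + y9 := by
    linear_combination -b5 * b_b + b * b_b5 + b_x15 - c_b5
  have b6_c5 : b6 * c5 = b6 + y15 + y9 := by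
    linear_combination -c5 * b_b + b * b_c5 + b_x15 - c_c5
  have b6_y3 : b6 * y3 = x10 + c8 := by
    linear_combination -y3 * b_b + b * b_y3 + b_X9 - c_y3
  have x6_x6 : x6 * x6 = 2 * b6 + y15 + y9 := by
    linear_combination -x6 * B_c + bar b * c_x6 + B_B + B_X15 - b_x6
  have X6_x6 : bar x6 * x6 = 1 + b8 + z9 + c8 + b5 + c5 := by
    linear_combination -x6 * b_c + b * c_x6 + b_B + b_X15 - B_x6
  have b8_x6 : b8 * x6 = b + x6 + 2 * x15 + x9 := by
    linear_combination -x6 * c_c + c * c_x6 + B_c + c_X15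
  have x6_x15 : x6 * x15 = c + b6 + 4 * y15 + 2 * y9 + y3 := by
    linear_combination -x15 * B_c + bar b * c_x15 + B_X6 + 2 * B_X15 + B_X9 - b_x15
  have x6_x10 : x6 * x10 = b + 3 * x15 + x9 + bar d := by
    linear_combination -x10 * B_c + bar b * c_x10 + B_b6 + B_y15 + B_y9 - b_x10
  have x6_X15 : x6 * bar x15 = 2 * b8 + 3 * x10 + 2 * z9 + 2 * c8 + b5 + c5 := by
    linear_combination -bar x15 * B_c + bar b * c_X15 + B_x6 + 2 * B_x15 + B_x9 - b_X15
  have x6_x9 : x6 * x9 = b6 + 2 * y15 + 2 * y9 := by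
    linear_combination -x9 * B_c + bar b * c_x9 + B_X15 + B_X9 + B_d - b_x9
  have x6_X9 : x6 * bar x9 = b8 + x10 + 2 * z9 + c8 + b5 + c5 := by
    linear_combination -bar x9 * B_c + bar b * c_X9 + B_x15 + B_x9 + B_D - b_X9
  have x6_y15 : x6 * y15 = bar b + bar x6 + 4 * bar x15 + 2 * bar x9 + d := by
    linear_combination -y15 * B_c + bar b * c_y15 + B_b8 + B_x10 + B_z9 + B_c8 + B_b5 + B_c5 -
        b_y15
  have x6_y9 : x6 * y9 = bar x6 + 2 * bar x15 + 2 * bar x9 := by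
    linear_combination -y9 * B_c + bar b * c_y9 + B_x10 + B_z9 + B_c8 - b_y9
  have x6_d : x6 * d = x10 + c8 := by
    linear_combination -d * B_c + bar b * c_d + B_x9 - b_d
  have x6_D : x6 * bar d = y15 + y3 := by
    linear_combination -bar d * B_c + bar b * c_D + B_X9 - b_D
  have x6_z9 : x6 * z9 = x6 + 2 * x15 + 2 * x9 := by
    linear_combination -z9 * B_c + bar b * c_z9 + B_y15 + B_y9 + B_y3 - b_z9
  have x6_c8 : x6 * c8 = x6 + 2 * x15 + x9 + bar d := by
    linear_combination -c8 * B_c + bar b * c_c8 + B_y15 + B_y9 - b_c8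
  have x6_b5 : x6 * b5 = x6 + x15 + x9 := by
    linear_combination -b5 * B_c + bar b * c_b5 + B_y15 - b_b5
  have x6_c5 : x6 * c5 = x6 + x15 + x9 := by
    linear_combination -c5 * B_c + bar b * c_c5 + B_y15 - b_c5
  have x6_y3 : x6 * y3 = bar x15 + d := by
    linear_combination -y3 * B_c + bar b * c_y3 + B_z9 - b_y3
  have b8_b8 : b8 * b8 = 1 + 2 * b8 + 2 * x10 + z9 + c8 + b5 + c5 := by
    linear_combination -b8 * c_c + c * c_b8 + c_c + c_b6 + c_y15
  have b8_x10 : b8 * x10 = 2 * b8 + 2 * x10 + 2 * z9 + 2 * c8 + b5 + c5 := by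
    linear_combination -x10 * c_c + c * c_x10 + c_b6 + c_y15 + c_y9
  have b8_x9 : b8 * x9 = x6 + 3 * x15 + 2 * x9 + bar d := by
    linear_combination -x9 * c_c + c * c_x9 + c_X15 + c_X9 + c_d
  have b8_y15 : b8 * y15 = c + 2 * b6 + 5 * y15 + 3 * y9 + y3 := by
    linear_combination -y15 * c_c + c * c_y15 + c_b8 + c_x10 + c_z9 + c_c8 + c_b5 + c_c5
  have b8_y9 : b8 * y9 = b6 + 3 * y15 + 2 * y9 + y3 := by
    linear_combination -y9 * c_c + c * c_y9 + c_x10 + c_z9 + c_c8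
  have b8_d : b8 * d = bar x15 + bar x9 := by
    linear_combination -d * c_c + c * c_d + c_x9
  have b8_z9 : b8 * z9 = b8 + 2 * x10 + 2 * z9 + 2 * c8 + b5 + c5 := by
    linear_combination -z9 * c_c + c * c_z9 + c_y15 + c_y9 + c_y3
  have b8_c8 : b8 * c8 = b8 + 2 * x10 + 2 * z9 + c8 + b5 + c5 := by
    linear_combination -c8 * c_c + c * c_c8 + c_y15 + c_y9
  have b8_b5 : b8 * b5 = b8 + x10 + z9 + c8 + c5 := by
    linear_combination -b5 * c_c + c * c_b5 + c_y15
  have b8_c5 : b8 * c5 = b8 + x10 + z9 + c8 + b5 := by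
    linear_combination -c5 * c_c + c * c_c5 + c_y15
  have b8_y3 : b8 * y3 = y15 + y9 := by
    linear_combination -y3 * c_c + c * c_y3 + c_z9
  have b8_x15 : b8 * x15 = b + 2 * x6 + 5 * x15 + 3 * x9 + bar d := by
    linear_combination -x15 * c_c + c * c_x15 + c_X6 + 2 * c_X15 + c_X9
  have x15_x15 : x15 * x15 = 2 * c + 4 * b6 + 9 * y15 + 6 * y9 + 2 * y3 := by
    linear_combination -x15 * B_b6 + bar b * b6_x15 + B_B + B_X6 + 4 * B_X15 + 2 * B_X9 + B_d -
        b_x15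
  have x15_x10 : x15 * x10 = b + 3 * x6 + 6 * x15 + 4 * x9 + bar d := by
    linear_combination -x10 * B_b6 + bar b * b6_x10 + B_c + 3 * B_y15 + B_y9 + B_y3 - b_x10
  have X15_x15 : bar x15 * x15 = 1 + 5 * b8 + 6 * x10 + 6 * z9 + 5 * c8 + 3 * b5 + 3 * c5 := by
    linear_combination -x15 * b_b6 + b * b6_x15 + b_B + b_X6 + 4 * b_X15 + 2 * b_X9 + b_d - B_x15
  have x15_x9 : x15 * x9 = c + 2 * b6 + 6 * y15 + 3 * y9 + y3 := by
    linear_combination -x9 * B_b6 + bar b * b6_x9 + B_X6 + 2 * B_X15 + 2 * B_X9 - b_x9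
  have b6_X9 : b6 * bar x9 = x6 + 2 * x15 + 2 * x9 := by
    simpa only [map_add, map_mul, map_ofNat, map_one, hbar, c_real, b6_real, b8_real, x10_real,
        y15_real, y9_real, z9_real, c8_real, b5_real, c5_real, y3_real] using key b6_x9
  have x15_X9 : x15 * bar x9 = 3 * b8 + 4 * x10 + 3 * z9 + 3 * c8 + 2 * b5 + 2 * c5 := by
    linear_combination -bar x9 * B_b6 + bar b * b6_X9 + B_x6 + 2 * B_x15 + 2 * B_x9 - b_X9
  have y15_x15 : y15 * x15 = 2 * bar b + 4 * bar x6 + 9 * bar x15 + 6 * bar x9 + 2 * d := by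
    linear_combination -x15 * b_x6 + b * x6_x15 + b_c + b_b6 + 4 * b_y15 + 2 * b_y9 + b_y3 - c_x15
  have x15_y9 : x15 * y9 = bar b + 2 * bar x6 + 6 * bar x15 + 3 * bar x9 + d := by
    linear_combination -y9 * B_b6 + bar b * b6_y9 + B_b8 + B_x10 + 2 * B_z9 + B_c8 + B_b5 + B_c5
        - b_y9
  have x15_d : x15 * d = b8 + x10 + z9 + c8 + b5 + c5 := by
    linear_combination -d * B_b6 + bar b * b6_d + B_x15 + B_D - b_d
  have b6_D : b6 * bar d = bar x15 + d := by
    simpa only [map_add, map_mul, map_ofNat, map_one, hbar, c_real, b6_real, b8_real, x10_real,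
        y15_real, y9_real, z9_real, c8_real, b5_real, c5_real, y3_real] using key b6_d
  have x15_D : x15 * bar d = b6 + 2 * y15 + y9 := by
    linear_combination -bar d * B_b6 + bar b * b6_D + B_X15 + B_d - b_D
  have x15_z9 : x15 * z9 = b + 2 * x6 + 6 * x15 + 3 * x9 + bar d := by
    linear_combination -z9 * B_b6 + bar b * b6_z9 + B_b6 + 2 * B_y15 + 2 * B_y9 - b_z9
  have x15_c8 : x15 * c8 = b + 2 * x6 + 5 * x15 + 3 * x9 + bar d := by
    linear_combination -c8 * B_b6 + bar b * b6_c8 + B_b6 + 2 * B_y15 + B_y9 + B_y3 - b_c8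
  have x15_b5 : x15 * b5 = b + x6 + 3 * x15 + 2 * x9 + bar d := by
    linear_combination -b5 * B_b6 + bar b * b6_b5 + B_b6 + B_y15 + B_y9 - b_b5
  have x15_c5 : x15 * c5 = b + x6 + 3 * x15 + 2 * x9 + bar d := by
    linear_combination -c5 * B_b6 + bar b * b6_c5 + B_b6 + B_y15 + B_y9 - b_c5
  have x15_y3 : x15 * y3 = bar x6 + 2 * bar x15 + bar x9 := by
    linear_combination -y3 * B_b6 + bar b * b6_y3 + B_x10 + B_c8 - b_y3
  have x10_x10 : x10 * x10 = 1 + 2 * b8 + 2 * x10 + 3 * z9 + 2 * c8 + 2 * b5 + 2 * c5 := by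
    linear_combination -x10 * c_b6 + c * b6_x10 + c_c + 3 * c_y15 + c_y9 + c_y3 - b8_x10
  have x10_x9 : x10 * x9 = b + x6 + 4 * x15 + 2 * x9 + bar d := by
    linear_combination -x9 * c_b6 + c * b6_x9 + c_X6 + 2 * c_X15 + 2 * c_X9 - b8_x9
  have y15_x10 : y15 * x10 = c + 3 * b6 + 6 * y15 + 4 * y9 + y3 := by
    linear_combination -x10 * b_x6 + b * x6_x10 + b_b + 3 * b_x15 + b_x9 + b_D - c_x10
  have x10_y9 : x10 * y9 = c + b6 + 4 * y15 + 2 * y9 + y3 := by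
    linear_combination -y9 * c_b6 + c * b6_y9 + c_b8 + c_x10 + 2 * c_z9 + c_c8 + c_b5 + c_c5 -
        b8_y9
  have x10_d : x10 * d = bar x6 + bar x15 + bar x9 := by
    linear_combination -d * c_b6 + c * b6_d + c_x15 + c_D - b8_d
  have x10_z9 : x10 * z9 = 2 * b8 + 3 * x10 + 2 * z9 + 2 * c8 + b5 + c5 := by
    linear_combination -z9 * c_b6 + c * b6_z9 + c_b6 + 2 * c_y15 + 2 * c_y9 - b8_z9
  have x10_c8 : x10 * c8 = 2 * b8 + 2 * x10 + 2 * z9 + 2 * c8 + b5 + c5 := by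
    linear_combination -c8 * c_b6 + c * b6_c8 + c_b6 + 2 * c_y15 + c_y9 + c_y3 - b8_c8
  have x10_b5 : x10 * b5 = b8 + 2 * x10 + z9 + c8 + b5 := by
    linear_combination -b5 * c_b6 + c * b6_b5 + c_b6 + c_y15 + c_y9 - b8_b5
  have x10_c5 : x10 * c5 = b8 + 2 * x10 + z9 + c8 + c5 := by
    linear_combination -c5 * c_b6 + c * b6_c5 + c_b6 + c_y15 + c_y9 - b8_c5
  have x10_y3 : x10 * y3 = b6 + y15 + y9 := by
    linear_combination -y3 * c_b6 + c * b6_y3 + c_x10 + c_c8 - b8_y3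
  have x9_x9 : x9 * x9 = c + 2 * b6 + 3 * y15 + 2 * y9 + y3 := by
    linear_combination -x9 * b_x10 + b * x10_x9 + b_b + b_x6 + 4 * b_x15 + 2 * b_x9 + b_D - x6_x9
        - x15_x9
  have x10_X9 : x10 * bar x9 = bar b + bar x6 + 4 * bar x15 + 2 * bar x9 + d := by
    simpa only [map_add, map_mul, map_ofNat, map_one, hbar, c_real, b6_real, b8_real, x10_real,
        y15_real, y9_real, z9_real, c8_real, b5_real, c5_real, y3_real] using key x10_x9
  have x9_X9 : x9 * bar x9 = 1 + 2 * b8 + 2 * x10 + 2 * z9 + 2 * c8 + b5 + c5 := by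
    linear_combination -bar x9 * b_x10 + b * x10_X9 + b_B + b_X6 + 4 * b_X15 + 2 * b_X9 + b_d -
        x6_X9 - x15_X9
  have y15_x9 : y15 * x9 = bar b + 2 * bar x6 + 6 * bar x15 + 3 * bar x9 + d := by
    linear_combination -x9 * b_x6 + b * x6_x9 + b_b6 + 2 * b_y15 + 2 * b_y9 - c_x9
  have x9_y9 : x9 * y9 = bar b + 2 * bar x6 + 3 * bar x15 + 2 * bar x9 + d := by
    linear_combination -y9 * b_x10 + b * x10_y9 + b_c + b_b6 + 4 * b_y15 + 2 * b_y9 + b_y3 -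
        x6_y9 - x15_y9
  have x9_d : x9 * d = b8 + x10 + z9 := by
    linear_combination -d * b_x10 + b * x10_d + b_X6 + b_X15 + b_X9 - x6_d - x15_d
  have x10_D : x10 * bar d = x6 + x15 + x9 := by
    simpa only [map_add, map_mul, map_ofNat, map_one, hbar, c_real, b6_real, b8_real, x10_real,
        y15_real, y9_real, z9_real, c8_real, b5_real, c5_real, y3_real] using key x10_d
  have x9_D : x9 * bar d = c + y15 + y9 := by
    linear_combination -bar d * b_x10 + b * x10_D + b_x6 + b_x15 + b_x9 - x6_D - x15_D
  have x9_z9 : x9 * z9 = b + 2 * x6 + 3 * x15 + 2 * x9 + bar d := by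
    linear_combination -z9 * b_x10 + b * x10_z9 + 2 * b_b8 + 3 * b_x10 + 2 * b_z9 + 2 * b_c8 +
        b_b5 + b_c5 - x6_z9 - x15_z9
  have x9_b5 : x9 * b5 = x6 + 2 * x15 + x9 := by
    linear_combination -b5 * b_x10 + b * x10_b5 + b_b8 + 2 * b_x10 + b_z9 + b_c8 + b_b5 - x6_b5 -
        x15_b5
  have x9_c5 : x9 * c5 = x6 + 2 * x15 + x9 := by
    linear_combination -c5 * b_x10 + b * x10_c5 + b_b8 + 2 * b_x10 + b_z9 + b_c8 + b_c5 - x6_c5 -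
        x15_c5
  have x9_y3 : x9 * y3 = bar b + bar x15 + bar x9 := by
    linear_combination -y3 * b_x10 + b * x10_y3 + b_b6 + b_y15 + b_y9 - x6_y3 - x15_y3
  have y15_y15 : y15 * y15 = 1 + 5 * b8 + 6 * x10 + 6 * z9 + 5 * c8 + 3 * b5 + 3 * c5 := by
    linear_combination -y15 * b_x6 + b * x6_y15 + b_B + b_X6 + 4 * b_X15 + 2 * b_X9 + b_d - c_y15
  have y15_y9 : y15 * y9 = 3 * b8 + 4 * x10 + 3 * z9 + 3 * c8 + 2 * b5 + 2 * c5 := by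
    linear_combination -y9 * b_x6 + b * x6_y9 + b_X6 + 2 * b_X15 + 2 * b_X9 - c_y9
  have y15_d : y15 * d = x6 + 2 * x15 + x9 := by
    linear_combination -d * b_x6 + b * x6_d + b_x10 + b_c8 - c_d
  have y15_z9 : y15 * z9 = c + 2 * b6 + 6 * y15 + 3 * y9 + y3 := by
    linear_combination -z9 * b_x6 + b * x6_z9 + b_x6 + 2 * b_x15 + 2 * b_x9 - c_z9
  have y15_c8 : y15 * c8 = c + 2 * b6 + 5 * y15 + 3 * y9 + y3 := by
    linear_combination -c8 * b_x6 + b * x6_c8 + b_x6 + 2 * b_x15 + b_x9 + b_D - c_c8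
  have y15_b5 : y15 * b5 = c + b6 + 3 * y15 + 2 * y9 + y3 := by
    linear_combination -b5 * b_x6 + b * x6_b5 + b_x6 + b_x15 + b_x9 - c_b5
  have y15_c5 : y15 * c5 = c + b6 + 3 * y15 + 2 * y9 + y3 := by
    linear_combination -c5 * b_x6 + b * x6_c5 + b_x6 + b_x15 + b_x9 - c_c5
  have y15_y3 : y15 * y3 = b8 + x10 + z9 + c8 + b5 + c5 := by
    linear_combination -y3 * b_x6 + b * x6_y3 + b_X15 + b_d - c_y3
  have y9_y9 : y9 * y9 = 1 + 2 * b8 + 2 * x10 + 2 * z9 + 2 * c8 + b5 + c5 := by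
    linear_combination -y9 * c_x10 + c * x10_y9 + c_c + c_b6 + 4 * c_y15 + 2 * c_y9 + c_y3 -
        b6_y9 - y15_y9
  have y9_d : y9 * d = b + x15 + x9 := by
    linear_combination -d * c_x10 + c * x10_d + c_X6 + c_X15 + c_X9 - b6_d - y15_d
  have y9_z9 : y9 * z9 = c + 2 * b6 + 3 * y15 + 2 * y9 + y3 := by
    linear_combination -z9 * c_x10 + c * x10_z9 + 2 * c_b8 + 3 * c_x10 + 2 * c_z9 + 2 * c_c8 +
        c_b5 + c_c5 - b6_z9 - y15_z9
  have y9_c8 : y9 * c8 = c + b6 + 3 * y15 + 2 * y9 := by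
    linear_combination -c8 * c_x10 + c * x10_c8 + 2 * c_b8 + 2 * c_x10 + 2 * c_z9 + 2 * c_c8 +
        c_b5 + c_c5 - b6_c8 - y15_c8
  have y9_b5 : y9 * b5 = b6 + 2 * y15 + y9 := by
    linear_combination -b5 * c_x10 + c * x10_b5 + c_b8 + 2 * c_x10 + c_z9 + c_c8 + c_b5 - b6_b5 -
        y15_b5
  have y9_c5 : y9 * c5 = b6 + 2 * y15 + y9 := by
    linear_combination -c5 * c_x10 + c * x10_c5 + c_b8 + 2 * c_x10 + c_z9 + c_c8 + c_c5 - b6_c5 -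
        y15_c5
  have y9_y3 : y9 * y3 = b8 + x10 + z9 := by
    linear_combination -y3 * c_x10 + c * x10_y3 + c_b6 + c_y15 + c_y9 - b6_y3 - y15_y3
  have y9_D : y9 * bar d = bar b + bar x15 + bar x9 := by
    simpa only [map_add, map_mul, map_ofNat, map_one, hbar, c_real, b6_real, b8_real, x10_real,
        y15_real, y9_real, z9_real, c8_real, b5_real, c5_real, y3_real] using key y9_d
  have X15_D : bar x15 * bar d = b8 + x10 + z9 + c8 + b5 + c5 := by
    simpa only [map_add, map_mul, map_ofNat, map_one, hbar, c_real, b6_real, b8_real, x10_real,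
        y15_real, y9_real, z9_real, c8_real, b5_real, c5_real, y3_real] using key x15_d
  have X9_D : bar x9 * bar d = b8 + x10 + z9 := by
    simpa only [map_add, map_mul, map_ofNat, map_one, hbar, c_real, b6_real, b8_real, x10_real,
        y15_real, y9_real, z9_real, c8_real, b5_real, c5_real, y3_real] using key x9_d
  have d_D : d * bar d = 1 + c8 := by
    linear_combination -bar d * b_y9 + b * y9_D + b_B + b_X15 + b_X9 - X15_D - X9_D
  have X15_d : bar x15 * d = b6 + 2 * y15 + y9 := by
    simpa only [map_add, map_mul, map_ofNat, map_one, hbar, c_real, b6_real, b8_real, x10_real,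
        y15_real, y9_real, z9_real, c8_real, b5_real, c5_real, y3_real] using key x15_D
  have X9_d : bar x9 * d = c + y15 + y9 := by
    simpa only [map_add, map_mul, map_ofNat, map_one, hbar, c_real, b6_real, b8_real, x10_real,
        y15_real, y9_real, z9_real, c8_real, b5_real, c5_real, y3_real] using key x9_D
  have d_d : d * d = b6 + y3 := by
    linear_combination -d * b_y9 + b * y9_d + b_b + b_x15 + b_x9 - X15_d - X9_d
  have X15_z9 : bar x15 * z9 = bar b + 2 * bar x6 + 6 * bar x15 + 3 * bar x9 + d := by
    simpa only [map_add, map_mul, map_ofNat, map_one, hbar, c_real, b6_real, b8_real, x10_real,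
        y15_real, y9_real, z9_real, c8_real, b5_real, c5_real, y3_real] using key x15_z9
  have X9_z9 : bar x9 * z9 = bar b + 2 * bar x6 + 3 * bar x15 + 2 * bar x9 + d := by
    simpa only [map_add, map_mul, map_ofNat, map_one, hbar, c_real, b6_real, b8_real, x10_real,
        y15_real, y9_real, z9_real, c8_real, b5_real, c5_real, y3_real] using key x9_z9
  have d_z9 : d * z9 = bar b + bar x15 + bar x9 := by
    linear_combination -z9 * b_y9 + b * y9_z9 + b_c + 2 * b_b6 + 3 * b_y15 + 2 * b_y9 + b_y3 -
        X15_z9 - X9_z9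
  have X15_c8 : bar x15 * c8 = bar b + 2 * bar x6 + 5 * bar x15 + 3 * bar x9 + d := by
    simpa only [map_add, map_mul, map_ofNat, map_one, hbar, c_real, b6_real, b8_real, x10_real,
        y15_real, y9_real, z9_real, c8_real, b5_real, c5_real, y3_real] using key x15_c8
  have X6_c8 : bar x6 * c8 = bar x6 + 2 * bar x15 + bar x9 + d := by
    simpa only [map_add, map_mul, map_ofNat, map_one, hbar, c_real, b6_real, b8_real, x10_real,
        y15_real, y9_real, z9_real, c8_real, b5_real, c5_real, y3_real] using key x6_c8
  have X9_c8 : bar x9 * c8 = bar b + bar x6 + 3 * bar x15 + 2 * bar x9 := by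
    linear_combination -c8 * B_x10 + bar b * x10_c8 + 2 * B_b8 + 2 * B_x10 + 2 * B_z9 + 2 * B_c8
        + B_b5 + B_c5 - X6_c8 - X15_c8
  have d_c8 : d * c8 = bar x6 + bar x15 + d := by
    linear_combination -c8 * b_y9 + b * y9_c8 + b_c + b_b6 + 3 * b_y15 + 2 * b_y9 - X15_c8 - X9_c8
  have X15_b5 : bar x15 * b5 = bar b + bar x6 + 3 * bar x15 + 2 * bar x9 + d := by
    simpa only [map_add, map_mul, map_ofNat, map_one, hbar, c_real, b6_real, b8_real, x10_real,
        y15_real, y9_real, z9_real, c8_real, b5_real, c5_real, y3_real] using key x15_b5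
  have X9_b5 : bar x9 * b5 = bar x6 + 2 * bar x15 + bar x9 := by
    simpa only [map_add, map_mul, map_ofNat, map_one, hbar, c_real, b6_real, b8_real, x10_real,
        y15_real, y9_real, z9_real, c8_real, b5_real, c5_real, y3_real] using key x9_b5
  have d_b5 : d * b5 = bar x15 := by
    linear_combination -b5 * b_y9 + b * y9_b5 + b_b6 + 2 * b_y15 + b_y9 - X15_b5 - X9_b5
  have X15_c5 : bar x15 * c5 = bar b + bar x6 + 3 * bar x15 + 2 * bar x9 + d := by
    simpa only [map_add, map_mul, map_ofNat, map_one, hbar, c_real, b6_real, b8_real, x10_real,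
        y15_real, y9_real, z9_real, c8_real, b5_real, c5_real, y3_real] using key x15_c5
  have X9_c5 : bar x9 * c5 = bar x6 + 2 * bar x15 + bar x9 := by
    simpa only [map_add, map_mul, map_ofNat, map_one, hbar, c_real, b6_real, b8_real, x10_real,
        y15_real, y9_real, z9_real, c8_real, b5_real, c5_real, y3_real] using key x9_c5
  have d_c5 : d * c5 = bar x15 := by
    linear_combination -c5 * b_y9 + b * y9_c5 + b_b6 + 2 * b_y15 + b_y9 - X15_c5 - X9_c5
  have X15_y3 : bar x15 * y3 = x6 + 2 * x15 + x9 := by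
    simpa only [map_add, map_mul, map_ofNat, map_one, hbar, c_real, b6_real, b8_real, x10_real,
        y15_real, y9_real, z9_real, c8_real, b5_real, c5_real, y3_real] using key x15_y3
  have X9_y3 : bar x9 * y3 = b + x15 + x9 := by
    simpa only [map_add, map_mul, map_ofNat, map_one, hbar, c_real, b6_real, b8_real, x10_real,
        y15_real, y9_real, z9_real, c8_real, b5_real, c5_real, y3_real] using key x9_y3
  have d_y3 : d * y3 = x6 + bar d := by
    linear_combination -y3 * b_y9 + b * y9_y3 + b_b8 + b_x10 + b_z9 - X15_y3 - X9_y3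
  have z9_z9 : z9 * z9 = 1 + 2 * b8 + 2 * x10 + 2 * z9 + 2 * c8 + b5 + c5 := by
    linear_combination -z9 * b_d + b * d_z9 + b_B + b_X15 + b_X9
  have z9_c8 : z9 * c8 = 2 * b8 + 2 * x10 + 2 * z9 + c8 + b5 + c5 := by
    linear_combination -c8 * b_d + b * d_c8 + b_X6 + b_X15 + b_d
  have z9_b5 : z9 * b5 = b8 + x10 + z9 + c8 + b5 + c5 := by
    linear_combination -b5 * b_d + b * d_b5 + b_X15
  have z9_c5 : z9 * c5 = b8 + x10 + z9 + c8 + b5 + c5 := by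
    linear_combination -c5 * b_d + b * d_c5 + b_X15
  have z9_y3 : z9 * y3 = c + y15 + y9 := by
    linear_combination -y3 * b_d + b * d_y3 + b_x6 + b_D
  have c8_c8 : c8 * c8 = 1 + b8 + 2 * x10 + z9 + 2 * c8 + b5 + c5 := by
    linear_combination -c8 * b_X9 + b * X9_c8 + b_B + b_X6 + 3 * b_X15 + 2 * b_X9 - x10_c8 - z9_c8
  have c8_b5 : c8 * b5 = b8 + x10 + z9 + c8 + c5 := by
    linear_combination -b5 * b_X9 + b * X9_b5 + b_X6 + 2 * b_X15 + b_X9 - x10_b5 - z9_b5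
  have c8_c5 : c8 * c5 = b8 + x10 + z9 + c8 + b5 := by
    linear_combination -c5 * b_X9 + b * X9_c5 + b_X6 + 2 * b_X15 + b_X9 - x10_c5 - z9_c5
  have x9_c8 : x9 * c8 = b + x6 + 3 * x15 + 2 * x9 := by
    simpa only [map_add, map_mul, map_ofNat, map_one, hbar, c_real, b6_real, b8_real, x10_real,
        y15_real, y9_real, z9_real, c8_real, b5_real, c5_real, y3_real] using key X9_c8
  have y3_c8 : y3 * c8 = b6 + y15 + y3 := by
    linear_combination -c8 * b_x9 + b * x9_c8 + b_b + b_x6 + 3 * b_x15 + 2 * b_x9 - y15_c8 - y9_c8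
  have y3_b5 : y3 * b5 = y15 := by
    linear_combination -b5 * b_x9 + b * x9_b5 + b_x6 + 2 * b_x15 + b_x9 - y15_b5 - y9_b5
  have c5_c5 : c5 * c5 = 1 + x10 + z9 + c5 := by
    linear_combination -c5 * b_X15 + b * X15_c5 + b_B + b_X6 + 3 * b_X15 + 2 * b_X9 + b_d - b8_c5
        - x10_c5 - z9_c5 - c8_c5 - b5_c5
  have y3_c5 : y3 * c5 = y15 := by
    linear_combination -c5 * b_x9 + b * x9_c5 + b_x6 + 2 * b_x15 + b_x9 - y15_c5 - y9_c5
  have y3_y3 : y3 * y3 = 1 + c8 := by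
    linear_combination -y3 * b_x9 + b * x9_y3 + b_B + b_X15 + b_X9 - y15_y3 - y9_y3
  constructor
  · linear_combination b_B
  · linear_combination b_b
  · linear_combination b_c
  · linear_combination b_b6
  · linear_combination b_x6
  · linear_combination b_X6
  · linear_combination b_b8
  · linear_combination b_x15
  · linear_combination b_x10
  · linear_combination b_X15
  · linear_combination b_x9
  · linear_combination b_X9
  · linear_combination b_y15
  · linear_combination b_y9
  · linear_combination b_d
  · linear_combination b_D
  · linear_combination b_z9
  · linear_combination b_c8
  · linear_combination b_b5
  · linear_combination b_c5
  · linear_combination b_y3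
  · linear_combination c_c
  · linear_combination c_b6
  · linear_combination c_x6
  · linear_combination c_b8
  · linear_combination c_x15
  · linear_combination c_x10
  · linear_combination c_x9
  · linear_combination c_y15
  · linear_combination c_y9
  · linear_combination c_d
  · linear_combination c_z9
  · linear_combination c_c8
  · linear_combination c_b5
  · linear_combination c_c5
  · linear_combination c_y3
  · linear_combination b6_b6
  · linear_combination b6_x6
  · linear_combination b8_b6
  · linear_combination b6_x15
  · linear_combination b6_x10
  · linear_combination b6_x9
  · linear_combination b6_y15
  · linear_combination b6_y9
  · linear_combination b6_d
  · linear_combination b6_z9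
  · linear_combination b6_c8
  · linear_combination b6_b5
  · linear_combination b6_c5
  · linear_combination b6_y3
  · linear_combination x6_x6
  · linear_combination X6_x6
  · linear_combination b8_x6
  · linear_combination x6_x15
  · linear_combination x6_x10
  · linear_combination x6_X15
  · linear_combination x6_x9
  · linear_combination x6_X9
  · linear_combination x6_y15
  · linear_combination x6_y9
  · linear_combination x6_d
  · linear_combination x6_D
  · linear_combination x6_z9
  · linear_combination x6_c8
  · linear_combination x6_b5
  · linear_combination x6_c5
  · linear_combination x6_y3
  · linear_combination b8_b8
  · linear_combination b8_x10
  · linear_combination b8_x9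
  · linear_combination b8_y15
  · linear_combination b8_y9
  · linear_combination b8_d
  · linear_combination b8_z9
  · linear_combination b8_c8
  · linear_combination b8_b5
  · linear_combination b8_c5
  · linear_combination b8_y3
  · linear_combination b8_x15
  · linear_combination x15_x15
  · linear_combination x15_x10
  · linear_combination X15_x15
  · linear_combination x15_x9
  · linear_combination x15_X9
  · linear_combination y15_x15
  · linear_combination x15_y9
  · linear_combination x15_d
  · linear_combination x15_D
  · linear_combination x15_z9
  · linear_combination x15_c8
  · linear_combination x15_b5
  · linear_combination x15_c5
  · linear_combination x15_y3
  · linear_combination x10_x10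
  · linear_combination x10_x9
  · linear_combination y15_x10
  · linear_combination x10_y9
  · linear_combination x10_d
  · linear_combination x10_z9
  · linear_combination x10_c8
  · linear_combination x10_b5
  · linear_combination x10_c5
  · linear_combination x10_y3
  · linear_combination x9_x9
  · linear_combination x9_X9
  · linear_combination y15_x9
  · linear_combination x9_y9
  · linear_combination x9_d
  · linear_combination x9_D
  · linear_combination x9_z9
  · linear_combination x9_b5
  · linear_combination x9_c5
  · linear_combination x9_y3
  · linear_combination y15_y15
  · linear_combination y15_y9
  · linear_combination y15_d
  · linear_combination y15_z9
  · linear_combination y15_c8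
  · linear_combination y15_b5
  · linear_combination y15_c5
  · linear_combination y15_y3
  · linear_combination y9_y9
  · linear_combination y9_d
  · linear_combination y9_z9
  · linear_combination y9_c8
  · linear_combination y9_b5
  · linear_combination y9_c5
  · linear_combination y9_y3
  · linear_combination d_D
  · linear_combination d_d
  · linear_combination d_z9
  · linear_combination d_c8
  · linear_combination d_b5
  · linear_combination d_c5
  · linear_combination d_y3
  · linear_combination z9_z9
  · linear_combination z9_c8
  · linear_combination z9_b5
  · linear_combination z9_c5
  · linear_combination z9_y3
  · linear_combination c8_c8
  · linear_combination c8_b5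
  · linear_combination c8_c5
  · linear_combination y3_c8
  · linear_combination b5_b5
  · linear_combination b5_c5
  · linear_combination y3_b5
  · linear_combination c5_c5
  · linear_combination y3_c5
  · linear_combination y3_y3
  · linear_combination x9_c8

end TableRel

/-! ### Passage to the ring of integral elements -/

namespace TableAlgebra

variable {ι A : Type*} [Fintype ι] [CommRing A] [Algebra ℂ A] (T : TableAlgebra ι A)

/-- The elements with integer coordinates with respect to the table basis. -/
def intSubring (hT : T.IsNITA) : Subring A where
  carrier := {a | ∀ i, ∃ n : ℤ, T.basis.repr a i = n}
  mul_mem' := by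
    intro x y hx hy m
    choose p hp using hx
    choose q hq using hy
    choose s hs using hT.2.1
    refine ⟨∑ i, ∑ j, p i * q j * s i j m, ?_⟩
    conv_lhs => rw [← T.basis.sum_repr x, ← T.basis.sum_repr y, Finset.sum_mul_sum]
    simp only [map_sum, smul_mul_smul_comm, map_smul, Finsupp.coe_finsetSum, Finset.sum_apply,
      Finsupp.smul_apply, smul_eq_mul, hp, hq, hs]
    push_cast
    rfl
  one_mem' := fun i => by
    classical
    exact ⟨if T.one = i then 1 else 0, by
      rw [← T.basis_one, T.basis.repr_self_apply]; split_ifs <;> simp⟩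
  add_mem' := by
    intro x y hx hy m
    obtain ⟨p, hp⟩ := hx m
    obtain ⟨q, hq⟩ := hy m
    exact ⟨p + q, by simp [hp, hq]⟩
  zero_mem' := fun i => ⟨0, by simp⟩
  neg_mem' := by
    intro x hx m
    obtain ⟨p, hp⟩ := hx m
    exact ⟨-p, by simp [hp]⟩

theorem basis_mem (hT : T.IsNITA) (i : ι) : T.basis i ∈ T.intSubring hT := by
  classical
  exact fun j => ⟨if i = j then 1 else 0, by rw [T.basis.repr_self_apply]; split_ifs <;> simp⟩

theorem bar_mem (hT : T.IsNITA) {a : A} (ha : a ∈ T.intSubring hT) :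
    T.bar a ∈ T.intSubring hT := by
  choose p hp using ha
  choose s hs using T.bar_basis
  rw [← T.basis.sum_repr a, map_sum]
  refine Subring.sum_mem _ fun i _ => ?_
  rw [map_smul, hs, hp, Int.cast_smul_eq_zsmul]
  exact Subring.zsmul_mem _ (T.basis_mem hT _) _

/-- The integer coordinates of an element. -/
noncomputable def intCoef (hT : T.IsNITA) : T.intSubring hT →+ (ι → ℤ) where
  toFun a i := (a.2 i).choose
  map_zero' := by
    ext i
    have h := ((0 : T.intSubring hT).2 i).choose_spec
    simpa using h.symm
  map_add' a c := by
    ext i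
    have h := ((a + c).2 i).choose_spec
    have ha := (a.2 i).choose_spec
    have hc := (c.2 i).choose_spec
    have h1 : T.basis.repr ((a + c : T.intSubring hT) : A) i
        = T.basis.repr (a : A) i + T.basis.repr (c : A) i := by
      rw [Subring.coe_add, map_add, Finsupp.add_apply]
    rw [h, ha, hc] at h1
    exact_mod_cast h1

theorem intCoef_spec (hT : T.IsNITA) (a : T.intSubring hT) (i : ι) :
    T.basis.repr a i = (T.intCoef hT a i : ℂ) := (a.2 i).choose_spec

theorem exists_intDeg (hT : T.IsNITA) {f : A →ₐ[ℂ] ℂ} (hf : T.IsDegreeHom f) :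
    ∃ g : T.intSubring hT →+* ℤ, ∀ a : T.intSubring hT, f a = (g a : ℂ) := by
  have h : ∀ a : T.intSubring hT, ∃ n : ℤ, f a = n := by
    intro a
    choose s hs using hT.2.2
    refine ⟨∑ i, T.intCoef hT a i * s i, ?_⟩
    conv_lhs => rw [← T.basis.sum_repr (a : A), map_sum]
    simp only [map_smul, smul_eq_mul, T.intCoef_spec hT]
    simp only [← T.degree_eq hf, hs]
    push_cast
    rfl
  choose g hg using h
  have hinj : Function.Injective (Int.cast : ℤ → ℂ) := Int.cast_injective
  exact ⟨{ toFun := g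
           map_one' := hinj (by rw [← hg]; simp)
           map_mul' := fun a c => hinj (by rw [← hg]; push_cast; simp [hg])
           map_zero' := hinj (by rw [← hg]; simp)
           map_add' := fun a c => hinj (by rw [← hg]; push_cast; simp [hg]) }, hg⟩

/-- Composing with conjugation gives another degree homomorphism, so uniqueness applies. -/
theorem IsDegreeHom.bar {f : A →ₐ[ℂ] ℂ} (hf : T.IsDegreeHom f) (a : A) : f (T.bar a) = f a := by
  have h : T.IsDegreeHom (f.comp (T.bar : A →ₐ[ℂ] A)) := fun i => by
    obtain ⟨j, hj⟩ := T.bar_basis i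
    obtain ⟨r, hr, h⟩ := hf j
    exact ⟨r, hr, by simpa [hj] using h⟩
  exact congrArg (fun g : A →ₐ[ℂ] ℂ => g a) (IsDegreeHom.unique T h hf)

-- Integrality makes the ℤ-span of the basis a subring stable under conjugation on which the degree
-- is integer valued. The bound three on degrees holds because degrees of basis elements are
-- positive integers and 1 and 2 are excluded.
open Classical in
theorem exists_intTable (hT : T.IsNITA) {f : A →ₐ[ℂ] ℂ} (hf : T.IsDegreeHom f)
    (hdeg : ∀ a ∈ T.B, a ≠ 1 → T.degree a ≠ 1 ∧ T.degree a ≠ 2) :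
    ∃ I : IntTable ι (T.intSubring hT), (∀ i, (I.e i : A) = T.basis i) ∧
      (∀ (a : T.intSubring hT) i, T.basis.repr (a : A) i = (I.coef a i : ℂ)) ∧
      (∀ a, (I.bar a : A) = T.bar a) ∧ ∀ a : T.intSubring hT, T.degree (a : A) = (I.deg a : ℂ) := by
  obtain ⟨g, hg⟩ := T.exists_intDeg hT hf
  have hsp := T.intCoef_spec hT
  have hcoef : ∀ (a : T.intSubring hT) (i : ι) (n : ℤ), T.basis.repr (a : A) i = n →
      T.intCoef hT a i = n := fun a i n h => by rw [hsp] at h; exact_mod_cast h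
  let br : T.intSubring hT →+* T.intSubring hT :=
    RingHom.restrict (T.bar : A →+* A) (T.intSubring hT) (T.intSubring hT)
      fun a ha => T.bar_mem hT ha
  have hbr : ∀ a, (br a : A) = T.bar a := fun a => rfl
  refine ⟨
    { e := fun i => ⟨T.basis i, T.basis_mem hT i⟩
      coef := T.intCoef hT
      expand := fun a => ?_
      coef_e := fun i j => hcoef _ _ _ ?_
      one := T.one
      e_one := Subtype.ext T.basis_one
      bar := br
      bar_bar := fun a => Subtype.ext (T.bar_bar a)
      bar_e := fun i => ?_
      nonneg := fun i j m => ?_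
      adj := fun i j m => hcoef _ _ _ ?_
      deg := g
      deg_bar := fun a => ?_
      three_le_deg := fun i hi => ?_ }, fun i => rfl, hsp, hbr,
      fun a => by rw [T.degree_eq hf, hg]⟩
  · refine Subtype.ext ?_
    conv_lhs => rw [← T.basis.sum_repr (a : A)]
    rw [AddSubmonoidClass.coe_finsetSum]
    refine Finset.sum_congr rfl fun i _ => ?_
    rw [hsp, Int.cast_smul_eq_zsmul]
    rfl
  · rw [T.basis.repr_self_apply]
    split_ifs <;> simp
  · obtain ⟨j, hj⟩ := T.bar_basis i
    exact ⟨j, Subtype.ext hj⟩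
  · obtain ⟨n, hn⟩ := hT.2.1 i j m
    rw [hcoef _ _ (n : ℤ) (by simpa using hn)]
    exact Int.natCast_nonneg n
  · rw [← hsp]
    exact hT.1 i j m
  · have h := hg (br a)
    rw [hbr, IsDegreeHom.bar T hf, hg] at h
    exact_mod_cast h.symm
  · obtain ⟨n, hn⟩ := hT.2.2 i
    obtain ⟨r, hr, hfr⟩ := hf i
    have h1 := hdeg (T.basis i) ⟨i, rfl⟩ fun h => hi (Subtype.ext h)
    rw [hn] at h1
    have h2 : g ⟨T.basis i, T.basis_mem hT i⟩ = n := by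
      have h := hg ⟨T.basis i, T.basis_mem hT i⟩
      rw [← T.degree_eq hf, hn] at h
      exact_mod_cast h.symm
    rw [← T.degree_eq hf, hn] at hfr
    have h3 : (n : ℝ) = r := by exact_mod_cast hfr
    have h4 : 0 < n := by rw [← h3] at hr; exact_mod_cast hr
    have h5 : n ≠ 1 := fun h => h1.1 (by rw [h]; norm_num)
    have h6 : n ≠ 2 := fun h => h1.2 (by rw [h]; norm_num)
    rw [h2]
    omega

end TableAlgebra

/-! ### Distinctness of the listed elements -/

namespace IntTable

variable {ι R : Type*} [Fintype ι] [DecidableEq ι] [CommRing R] {T : IntTable ι R}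

/-- The product of a basis element with its own conjugate contains 1. This separates elements of
equal degree by reading off the multiplication table. -/
theorem IsB.ne_of_mul {s t t' r : R} (hs : T.IsB s) (ht : T.bar t = t') (h : s * t' = r)
    (hr : T.ip r 1 = 0) : s ≠ t := by
  rintro rfl
  have h1 := ip_mul_right (T := T) s t' 1
  rw [h, hr, mul_one, ← ht, T.bar_bar, hs.ip_self] at h1
  exact zero_ne_one h1

theorem IsB.ip_eq_zero_of_deg {s : R} {n : ℤ} (hs : T.IsB s) (h : T.deg s = n) (hn : n ≠ 1) :
    T.ip s 1 = 0 :=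
  hs.ip_deg_ne isB_one (by rwa [h, map_one])

/-- The listed basis elements are distinct. -/
theorem Final.nodup {b c b6 x6 b8 x15 x10 x9 y15 y9 d z9 c8 b5 c5 y3 : R}
    (h : T.Final b c b6 x6 b8 x15 x10 x9 y15 y9 d z9 c8 b5 c5 y3) :
    [1, T.bar b, b, c, b6, x6, T.bar x6, b8, x15, T.bar x15, x10, x9, T.bar x9, y15, y9, d,
      T.bar d, z9, c8, b5, c5, y3].Nodup := by
  have r := h.rel
  have p := r.products T.bar_bar
  have d1 : T.deg (1 : R) = 1 := map_one _
  have d_B : T.deg (T.bar b) = 3 := (T.deg_bar _).trans h.b_deg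
  have d_b : T.deg b = 3 := h.b_deg
  have d_c : T.deg c = 3 := h.c_deg
  have d_b6 : T.deg b6 = 6 := h.b6_deg
  have d_x6 : T.deg x6 = 6 := h.x6_deg
  have d_X6 : T.deg (T.bar x6) = 6 := (T.deg_bar _).trans h.x6_deg
  have d_b8 : T.deg b8 = 8 := h.b8_deg
  have d_x15 : T.deg x15 = 15 := h.x15_deg
  have d_X15 : T.deg (T.bar x15) = 15 := (T.deg_bar _).trans h.x15_deg
  have d_x10 : T.deg x10 = 10 := h.x10_deg
  have d_x9 : T.deg x9 = 9 := h.x9_deg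
  have d_X9 : T.deg (T.bar x9) = 9 := (T.deg_bar _).trans h.x9_deg
  have d_y15 : T.deg y15 = 15 := h.y15_deg
  have d_y9 : T.deg y9 = 9 := h.y9_deg
  have d_d : T.deg d = 3 := h.d_deg
  have d_D : T.deg (T.bar d) = 3 := (T.deg_bar _).trans h.d_deg
  have d_z9 : T.deg z9 = 9 := h.z9_deg
  have d_c8 : T.deg c8 = 8 := h.c8_deg
  have d_b5 : T.deg b5 = 5 := h.b5_deg
  have d_c5 : T.deg c5 = 5 := h.c5_deg
  have d_y3 : T.deg y3 = 3 := h.y3_deg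
  have o_B : T.ip (T.bar b) 1 = 0 := h.b_isB.bar.ip_eq_zero_of_deg d_B (by decide)
  have o_b : T.ip b 1 = 0 := h.b_isB.ip_eq_zero_of_deg d_b (by decide)
  have o_c : T.ip c 1 = 0 := h.c_isB.ip_eq_zero_of_deg d_c (by decide)
  have o_b6 : T.ip b6 1 = 0 := h.b6_isB.ip_eq_zero_of_deg d_b6 (by decide)
  have o_x6 : T.ip x6 1 = 0 := h.x6_isB.ip_eq_zero_of_deg d_x6 (by decide)
  have o_X6 : T.ip (T.bar x6) 1 = 0 := h.x6_isB.bar.ip_eq_zero_of_deg d_X6 (by decide)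
  have o_x15 : T.ip x15 1 = 0 := h.x15_isB.ip_eq_zero_of_deg d_x15 (by decide)
  have o_X15 : T.ip (T.bar x15) 1 = 0 := h.x15_isB.bar.ip_eq_zero_of_deg d_X15 (by decide)
  have o_x9 : T.ip x9 1 = 0 := h.x9_isB.ip_eq_zero_of_deg d_x9 (by decide)
  have o_X9 : T.ip (T.bar x9) 1 = 0 := h.x9_isB.bar.ip_eq_zero_of_deg d_X9 (by decide)
  have o_y15 : T.ip y15 1 = 0 := h.y15_isB.ip_eq_zero_of_deg d_y15 (by decide)
  have o_y9 : T.ip y9 1 = 0 := h.y9_isB.ip_eq_zero_of_deg d_y9 (by decide)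
  have o_d : T.ip d 1 = 0 := h.d_isB.ip_eq_zero_of_deg d_d (by decide)
  have o_D : T.ip (T.bar d) 1 = 0 := h.d_isB.bar.ip_eq_zero_of_deg d_D (by decide)
  have o_z9 : T.ip z9 1 = 0 := h.z9_isB.ip_eq_zero_of_deg d_z9 (by decide)
  have o_y3 : T.ip y3 1 = 0 := h.y3_isB.ip_eq_zero_of_deg d_y3 (by decide)
  have n_B_b : T.bar b ≠ b :=
    (h.b_isB.ne_of_mul (T.bar_bar _) ((sq _).symm.trans p.b3_sq) (by simp only [add_ip, o_c,
        o_b6, add_zero])).symm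
  have n_B_c : T.bar b ≠ c :=
    (h.c_isB.ne_of_mul (T.bar_bar _) ((mul_comm _ _).trans p.b3_mul_c3) (by simp only [add_ip,
        o_B, o_X6, add_zero])).symm
  have n_B_d : T.bar b ≠ d :=
    (h.d_isB.ne_of_mul (T.bar_bar _) ((mul_comm _ _).trans p.b3_mul_d3) (by simp only
        [o_z9])).symm
  have n_B_D : T.bar b ≠ T.bar d :=
    (h.d_isB.bar.ne_of_mul (T.bar_bar _) ((mul_comm _ _).trans p.b3_mul_d3bar) (by simp only
        [o_y9])).symm
  have n_B_y3 : T.bar b ≠ y3 :=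
    (h.y3_isB.ne_of_mul (T.bar_bar _) ((mul_comm _ _).trans p.b3_mul_y3) (by simp only
        [o_X9])).symm
  have n_b_c : b ≠ c :=
    h.b_isB.ne_of_mul r.c_real p.b3_mul_c3 (by simp only [add_ip, o_B, o_X6, add_zero])
  have n_b_d : b ≠ d :=
    h.b_isB.ne_of_mul rfl p.b3_mul_d3bar (by simp only [o_y9])
  have n_b_D : b ≠ T.bar d :=
    h.b_isB.ne_of_mul (T.bar_bar _) p.b3_mul_d3 (by simp only [o_z9])
  have n_b_y3 : b ≠ y3 :=
    h.b_isB.ne_of_mul r.y3_real p.b3_mul_y3 (by simp only [o_X9])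
  have n_c_d : c ≠ d :=
    (h.d_isB.ne_of_mul r.c_real ((mul_comm _ _).trans p.c3_mul_d3) (by simp only [o_x9])).symm
  have n_c_D : c ≠ T.bar d :=
    h.c_isB.ne_of_mul (T.bar_bar _) p.c3_mul_d3 (by simp only [o_x9])
  have n_c_y3 : c ≠ y3 :=
    h.c_isB.ne_of_mul r.y3_real p.c3_mul_y3 (by simp only [o_z9])
  have n_b6_x6 : b6 ≠ x6 :=
    (h.x6_isB.ne_of_mul r.b6_real ((mul_comm _ _).trans p.b6_mul_x6) (by simp only [add_ip,
        ofNat_mul_ip, o_X6, o_X15, o_X9, mul_zero, add_zero])).symm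
  have n_b6_X6 : b6 ≠ T.bar x6 :=
    h.b6_isB.ne_of_mul (T.bar_bar _) p.b6_mul_x6 (by simp only [add_ip, ofNat_mul_ip, o_X6,
        o_X15, o_X9, mul_zero, add_zero])
  have n_x6_X6 : x6 ≠ T.bar x6 :=
    h.x6_isB.ne_of_mul (T.bar_bar _) ((sq _).symm.trans p.x6_sq) (by simp only [add_ip,
        ofNat_mul_ip, o_b6, o_y15, o_y9, mul_zero, add_zero])
  have n_x15_X15 : x15 ≠ T.bar x15 :=
    h.x15_isB.ne_of_mul (T.bar_bar _) ((sq _).symm.trans p.x15_sq) (by simp only [add_ip,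
        ofNat_mul_ip, o_c, o_b6, o_y15, o_y9, o_y3, mul_zero, add_zero])
  have n_x15_y15 : x15 ≠ y15 :=
    h.x15_isB.ne_of_mul r.y15_real p.x15_mul_y15 (by simp only [add_ip, ofNat_mul_ip, o_B, o_X6,
        o_X15, o_X9, o_d, mul_zero, add_zero])
  have n_X15_y15 : T.bar x15 ≠ y15 :=
    (h.y15_isB.ne_of_mul (T.bar_bar _) ((mul_comm _ _).trans p.x15_mul_y15) (by simp only
        [add_ip, ofNat_mul_ip, o_B, o_X6, o_X15, o_X9, o_d, mul_zero, add_zero])).symm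
  have n_x9_X9 : x9 ≠ T.bar x9 :=
    h.x9_isB.ne_of_mul (T.bar_bar _) ((sq _).symm.trans p.x9_sq) (by simp only [add_ip,
        ofNat_mul_ip, o_c, o_b6, o_y15, o_y9, o_y3, mul_zero, add_zero])
  have n_x9_y9 : x9 ≠ y9 :=
    h.x9_isB.ne_of_mul r.y9_real p.x9_mul_y9 (by simp only [add_ip, ofNat_mul_ip, o_B, o_X6,
        o_X15, o_X9, o_d, mul_zero, add_zero])
  have n_x9_z9 : x9 ≠ z9 :=
    h.x9_isB.ne_of_mul r.z9_real p.x9_mul_z9 (by simp only [add_ip, ofNat_mul_ip, o_b, o_x6,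
        o_x15, o_x9, o_D, mul_zero, add_zero])
  have n_X9_y9 : T.bar x9 ≠ y9 :=
    (h.y9_isB.ne_of_mul (T.bar_bar _) ((mul_comm _ _).trans p.x9_mul_y9) (by simp only [add_ip,
        ofNat_mul_ip, o_B, o_X6, o_X15, o_X9, o_d, mul_zero, add_zero])).symm
  have n_X9_z9 : T.bar x9 ≠ z9 :=
    (h.z9_isB.ne_of_mul (T.bar_bar _) ((mul_comm _ _).trans p.x9_mul_z9) (by simp only [add_ip,
        ofNat_mul_ip, o_b, o_x6, o_x15, o_x9, o_D, mul_zero, add_zero])).symm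
  have n_y9_z9 : y9 ≠ z9 :=
    h.y9_isB.ne_of_mul r.z9_real p.y9_mul_z9 (by simp only [add_ip, ofNat_mul_ip, o_c, o_b6,
        o_y15, o_y9, o_y3, mul_zero, add_zero])
  have n_d_D : d ≠ T.bar d :=
    h.d_isB.ne_of_mul (T.bar_bar _) ((sq _).symm.trans p.d3_sq) (by simp only [add_ip, o_b6,
        o_y3, add_zero])
  have n_d_y3 : d ≠ y3 :=
    h.d_isB.ne_of_mul r.y3_real p.d3_mul_y3 (by simp only [add_ip, o_x6, o_D, add_zero])
  have n_D_y3 : T.bar d ≠ y3 :=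
    (h.y3_isB.ne_of_mul (T.bar_bar _) ((mul_comm _ _).trans p.d3_mul_y3) (by simp only [add_ip,
        o_x6, o_D, add_zero])).symm
  have n_b8_c8 := h.b8_ne_c8
  have n_b5_c5 := h.b5_ne_c5
  simp only [List.nodup_cons, List.mem_cons, not_or, List.not_mem_nil, not_false_eq_true,
    List.nodup_nil, and_true]
  and_intros
  all_goals first
    | assumption
    | (intro hh
       have h1 := congrArg T.deg hh
       simp only [d1, d_B, d_b, d_c, d_b6, d_x6, d_X6, d_b8, d_x15, d_X15, d_x10, d_x9, d_X9,
           d_y15, d_y9, d_d, d_D, d_z9, d_c8, d_b5, d_c5, d_y3] at h1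
       norm_num at h1)

end IntTable

/-! ### Closure of the listed elements under multiplication -/

theorem AddSubgroup.ofNat_mul_mem {A : Type*} [CommRing A] (V : AddSubgroup A) (n : ℕ)
    [n.AtLeastTwo] {a : A} (ha : a ∈ V) : ofNat(n) * a ∈ V := by
  have h := V.nsmul_mem ha n
  rwa [nsmul_eq_mul] at h

/-- The elements whose multiples preserve an additive subgroup. -/
def AddSubgroup.multiplierRing {A : Type*} [CommRing A] (V : AddSubgroup A) : Subring A where
  carrier := {a | ∀ v ∈ V, a * v ∈ V}
  mul_mem' := fun {x y} hx hy v hv => by rw [mul_assoc]; exact hx _ (hy _ hv)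
  one_mem' := fun v hv => by rwa [one_mul]
  add_mem' := fun {x y} hx hy v hv => by rw [add_mul]; exact V.add_mem (hx _ hv) (hy _ hv)
  zero_mem' := fun v _ => by rw [zero_mul]; exact V.zero_mem
  neg_mem' := fun {x} hx v hv => by rw [neg_mul]; exact V.neg_mem (hx _ hv)

namespace AddSubgroup

variable {A : Type*} [CommRing A] {S : Set A}

theorem mem_multiplierRing_closure {a : A} (h : ∀ s ∈ S, a * s ∈ closure S) :
    a ∈ (closure S).multiplierRing := fun v hv => by
  induction hv using closure_induction with
  | mem x hx => exact h x hx
  | zero => rw [mul_zero]; exact zero_mem _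
  | add x y _ _ hx hy => rw [mul_add]; exact AddSubgroup.add_mem _ hx hy
  | neg x _ hx => rw [mul_neg]; exact AddSubgroup.neg_mem _ hx

theorem bar_mem_multiplierRing_closure {bar : A →+* A} (hbar : ∀ a, bar (bar a) = a)
    (hS : ∀ s ∈ S, bar s ∈ S) {a : A} (ha : a ∈ (closure S).multiplierRing) :
    bar a ∈ (closure S).multiplierRing := by
  have h : ∀ v ∈ closure S, bar v ∈ closure S := fun v hv => by
    induction hv using closure_induction with
    | mem x hx => exact subset_closure (hS x hx)
    | zero => rw [map_zero]; exact zero_mem _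
    | add x y _ _ hx hy => rw [map_add]; exact AddSubgroup.add_mem _ hx hy
    | neg x _ hx => rw [map_neg]; exact AddSubgroup.neg_mem _ hx
  intro v hv
  have h1 := h _ (ha _ (h v hv))
  rwa [map_mul, hbar] at h1

end AddSubgroup

namespace TableRel

variable {A : Type*} [CommRing A] {bar : A →+* A}
  {b c b6 x6 b8 x15 x10 x9 y15 y9 d z9 c8 b5 c5 y3 : A}

set_option maxHeartbeats 1000000 in
/-- The products of the listed elements are integral combinations of the listed elements. -/
theorem mul_mem_closure (hbar : ∀ a, bar (bar a) = a)
    (h : TableRel bar b c b6 x6 b8 x15 x10 x9 y15 y9 d z9 c8 b5 c5 y3) {S : Set A}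
    (hS : S = {1, bar b, b, c, b6, x6, bar x6, b8, x15, bar x15, x10, x9, bar x9, y15, y9, d,
      bar d, z9, c8, b5, c5, y3}) (hSbar : ∀ s ∈ S, bar s ∈ S) :
    ∀ s ∈ S, ∀ t ∈ S, s * t ∈ AddSubgroup.closure S := by
  set V := AddSubgroup.closure S with hV
  have hm : ∀ s ∈ S, s ∈ V := fun s hs => AddSubgroup.subset_closure hs
  have hm' := hm
  rw [hS] at hm'
  simp only [Set.mem_insert_iff, Set.mem_singleton_iff, forall_eq_or_imp, forall_eq] at hm'
  obtain ⟨m1, mB, mb, mc, mb6, mx6, mX6, mb8, mx15, mX15, mx10, mx9, mX9, my15, my9, md, mD, mz9,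
    mc8, mb5, mc5, my3⟩ := hm'
  have hwm : ∀ {a}, a ∈ V.multiplierRing → a ∈ V := fun {a} ha => by
    have h1 := ha 1 m1
    rwa [mul_one] at h1
  have hWbar : ∀ {a}, a ∈ V.multiplierRing → bar a ∈ V.multiplierRing := fun ha =>
    AddSubgroup.bar_mem_multiplierRing_closure hbar hSbar ha
  have wb : b ∈ V.multiplierRing := by
    refine AddSubgroup.mem_multiplierRing_closure fun s hs => ?_
    rw [hS] at hs
    rcases hs with hs | hs | hs | hs | hs | hs | hs | hs | hs | hs | hs | hs | hs | hs |
      hs | hs | hs | hs | hs | hs | hs | hs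
    all_goals rw [hs]
    all_goals simp only [mul_one, h.b_bbar, h.b_b, h.b_c, h.b_b6, h.b_x6, h.b_x6bar, h.b_b8,
      h.b_x15, h.b_x15bar, h.b_x10, h.b_x9, h.b_x9bar, h.b_y15, h.b_y9, h.b_d, h.b_dbar, h.b_z9,
      h.b_c8, h.b_b5, h.b_c5, h.b_y3]
    all_goals repeat first
      | assumption
      | refine V.add_mem ?_ ?_
      | refine V.ofNat_mul_mem _ ?_
  have wB := hWbar wb
  have wc : c ∈ V.multiplierRing := by
    have hB : ∀ {x y}, c * x = y → c * bar x = bar y := fun {x y} hx => by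
      rw [← hx, map_mul, h.c_real]
    refine AddSubgroup.mem_multiplierRing_closure fun s hs => ?_
    rw [hS] at hs
    rcases hs with hs | hs | hs | hs | hs | hs | hs | hs | hs | hs | hs | hs | hs | hs |
      hs | hs | hs | hs | hs | hs | hs | hs
    all_goals rw [hs]
    all_goals simp only [mul_one, mul_comm c b, h.c_c, h.b_c, h.c_b6, h.c_x6, hB h.c_x6, h.c_b8,
      h.c_x15, hB h.c_x15, h.c_x10, h.c_x9, hB h.c_x9, h.c_y15, h.c_y9, h.c_d, hB h.c_d, h.c_z9,
      h.c_c8, h.c_b5, h.c_c5, h.c_y3, hB ((mul_comm c b).trans h.b_c), map_add, map_mul,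
      map_ofNat, hbar]
    all_goals repeat first
      | assumption
      | refine V.add_mem ?_ ?_
      | refine V.ofNat_mul_mem _ ?_
  -- The multipliers form a ring containing `b`, its conjugate and `c`, so no full table is needed:
  -- the remaining elements are peeled off from products and sums of known multipliers.
  have sub : ∀ {x y z : A}, x * y = z → x ∈ V.multiplierRing → y ∈ V.multiplierRing →
      z ∈ V.multiplierRing := fun h hx hy => h ▸ mul_mem hx hy
  have addl : ∀ {x y : A}, x + y ∈ V.multiplierRing → y ∈ V.multiplierRing →
      x ∈ V.multiplierRing := fun {x y} h hy => by
    have h1 := sub_mem h hy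
    rwa [add_sub_cancel_right] at h1
  have addr : ∀ {x y : A}, x + y ∈ V.multiplierRing → x ∈ V.multiplierRing →
      y ∈ V.multiplierRing := fun {x y} h hy => by
    have h1 := sub_mem h hy
    rwa [add_sub_cancel_left] at h1
  have w1 : (1 : A) ∈ V.multiplierRing := one_mem _
  have wb8 := addr (sub h.c_c wc wc) w1
  have wb6 := addr (sub h.b_b wb wb) wc
  have wX6 := addr (sub h.b_c wb wc) wB
  have wx6 := hWbar wX6
  rw [hbar] at wx6
  have wX15 := addr (sub h.b_b6 wb wb6) wB
  have wx15 := hWbar wX15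
  rw [hbar] at wx15
  have wy15 := addr (sub h.b_x6 wb wx6) wc
  have wx10 := addr (sub h.b_x6bar wb wX6) wb8
  have wx9 := addr (sub h.b_x10 wb wx10) (add_mem wx15 wx6)
  have wX9 := hWbar wx9
  have wy9 := addr (sub h.b_x15 wb wx15) (add_mem (mul_mem (ofNat_mem _ 2) wy15) wb6)
  have wy3 := addr (sub h.b_x9 wb wx9) (add_mem wy9 wy15)
  have wd := addl (addl (sub h.b_y9 wb wy9) wX9) wX15
  have wD := hWbar wd
  have wz9 := sub h.b_d wb wd
  have wc8 := addr (sub h.b_x9bar wb wX9) (add_mem wx10 wz9)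
  -- Only the sum is reachable in this way, since the rows of `b` and `c` do not distinguish b₅ from
  -- c₅.
  have w55 : b5 + c5 ∈ V.multiplierRing := by
    refine addr (x := x10 + b8 + z9 + c8) ?_ (add_mem (add_mem (add_mem wx10 wb8) wz9) wc8)
    have h1 := sub h.b_x15bar wb wX15
    rwa [add_assoc _ b5 c5] at h1
  -- By commutativity, products of b₅ with known multipliers are covered; just b₅² and b₅c₅ need
  -- their explicit values.
  have wb5 : b5 ∈ V.multiplierRing := by
    refine AddSubgroup.mem_multiplierRing_closure fun s hs => ?_
    have hcomm : s ∈ V.multiplierRing → b5 * s ∈ V := fun hs => mul_comm s b5 ▸ hs _ mb5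
    rw [hS] at hs
    rcases hs with hs | hs | hs | hs | hs | hs | hs | hs | hs | hs | hs | hs | hs | hs |
      hs | hs | hs | hs | hs | hs | hs | hs
    all_goals rw [hs] at hcomm ⊢
    all_goals first
      | exact hcomm (by assumption)
      | (simp only [h.b5_b5, h.b5_c5]
         repeat first
          | assumption
          | refine V.add_mem ?_ ?_)
  have wc5 := addr w55 wb5
  intro s hs t ht
  refine (?_ : s ∈ V.multiplierRing) t (hm t ht)
  rw [hS] at hs
  rcases hs with hs | hs | hs | hs | hs | hs | hs | hs | hs | hs | hs | hs | hs | hs |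
    hs | hs | hs | hs | hs | hs | hs | hs
  all_goals rw [hs]
  all_goals assumption

end TableRel

/-- The products of the listed real elements are integral combinations of these elements. -/
theorem B22Products.mul_mem_closure {A : Type*} [CommRing A] {bar : A → A}
    {b c b6 x6 b8 x15 x10 x9 y15 y9 d z9 c8 b5 c5 y3 : A}
    (p : B22Products bar b c b6 x6 b8 x15 x10 x9 y15 y9 d z9 c8 b5 c5 y3) {S : Set A}
    (hS : S = {1, b8, x10, z9, c8, b5, c5}) :
    ∀ s ∈ S, ∀ t ∈ S, s * t ∈ AddSubgroup.closure S := by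
  set V := AddSubgroup.closure S with hV
  have hm : ∀ s ∈ S, s ∈ V := fun s hs => AddSubgroup.subset_closure hs
  rw [hS] at hm ⊢
  simp only [Set.mem_insert_iff, Set.mem_singleton_iff, forall_eq_or_imp, forall_eq] at hm ⊢
  obtain ⟨m1, mb8, mx10, mz9, mc8, mb5, mc5⟩ := hm
  simp only [one_pow, mul_one, one_mul, ← sq, p.b8_sq, p.x10_sq, p.z9_sq, p.c8_sq, p.b5_sq, p.c5_sq,
    p.b8_mul_x10, p.b8_mul_z9, p.b8_mul_c8, p.b8_mul_b5, p.b8_mul_c5, p.x10_mul_z9,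
    p.x10_mul_c8, p.x10_mul_b5, p.x10_mul_c5, p.z9_mul_c8, p.z9_mul_b5, p.z9_mul_c5,
    p.c8_mul_b5, p.c8_mul_c5, p.b5_mul_c5, mul_comm x10 b8, mul_comm z9 b8, mul_comm c8 b8,
    mul_comm b5 b8, mul_comm c5 b8, mul_comm z9 x10, mul_comm c8 x10, mul_comm b5 x10,
    mul_comm c5 x10, mul_comm c8 z9, mul_comm b5 z9, mul_comm c5 z9, mul_comm b5 c8,
    mul_comm c5 c8, mul_comm c5 b5]
  and_intros
  all_goals repeat first
    | assumption
    | refine V.add_mem ?_ ?_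
    | refine V.ofNat_mul_mem _ ?_

theorem TableRel.map {A R : Type*} [CommRing A] [CommRing R] {barA : A → A}
    {bar : R → R} (φ : R →+* A) (hφ : ∀ a, φ (bar a) = barA (φ a))
    {b c b6 x6 b8 x15 x10 x9 y15 y9 d z9 c8 b5 c5 y3 : R}
    (h : TableRel bar b c b6 x6 b8 x15 x10 x9 y15 y9 d z9 c8 b5 c5 y3) :
    TableRel barA (φ b) (φ c) (φ b6) (φ x6) (φ b8) (φ x15) (φ x10) (φ x9) (φ y15) (φ y9) (φ d)
      (φ z9) (φ c8) (φ b5) (φ c5) (φ y3) := by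
  have h2 : φ 2 = 2 := map_ofNat φ 2
  constructor
  · simpa only [map_mul, map_add, map_one, h2, hφ] using congrArg φ h.c_real
  · simpa only [map_mul, map_add, map_one, h2, hφ] using congrArg φ h.b6_real
  · simpa only [map_mul, map_add, map_one, h2, hφ] using congrArg φ h.b8_real
  · simpa only [map_mul, map_add, map_one, h2, hφ] using congrArg φ h.x10_real
  · simpa only [map_mul, map_add, map_one, h2, hφ] using congrArg φ h.y15_real
  · simpa only [map_mul, map_add, map_one, h2, hφ] using congrArg φ h.y9_real
  · simpa only [map_mul, map_add, map_one, h2, hφ] using congrArg φ h.z9_real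
  · simpa only [map_mul, map_add, map_one, h2, hφ] using congrArg φ h.c8_real
  · simpa only [map_mul, map_add, map_one, h2, hφ] using congrArg φ h.b5_real
  · simpa only [map_mul, map_add, map_one, h2, hφ] using congrArg φ h.c5_real
  · simpa only [map_mul, map_add, map_one, h2, hφ] using congrArg φ h.y3_real
  · simpa only [map_mul, map_add, map_one, h2, hφ] using congrArg φ h.b_bbar
  · simpa only [map_mul, map_add, map_one, h2, hφ] using congrArg φ h.b_b
  · simpa only [map_mul, map_add, map_one, h2, hφ] using congrArg φ h.b_c
  · simpa only [map_mul, map_add, map_one, h2, hφ] using congrArg φ h.b_b6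
  · simpa only [map_mul, map_add, map_one, h2, hφ] using congrArg φ h.b_x6
  · simpa only [map_mul, map_add, map_one, h2, hφ] using congrArg φ h.b_x6bar
  · simpa only [map_mul, map_add, map_one, h2, hφ] using congrArg φ h.b_b8
  · simpa only [map_mul, map_add, map_one, h2, hφ] using congrArg φ h.b_x15
  · simpa only [map_mul, map_add, map_one, h2, hφ] using congrArg φ h.b_x15bar
  · simpa only [map_mul, map_add, map_one, h2, hφ] using congrArg φ h.b_x10
  · simpa only [map_mul, map_add, map_one, h2, hφ] using congrArg φ h.b_x9
  · simpa only [map_mul, map_add, map_one, h2, hφ] using congrArg φ h.b_x9bar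
  · simpa only [map_mul, map_add, map_one, h2, hφ] using congrArg φ h.b_y15
  · simpa only [map_mul, map_add, map_one, h2, hφ] using congrArg φ h.b_y9
  · simpa only [map_mul, map_add, map_one, h2, hφ] using congrArg φ h.b_d
  · simpa only [map_mul, map_add, map_one, h2, hφ] using congrArg φ h.b_dbar
  · simpa only [map_mul, map_add, map_one, h2, hφ] using congrArg φ h.b_z9
  · simpa only [map_mul, map_add, map_one, h2, hφ] using congrArg φ h.b_c8
  · simpa only [map_mul, map_add, map_one, h2, hφ] using congrArg φ h.b_b5
  · simpa only [map_mul, map_add, map_one, h2, hφ] using congrArg φ h.b_c5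
  · simpa only [map_mul, map_add, map_one, h2, hφ] using congrArg φ h.b_y3
  · simpa only [map_mul, map_add, map_one, h2, hφ] using congrArg φ h.c_c
  · simpa only [map_mul, map_add, map_one, h2, hφ] using congrArg φ h.c_b6
  · simpa only [map_mul, map_add, map_one, h2, hφ] using congrArg φ h.c_x6
  · simpa only [map_mul, map_add, map_one, h2, hφ] using congrArg φ h.c_b8
  · simpa only [map_mul, map_add, map_one, h2, hφ] using congrArg φ h.c_x15
  · simpa only [map_mul, map_add, map_one, h2, hφ] using congrArg φ h.c_x10
  · simpa only [map_mul, map_add, map_one, h2, hφ] using congrArg φ h.c_x9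
  · simpa only [map_mul, map_add, map_one, h2, hφ] using congrArg φ h.c_y15
  · simpa only [map_mul, map_add, map_one, h2, hφ] using congrArg φ h.c_y9
  · simpa only [map_mul, map_add, map_one, h2, hφ] using congrArg φ h.c_d
  · simpa only [map_mul, map_add, map_one, h2, hφ] using congrArg φ h.c_z9
  · simpa only [map_mul, map_add, map_one, h2, hφ] using congrArg φ h.c_c8
  · simpa only [map_mul, map_add, map_one, h2, hφ] using congrArg φ h.c_b5
  · simpa only [map_mul, map_add, map_one, h2, hφ] using congrArg φ h.c_c5
  · simpa only [map_mul, map_add, map_one, h2, hφ] using congrArg φ h.c_y3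
  · simpa only [map_mul, map_add, map_one, h2, hφ] using congrArg φ h.b5_b5
  · simpa only [map_mul, map_add, map_one, h2, hφ] using congrArg φ h.b5_c5

/-! ### Table subsets and the conclusion -/

namespace TableAlgebra

variable {ι A : Type*} [Fintype ι] [CommRing A] [Algebra ℂ A] (T : TableAlgebra ι A)

/-- A set of basis elements is a table subset if its products are integral combinations of its
elements. -/
theorem isTableSubset_of_closure {S : Set A} (hS : S ⊆ T.B) (h1 : (1 : A) ∈ S)
    (hbar : ∀ a ∈ S, T.bar a ∈ S) (hmul : ∀ s ∈ S, ∀ t ∈ S, s * t ∈ AddSubgroup.closure S) :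
    T.IsTableSubset S := by
  have key : ∀ v ∈ AddSubgroup.closure S, ∀ i, T.basis.repr v i ≠ 0 → T.basis i ∈ S := by
    intro v hv i
    contrapose!
    intro hi
    induction hv using AddSubgroup.closure_induction with
    | mem x hx =>
      obtain ⟨j, rfl⟩ := hS hx
      rw [T.basis.repr_self, Finsupp.single_apply_eq_zero]
      rintro rfl
      exact absurd hx hi
    | zero => simp
    | add x y _ _ hx hy => simp [hx, hy]
    | neg x _ hx => simp [hx]
  exact ⟨hS, h1, hbar, fun a ha c hc => key _ (hmul a ha c hc)⟩

theorem isTableSubset_one : T.IsTableSubset {1} :=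
  T.isTableSubset_of_closure (Set.singleton_subset_iff.2 ⟨T.one, T.basis_one⟩) rfl
    (fun a ha => by rw [Set.mem_singleton_iff.1 ha, map_one]; rfl)
    fun s hs t ht => by
      rw [Set.mem_singleton_iff.1 hs, Set.mem_singleton_iff.1 ht, mul_one]
      exact AddSubgroup.subset_closure rfl

theorem isTableSubset_B : T.IsTableSubset T.B :=
  ⟨subset_rfl, ⟨T.one, T.basis_one⟩, by
    rintro _ ⟨i, rfl⟩
    obtain ⟨j, hj⟩ := T.bar_basis i
    exact ⟨j, hj.symm⟩, fun _ _ _ _ i _ => ⟨i, rfl⟩⟩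

end TableAlgebra

theorem theorem8p1 {ι A : Type*} [Fintype ι] [CommRing A] [Algebra ℂ A] (T : TableAlgebra ι A)
    (hT : T.IsNITA)
    (b3 b8 c3 b6 : A)
    (hb3 : T.IsBasisElt 3 b3) (hb3_nonreal : ¬ T.IsReal b3) (hgen : T.IsGeneratedBy b3)
    (hdeg : ∀ a ∈ T.B, a ≠ 1 → T.degree a ≠ 1 ∧ T.degree a ≠ 2)
    (hb8 : T.IsBasisElt 8 b8) (hc3 : T.IsBasisElt 3 c3) (hb6 : T.IsBasisElt 6 b6)
    (hb3_bar : T.bar b3 * b3 = 1 + b8)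
    (hb3_sq : b3 ^ 2 = c3 + b6) (hc3_real : T.IsReal c3)
    (hform : T.form (b8 * b3) (b8 * b3) = 3) :
    ∃ x6 x15 x10 x9 y15 y9 d3 z9 c8 b5 c5 y3 : A,
      -- the algebra has dimension 22 and its basis consists of 22 distinct listed elements
      Module.finrank ℂ A = 22 ∧
      T.B = {1, T.bar b3, b3, c3, b6, x6, T.bar x6, b8, x15, T.bar x15, x10, x9, T.bar x9, y15,
        y9, d3, T.bar d3, z9, c8, b5, c5, y3} ∧
      T.B.ncard = 22 ∧
      -- the subscripts are the degrees
      (T.IsBasisElt 6 x6 ∧ T.IsBasisElt 15 x15 ∧ T.IsBasisElt 10 x10 ∧ T.IsBasisElt 9 x9 ∧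
        T.IsBasisElt 15 y15 ∧ T.IsBasisElt 9 y9 ∧ T.IsBasisElt 3 d3 ∧ T.IsBasisElt 9 z9 ∧
        T.IsBasisElt 8 c8 ∧ T.IsBasisElt 5 b5 ∧ T.IsBasisElt 5 c5 ∧ T.IsBasisElt 3 y3) ∧
      -- the basis elements listed without a conjugate are real
      (T.IsReal b6 ∧ T.IsReal b8 ∧ T.IsReal x10 ∧ T.IsReal y15 ∧ T.IsReal y9 ∧ T.IsReal z9 ∧
        T.IsReal c8 ∧ T.IsReal b5 ∧ T.IsReal c5 ∧ T.IsReal y3) ∧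
      -- the increasing series of table subsets
      (T.IsTableSubset {1} ∧ T.IsTableSubset {1, b8, x10, z9, c8, b5, c5} ∧
        T.IsTableSubset T.B ∧
        ({1} : Set A) ⊆ {1, b8, x10, z9, c8, b5, c5} ∧
        ({1, b8, x10, z9, c8, b5, c5} : Set A) ⊆ T.B) ∧
      -- the multiplication table
      B22Products T.bar b3 c3 b6 x6 b8 x15 x10 x9 y15 y9 d3 z9 c8 b5 c5 y3 := by
  classical
  have hex : ∃ f : A →ₐ[ℂ] ℂ, T.IsDegreeHom f := by
    -- Without a degree homomorphism `degree` takes its default value 0, contradicting the degree 3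
    -- of the generator.
    by_contra hno
    have h := hb3.2
    rw [TableAlgebra.degree, dif_neg hno] at h
    norm_num at h
  obtain ⟨f, hf⟩ := hex
  obtain ⟨I, hIe, hIc, hIb, hId⟩ := T.exists_intTable hT hf hdeg
  have lift : ∀ {n : ℕ} {a : A}, T.IsBasisElt n a →
      ∃ a' : T.intSubring hT, (a' : A) = a ∧ I.IsB a' ∧ I.deg a' = n := by
    rintro n a ⟨⟨i, rfl⟩, hn⟩
    refine ⟨I.e i, hIe i, ⟨i, rfl⟩, ?_⟩
    have h := hId (I.e i)
    rw [hIe, hn] at h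
    exact_mod_cast h.symm
  have unlift : ∀ {n : ℕ} {a : T.intSubring hT}, I.IsB a → I.deg a = n →
      T.IsBasisElt n (a : A) := by
    rintro n _ ⟨i, rfl⟩ hn
    refine ⟨⟨i, (hIe i).symm⟩, ?_⟩
    rw [hId, hn]
    rfl
  obtain ⟨b, rfl, bB, bd⟩ := lift hb3
  obtain ⟨b8, rfl, b8B, b8d⟩ := lift hb8
  obtain ⟨c, rfl, cB, cd⟩ := lift hc3
  obtain ⟨b6, rfl, b6B, b6d⟩ := lift hb6
  have hstart : I.Start b b8 c b6 :=
    { b_isB := bB, b8_isB := b8B, c_isB := cB, b6_isB := b6B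
      b_deg := bd, b8_deg := b8d, c_deg := cd, b6_deg := b6d
      b_nonreal := fun h => hb3_nonreal (by
        rw [TableAlgebra.IsReal, ← hIb, h])
      c_real := Subtype.ext ((hIb c).trans hc3_real)
      bar_mul := Subtype.ext (by
        push_cast
        rw [hIb, hb3_bar])
      sq := Subtype.ext (by
        push_cast
        rw [← sq, hb3_sq])
      norm := by
        have h := hform
        rw [TableAlgebra.form] at h
        simp only [← Subring.coe_mul, hIc, map_intCast] at h
        rw [IntTable.ip]
        exact_mod_cast h }
  obtain ⟨x6, x15, y15, x10, x9, y9, Q, hcore⟩ := hstart.exists_core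
  obtain ⟨d, z9, c8, b5, c5, y3, hfin⟩ := hcore.exists_final
  have hrel := hfin.rel.map (T.intSubring hT).subtype (barA := T.bar) hIb
  simp only [Subring.coe_subtype] at hrel
  have hbb := T.bar_bar
  have hprod := TableRel.products (bar := (T.bar : A →+* A)) hbb hrel
  have hbarB : ∀ {a : T.intSubring hT}, I.IsB a → T.bar (a : A) ∈ T.B := fun {a} ha => by
    obtain ⟨i, hi⟩ := ha.bar
    exact ⟨i, by rw [← hIb, ← hi, hIe]⟩
  have hB : ∀ {a : T.intSubring hT}, I.IsB a → (a : A) ∈ T.B := by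
    rintro _ ⟨i, rfl⟩
    exact ⟨i, (hIe i).symm⟩
  have h1B : (1 : A) ∈ T.B := ⟨T.one, T.basis_one⟩
  have hall : T.B = {1, T.bar (b : A), (b : A), (c : A), (b6 : A), (x6 : A), T.bar (x6 : A),
      (b8 : A), (x15 : A), T.bar (x15 : A), (x10 : A), (x9 : A), T.bar (x9 : A), (y15 : A),
      (y9 : A), (d : A), T.bar (d : A), (z9 : A), (c8 : A), (b5 : A), (c5 : A), (y3 : A)} := by
    -- The listed elements form a table subset containing the generator, so by hypothesis they
    -- exhaust the basis.
    refine (hgen _ (T.isTableSubset_of_closure ?_ (by simp) ?_ ?_) (by simp)).symm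
    · simp only [Set.insert_subset_iff, Set.singleton_subset_iff]
      exact ⟨h1B, hbarB bB, hB bB, hB cB, hB b6B, hB hfin.x6_isB, hbarB hfin.x6_isB, hB b8B,
        hB hfin.x15_isB, hbarB hfin.x15_isB, hB hfin.x10_isB, hB hfin.x9_isB, hbarB hfin.x9_isB,
        hB hfin.y15_isB, hB hfin.y9_isB, hB hfin.d_isB, hbarB hfin.d_isB, hB hfin.z9_isB,
        hB hfin.c8_isB, hB hfin.b5_isB, hB hfin.c5_isB, hB hfin.y3_isB⟩
    · simp only [Set.mem_insert_iff, Set.mem_singleton_iff, forall_eq_or_imp, forall_eq, map_one,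
        hbb, hrel.c_real, hrel.b6_real, hrel.b8_real, hrel.x10_real, hrel.y15_real,
        hrel.y9_real, hrel.z9_real, hrel.c8_real, hrel.b5_real, hrel.c5_real, hrel.y3_real,
        true_or, or_true, and_true]
    · refine TableRel.mul_mem_closure (bar := (T.bar : A →+* A)) hbb hrel rfl ?_
      simp only [RingHom.coe_coe, Set.mem_insert_iff, Set.mem_singleton_iff, forall_eq_or_imp,
        forall_eq, map_one,
        hbb, hrel.c_real, hrel.b6_real, hrel.b8_real, hrel.x10_real, hrel.y15_real,
        hrel.y9_real, hrel.z9_real, hrel.c8_real, hrel.b5_real, hrel.c5_real, hrel.y3_real,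
        true_or, or_true, and_true]
  have hcard : T.B.ncard = 22 := by
    have hnd := hfin.nodup.map Subtype.val_injective
    simp only [List.map_cons, List.map_nil, hIb, Subring.coe_one] at hnd
    have h := List.toFinset_card_of_nodup hnd
    rw [← Set.ncard_coe_finset] at h
    rw [hall]
    simpa using h
  have hNB : ({1, (b8 : A), (x10 : A), (z9 : A), (c8 : A), (b5 : A), (c5 : A)} : Set A) ⊆ T.B := by
    simp only [Set.insert_subset_iff, Set.singleton_subset_iff]
    exact ⟨h1B, hB b8B, hB hfin.x10_isB, hB hfin.z9_isB, hB hfin.c8_isB, hB hfin.b5_isB,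
      hB hfin.c5_isB⟩
  refine ⟨x6, x15, x10, x9, y15, y9, d, z9, c8, b5, c5, y3, ?_, hall, hcard,
    ⟨unlift hfin.x6_isB hfin.x6_deg, unlift hfin.x15_isB hfin.x15_deg,
      unlift hfin.x10_isB hfin.x10_deg, unlift hfin.x9_isB hfin.x9_deg,
      unlift hfin.y15_isB hfin.y15_deg, unlift hfin.y9_isB hfin.y9_deg,
      unlift hfin.d_isB hfin.d_deg, unlift hfin.z9_isB hfin.z9_deg,
      unlift hfin.c8_isB hfin.c8_deg, unlift hfin.b5_isB hfin.b5_deg,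
      unlift hfin.c5_isB hfin.c5_deg, unlift hfin.y3_isB hfin.y3_deg⟩,
    ⟨hrel.b6_real, hrel.b8_real, hrel.x10_real, hrel.y15_real, hrel.y9_real, hrel.z9_real,
      hrel.c8_real, hrel.b5_real, hrel.c5_real, hrel.y3_real⟩,
    ⟨T.isTableSubset_one, T.isTableSubset_of_closure hNB (by simp) ?_
      (hprod.mul_mem_closure rfl), T.isTableSubset_B, by simp, hNB⟩, hprod⟩
  · rw [Module.finrank_eq_nat_card_basis T.basis, ← hcard, TableAlgebra.B, ← Set.image_univ,
      Set.ncard_image_of_injective _ T.basis.injective, Set.ncard_univ]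
  · simp only [Set.mem_insert_iff, Set.mem_singleton_iff, forall_eq_or_imp, forall_eq, map_one,
      hrel.b8_real, hrel.x10_real, hrel.z9_real, hrel.c8_real, hrel.b5_real, hrel.c5_real,
      true_or, or_true, and_true]
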